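/- **Setting.** Let $S=\mathbb R/2\pi\mathbb Z$. A configuration $\hat\eta$ on $\mathbb Z^2$ has at each site $x$ either no particle or one particle, of type $\sigma\in\{a,p\}$ and with an angle $\theta_x\in S$. Write $\eta^\sigma_x\in\{0,1\}$ for the number of type-$\sigma$ particles at $x$, $\eta_x=\eta^a_x+\eta^p_x$, and $\eta^{\sigma,\Phi}_x=\Phi(\theta_x)\eta^\sigma_x$ for $\Phi:S\to\mathbb R$. Let $(\tau_xf)(\hat\eta)=f(\tau_x\hat\eta)$, $(\tau_x\hat\eta)_y=\hat\eta_{x+y}$; let $\hat\eta^{x,y}$ be $\hat\eta$ with the contents of $x,y$ exchanged, $\widetilde\nabla_{x,y}f(\hat\eta)=f(\hat\eta^{x,y})-f(\hat\eta)$, $\nabla_{x,y}=\eta_x(1-\eta_y)\widetilde\nabla_{x,y}$, and $\mathcal L=\sum_x\sum_{|z|=1}\nabla_{x,x+z}$. For $i=1,2$ put $$j_i^{\sigma,\Phi}=\eta_0^{\sigma,\Phi}(1-\eta_{e_i})-\eta_{e_i}^{\sigma,\Phi}(1-\eta_0),\quad j_i^\sigma=j_i^{\sigma,1},\quad \delta_i\eta^{\sigma,\Phi}=\eta^{\sigma,\Phi}_{e_i}-\eta^{\sigma,\Phi}_0,\quad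 \delta_i\eta^\sigma=\eta^\sigma_{e_i}-\eta^\sigma_0,\quad \delta_i\eta=\eta_{e_i}-\eta_0 .$$ Fix $\omega\in C^2(S)$ and $\hat\alpha=(\hat\alpha^a,\hat\alpha^p)$, a pair of non-negative measures on $S$ with masses $\alpha^a,\alpha^p$, $\alpha=\alpha^a+\alpha^p\le1$. $\mathbb E_{\hat\alpha}$ is the expectation for independent sites, each carrying a type-$\sigma$ particle with angle in $d\theta$ with probability $\hat\alpha^\sigma(d\theta)$ and being empty with probability $1-\alpha$. Put $\overline\omega^\sigma=\mathbb E_{\hat\alpha}[\omega(\theta_0)\mid\eta_0^\sigma=1]$ (any value if $\alpha^\sigma=0$), $j_i^{\sigma,\hat\omega}=j_i^{\sigma,\omega}-\overline\omega^\sigma j_i^\sigma$, $\delta_i\eta^{\sigma,\hat\omega}=\delta_i\eta^{\sigma,\omega}-\overline\omega^\sigma\delta_i\eta^\sigma$. **Function classes.** A cylinder function depends on finitely many sites and is $C^2$ in the angles. $\mathcal C_0$ is the space of cylinder functions with mean zero under every canonical measure with at least two empty sites on a box $B_l=\{-l,\dots,l\}^2$ containing their support (the canonical measure is uniform over all arrangements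 in $B_l$ of given particles). $\mathcal S$ is the set of functions of finitely many $\eta_x$. $T^\omega$ is the span of the cylinder functions $\sum_x(a\eta^a_x+b\eta^p_x+c\eta^{a,\omega}_x+d\eta^{p,\omega}_x)F_x$ (finite sums, $F_x\in\mathcal S$), and $\mathcal T_0^\omega=\mathcal C_0\cap T^\omega$. **Semi-norm.** For $j=\sum_{\sigma,i}j_i^{\sigma,\Phi_i^\sigma}$, local $g$ and $\varphi\in\mathcal T_0^\omega$ put, with $\Sigma_g=\sum_x\tau_xg$ (a formal sum), $$\ll j+\mathcal Lg\gg_{\hat\alpha}=\sum_{\sigma,i}\mathbb E_{\hat\alpha}\big[\eta_0^\sigma(1-\eta_{e_i})(\Phi_i^\sigma(\theta_0)+\widetilde\nabla_{0,e_i}\Sigma_g)^2\big],$$ $$\ll\varphi,j+\mathcal Lg\gg_{\hat\alpha}=-\mathbb E_{\hat\alpha}\Big[\varphi\Big(\Sigma_g+\sum_i\sum_xx_i(\eta_x^{a,\Phi_i^a}+\eta_x^{p,\Phi_i^p})\Big)\Big],$$ $$\ll\varphi\gg_{\hat\alpha}=\sup\big\{2\ll\varphi,j+\mathcal Lg\gg_{\hat\alpha}-\ll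 j+\mathcal Lg\gg_{\hat\alpha}\big\}\in[0,\infty],$$ the supremum being over $g\in\mathcal T_0^\omega$ and $\Phi_i^\sigma\in\mathrm{span}\{1,\omega\}$. $\overline{\mathcal L\mathcal T_0^\omega}$ is the closure of $\mathcal L\mathcal T_0^\omega$ in $\mathcal T_0^\omega$ with respect to $\ll\cdot\gg_{\hat\alpha}^{1/2}$ (whose completion is the Hilbert space $\mathcal H^\omega_{\hat\alpha}$). **Self-diffusion.** $d_s(\rho)$ is the self-diffusion coefficient of the symmetric simple exclusion process on $\mathbb Z^2$ at density $\rho\in[0,1]$, given by $x^\top D_s(\rho)x=d_s(\rho)|x|^2$ with $$x^\top D_s(\rho)x=\inf_{f\in\mathcal S}\sum_{i=1,2}\mathbb E_\rho\Big[(1-\eta_{e_i})\big(x_i+(\tau_{e_i}f)(\eta^{0,e_i})-f\big)^2+\sum_{y\ne0,e_i}(\nabla_{0,e_i}\tau_yf)^2\Big],$$ where under $\mathbb E_\rho$ the $\eta_x$ are independent Bernoulli($\rho$). Put $\mathcal D(\rho)=(1-d_s(\rho))/\rho$, extended to $\rho=0$ by its limit, and $\mathfrak d(\hat\alpha)=\mathbb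 E_{\hat\alpha}[\eta_0^{a,\omega}]\,\mathcal D(\alpha)$. **Proposition.** For $i=1,2$ and $\sigma\in\{a,p\}$, $$\inf_{g\in\mathcal T_0^\omega}\ll j_i^\sigma+d_s(\alpha)\delta_i\eta^\sigma+\alpha^\sigma\mathcal D(\alpha)\delta_i\eta+\mathcal Lg\gg_{\hat\alpha}=0,$$ $$\inf_{g\in\mathcal T_0^\omega}\ll j_i^{\sigma,\hat\omega}+d_s(\alpha)\delta_i\eta^{\sigma,\hat\omega}+\mathcal Lg\gg_{\hat\alpha}=0,$$ and consequently $$\inf_{g\in\mathcal T_0^\omega}\ll j_i^{a,\omega}+d_s(\alpha)\delta_i\eta^{a,\omega}+\mathfrak d(\hat\alpha)\delta_i\eta+\mathcal Lg\gg_{\hat\alpha}=0.$$ In other words, $j_i^\sigma+d_s(\alpha)\delta_i\eta^\sigma+\alpha^\sigma\mathcal D(\alpha)\delta_i\eta$, $\;j_i^{\sigma,\hat\omega}+d_s(\alpha)\delta_i\eta^{\sigma,\hat\omega}$ and $\;j_i^{a,\omega}+d_s(\alpha)\delta_i\eta^{a,\omega}+\mathfrak d(\hat\alpha)\delta_i\eta$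 all lie in $\overline{\mathcal L\mathcal T_0^\omega}$. -/

import Mathlib

noncomputable section

open MeasureTheory Filter Topology

namespace APLG

/-! ### Configurations -/

/-- The angular torus `[0, 2π)`. -/
abbrev Angle : Type := AddCircle (2 * Real.pi)

/-- The lattice `ℤ²`. -/
abbrev Lattice : Type := Fin 2 → ℤ

/-- The two particle types. -/
inductive Species : Type
  | active
  | passive
  deriving DecidableEq

instance : Fintype Species := ⟨{.active, .passive}, fun σ => by cases σ <;> decide⟩

/-- The state of a site: empty, or occupied by one particle carrying a type and an angle. -/
inductive Site : Type
  | empty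
  | particle (σ : Species) (θ : Angle)

/-- The σ-algebra of the disjoint union of a point and two circles. -/
instance : MeasurableSpace Site :=
  ⨅ σ : Species, MeasurableSpace.map (Site.particle σ) inferInstance

/-- Infinite configurations. -/
abbrev Config : Type := Lattice → Site

/-- The angle at a site, `0` by default when the site is empty. -/
def Site.angle : Site → Angle
  | .empty => 0
  | .particle _ θ => θ

/-- The number of particles of type `σ` at a site. -/
def Site.num (σ : Species) : Site → ℝ
  | .empty => 0
  | .particle τ _ => if τ = σ then 1 else 0

/-- Replace the angle of the particle at a site, if there is one. -/
def Site.setAngle (θ : Angle) : Site → Site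
  | .empty => .empty
  | .particle σ _ => .particle σ θ

/-- `η^σ_x`. -/
def occ (σ : Species) (x : Lattice) (η : Config) : ℝ := (η x).num σ

/-- `η_x = η^a_x + η^p_x`. -/
def occTot (x : Lattice) (η : Config) : ℝ := ∑ σ, occ σ x η

/-- `η^{σ,Φ}_x = Φ(θ_x) η^σ_x`. -/
def occAng (σ : Species) (Φ : Angle → ℝ) (x : Lattice) (η : Config) : ℝ :=
  Φ (η x).angle * occ σ x η

/-- The canonical basis vector `e_i`. -/
def e (i : Fin 2) : Lattice := Pi.single i 1

/-- The configuration `η^{x,y}` with the contents of `x` and `y` exchanged. -/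
def exch (x y : Lattice) (η : Config) : Config := η ∘ Equiv.swap x y

/-- The translation of functions, `(τ_x f)(η) = f(τ_x η)` with `(τ_x η)_y = η_{y+x}`. -/
def shift (x : Lattice) (f : Config → ℝ) : Config → ℝ := fun η => f (fun y => η (y + x))

/-- The undirected gradient `f(η^{x,y}) - f(η)`. -/
def ugrad (x y : Lattice) (f : Config → ℝ) : Config → ℝ := fun η => f (exch x y η) - f η

/-- The directed gradient `η_x (1 - η_y) (f(η^{x,y}) - f(η))`. -/
def dgrad (x y : Lattice) (f : Config → ℝ) : Config → ℝ :=
  fun η => occTot x η * (1 - occTot y η) * ugrad x y f η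

/-- The generator of the nearest-neighbour symmetric simple exclusion process on `ℤ²`. On a local
function only finitely many terms of the sum are non-zero. -/
def gen (f : Config → ℝ) : Config → ℝ := fun η =>
  ∑ᶠ x : Lattice, ∑ i : Fin 2, (dgrad x (x + e i) f η + dgrad x (x - e i) f η)

/-! ### Function classes -/

/-- `Φ` is a `C²` function on the angular torus. -/
def IsC2 (Φ : Angle → ℝ) : Prop := ContDiff ℝ 2 (fun t : ℝ => Φ (t : Angle))

/-- Replace the angles of the particles located in `A` by `t`. -/
def setAngles (A : Finset Lattice) (η : Config) (t : A → ℝ) : Config :=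
  fun x => if h : x ∈ A then (η x).setAngle (t ⟨x, h⟩ : Angle) else η x

/-- Cylinder functions: local and `C²` in the angles. -/
def cylinder : Submodule ℝ (Config → ℝ) where
  carrier := {f | (∃ A : Finset Lattice, DependsOn f (A : Set Lattice)) ∧
    ∀ (A : Finset Lattice) (η : Config), ContDiff ℝ 2 (fun t : A → ℝ => f (setAngles A η t))}
  zero_mem' := ⟨⟨∅, fun _ _ _ => rfl⟩, fun _ _ => contDiff_const⟩
  add_mem' := by
    classical
    rintro f g ⟨⟨A, hA⟩, hf⟩ ⟨⟨B, hB⟩, hg⟩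
    refine ⟨⟨A ∪ B, fun η ξ h => ?_⟩, fun C η => (hf C η).add (hg C η)⟩
    have h1 : f η = f ξ := hA fun x hx => h x (by simp at hx ⊢; exact Or.inl hx)
    have h2 : g η = g ξ := hB fun x hx => h x (by simp at hx ⊢; exact Or.inr hx)
    simp [h1, h2]
  smul_mem' := by
    rintro c f ⟨⟨A, hA⟩, hf⟩
    refine ⟨⟨A, fun η ξ h => ?_⟩, fun C η => contDiff_const.mul (hf C η)⟩
    have h1 : f η = f ξ := hA h
    simp [h1]

/-- The box `B_l = {-l, …, l}²`. -/
def box (l : ℕ) : Finset Lattice := Finset.Icc (fun _ => -(l : ℤ)) (fun _ => (l : ℤ))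

/-- The expectation of `ψ` under the canonical measure on `B_l` whose canonical state (the multisets
of angles of active and of passive particles) is the one of `ξ`: all the arrangements in `B_l` of the
particles that `ξ` has there are equally likely. -/
def canonicalExp (l : ℕ) (ξ : Config) (ψ : Config → ℝ) : ℝ :=
  (∑ π : Equiv.Perm (box l), ψ (ξ ∘ Equiv.Perm.ofSubtype π)) / (Fintype.card (Equiv.Perm (box l)))

/-- At least two sites of `B_l` are empty in `ξ`. -/
def TwoVacancies (l : ℕ) (ξ : Config) : Prop :=
  ∃ x ∈ box l, ∃ y ∈ box l, x ≠ y ∧ ξ x = Site.empty ∧ ξ y = Site.empty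

/-- `C_0`: cylinder functions that have mean zero under every canonical measure, with at least two
empty sites, on the boxes that contain their support. -/
def cylinderZero : Submodule ℝ (Config → ℝ) where
  carrier := {ψ | ψ ∈ cylinder ∧ ∃ s : ℕ, DependsOn ψ (box s : Set Lattice) ∧
    ∀ l, s ≤ l → ∀ ξ : Config, TwoVacancies l ξ → canonicalExp l ξ ψ = 0}
  zero_mem' := ⟨cylinder.zero_mem, 0, fun _ _ _ => rfl, fun _ _ _ _ => by simp [canonicalExp]⟩
  add_mem' := by
    rintro f g ⟨hf, s, hs, hs0⟩ ⟨hg, r, hr, hr0⟩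
    have mono : ∀ {a b : ℕ}, a ≤ b → ∀ x ∈ box a, x ∈ box b := by
      intro a b hab x hx
      have hab' : (a : ℤ) ≤ b := by exact_mod_cast hab
      rw [box, Finset.mem_Icc] at hx ⊢
      exact ⟨fun i => le_trans (neg_le_neg hab') (hx.1 i), fun i => le_trans (hx.2 i) hab'⟩
    refine ⟨cylinder.add_mem hf hg, max s r, fun η ξ h => ?_, fun l hl ξ hξ => ?_⟩
    · have h1 : f η = f ξ := hs fun x hx => h x (mono (le_max_left s r) x hx)
      have h2 : g η = g ξ := hr fun x hx => h x (mono (le_max_right s r) x hx)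
      simp [h1, h2]
    · have h1 := hs0 l (le_trans (le_max_left s r) hl) ξ hξ
      have h2 := hr0 l (le_trans (le_max_right s r) hl) ξ hξ
      simp only [canonicalExp] at h1 h2 ⊢
      simp only [Pi.add_apply, Finset.sum_add_distrib, add_div, h1, h2, add_zero]
  smul_mem' := by
    rintro c f ⟨hf, s, hs, hs0⟩
    refine ⟨cylinder.smul_mem c hf, s, fun η ξ h => ?_, fun l hl ξ hξ => ?_⟩
    · have h1 : f η = f ξ := hs h
      simp [h1]
    · have h1 := hs0 l hl ξ hξ
      simp only [canonicalExp] at h1 ⊢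
      simp only [Pi.smul_apply, smul_eq_mul, ← Finset.mul_sum, mul_div_assoc, h1, mul_zero]

/-- `S`: local functions that are blind to types and angles, that is, functions of the occupation
numbers `η_x` of finitely many sites. -/
def blind : Set (Config → ℝ) :=
  {F | ∃ A : Finset Lattice, ∀ η ξ : Config, (∀ x ∈ A, occTot x η = occTot x ξ) → F η = F ξ}

/-- `T^ω`: the span of the cylinder functions
`∑_x (a η^a_x + b η^p_x + c η^{a,ω}_x + d η^{p,ω}_x) F_x(η)` with `F_x ∈ S`. -/
def classT (ω : Angle → ℝ) : Submodule ℝ (Config → ℝ) :=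
  Submodule.span ℝ {f | f ∈ cylinder ∧ ∃ (a b c d : ℝ) (A : Finset Lattice)
    (F : Lattice → Config → ℝ), (∀ x, F x ∈ blind) ∧
    f = fun η => ∑ x ∈ A, (a * occ .active x η + b * occ .passive x η
      + c * occAng .active ω x η + d * occAng .passive ω x η) * F x η}

/-- `T_0^ω = C_0 ∩ T^ω`. -/
def classT0 (ω : Angle → ℝ) : Submodule ℝ (Config → ℝ) := cylinderZero ⊓ classT ω

/-! ### Grand canonical measures -/

/-- Grand canonical parameters: pairs of non-negative measures on the angular torus of joint total
mass at most one. -/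
structure GCParam where
  meas : Species → Measure Angle
  mass_le : ∑ σ, meas σ Set.univ ≤ 1

/-- The law of one site: a particle of type `σ` with angle in `dθ` with probability `α̂^σ(dθ)`, and
no particle with the remaining probability. -/
def GCParam.siteLaw (α : GCParam) : Measure Site :=
  ∑ σ, (α.meas σ).map (Site.particle σ)
    + (1 - ∑ σ, α.meas σ Set.univ) • Measure.dirac Site.empty

lemma measurable_particle (σ : Species) : Measurable (Site.particle σ) :=
  measurable_iff_le_map.2 (iInf_le _ σ)

instance (α : GCParam) : IsProbabilityMeasure α.siteLaw := by
  refine ⟨?_⟩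
  have h : ∀ σ, (α.meas σ).map (Site.particle σ) Set.univ = α.meas σ Set.univ := fun σ => by
    rw [Measure.map_apply (measurable_particle σ) MeasurableSet.univ, Set.preimage_univ]
  simp only [GCParam.siteLaw, Measure.add_apply, Measure.finsetSum_apply, h, Measure.smul_apply,
    measure_univ, smul_eq_mul, mul_one]
  exact add_tsub_cancel_of_le α.mass_le

/-- The grand canonical measure: the sites are independent with law `siteLaw`. -/
def GCParam.measure (α : GCParam) : Measure Config := Measure.infinitePi fun _ => α.siteLaw

/-- The expectation under the grand canonical measure. -/
def GCParam.E (α : GCParam) (f : Config → ℝ) : ℝ := ∫ η, f η ∂α.measure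

/-- The density `α^σ`. -/
def GCParam.density (α : GCParam) (σ : Species) : ℝ := (α.meas σ Set.univ).toReal

/-- The total density `α = α^a + α^p`. -/
def GCParam.total (α : GCParam) : ℝ := ∑ σ, α.density σ

/-- The conditional mean `E[ω(θ_0) | η^σ_0 = 1]`. -/
def GCParam.angMean (α : GCParam) (σ : Species) (ω : Angle → ℝ) : ℝ :=
  α.E (occAng σ ω 0) / α.E (occ σ 0)

/-! ### The semi-norm -/

/-- `⟪j* + 𝓛 g⟫_α̂`, where `j* = ∑_σ ∑_i j_i^{σ,Φ σ i}`. Here `∇̃_{0,e_i} Σ_g` is the sum over `x` of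
`∇̃_{0,e_i} τ_x g`, finitely many terms of which are non-zero when `g` is local. -/
def energy (α : GCParam) (Φ : Species → Fin 2 → Angle → ℝ) (g : Config → ℝ) : ℝ :=
  ∑ σ, ∑ i, α.E fun η => occ σ 0 η * (1 - occTot (e i) η) *
    (Φ σ i (η 0).angle + ∑ᶠ x : Lattice, ugrad 0 (e i) (shift x g) η) ^ 2

/-- `⟪φ, j* + 𝓛 g⟫_α̂ = - E[φ (Σ_g + ∑_i ∑_x x_i (η_x^{a,Φ^a_i} + η_x^{p,Φ^p_i}))]`, the sums over `x`
being taken outside the expectation; only finitely many terms are non-zero when `φ` is local with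
mean zero and `g` is local. -/
def pairing (α : GCParam) (φ : Config → ℝ) (Φ : Species → Fin 2 → Angle → ℝ)
    (g : Config → ℝ) : ℝ :=
  -(∑ᶠ x : Lattice, α.E (fun η => φ η * shift x g η)
    + ∑ i, ∑ᶠ x : Lattice, (x i : ℝ) * α.E (fun η => φ η * ∑ σ, occAng σ (Φ σ i) x η))

/-- The angular functions `c σ i + d σ i • ω` of the element
`∑_σ ∑_i (c σ i • j_i^σ + d σ i • j_i^{σ,ω})` of `J^ω`. -/
def affineAng (ω : Angle → ℝ) (c d : Species → Fin 2 → ℝ) : Species → Fin 2 → Angle → ℝ :=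
  fun σ i θ => c σ i + d σ i * ω θ

/-- `⟪φ⟫_α̂ = sup_{j ∈ J^ω, g ∈ T_0^ω} (2 ⟪φ, j + 𝓛 g⟫_α̂ - ⟪j + 𝓛 g⟫_α̂)`, the squared semi-norm
on `T_0^ω`, as an extended real number. -/
def seminormSq (α : GCParam) (ω : Angle → ℝ) (φ : Config → ℝ) : EReal :=
  ⨆ (c : Species → Fin 2 → ℝ) (d : Species → Fin 2 → ℝ) (g : classT0 ω),
    ((2 * pairing α φ (affineAng ω c d) g - energy α (affineAng ω c d) g : ℝ) : EReal)

/-- `f` belongs to the closure of `𝓛 T_0^ω` with respect to the semi-norm `⟪·⟫_α̂^{1/2}` on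
`T_0^ω`: it is the limit of a sequence `𝓛 g_n` with `g_n ∈ T_0^ω`. -/
def InClosureGen (α : GCParam) (ω : Angle → ℝ) (f : Config → ℝ) : Prop :=
  f ∈ classT0 ω ∧ ∃ g : ℕ → classT0 ω,
    Tendsto (fun n => seminormSq α ω (f - gen (g n))) atTop (𝓝 0)

/-! ### Currents and local gradients -/

/-- The current `j_i^{σ,Φ}`. -/
def current (σ : Species) (Φ : Angle → ℝ) (i : Fin 2) : Config → ℝ := fun η =>
  occAng σ Φ 0 η * (1 - occTot (e i) η) - occAng σ Φ (e i) η * (1 - occTot 0 η)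

/-- The current `j_i^σ`. -/
def current1 (σ : Species) (i : Fin 2) : Config → ℝ := current σ (fun _ => 1) i

/-- The local gradient `δ_i η^{σ,Φ}`. -/
def locGradAng (σ : Species) (Φ : Angle → ℝ) (i : Fin 2) : Config → ℝ :=
  fun η => occAng σ Φ (e i) η - occAng σ Φ 0 η

/-- The local gradient `δ_i η^σ`. -/
def locGrad (σ : Species) (i : Fin 2) : Config → ℝ := fun η => occ σ (e i) η - occ σ 0 η

/-- The local gradient `δ_i η`. -/
def locGradTot (i : Fin 2) : Config → ℝ := fun η => occTot (e i) η - occTot 0 η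

/-- The centered current `j_i^{σ,ω} - E[ω(θ_0) | η^σ_0 = 1] j_i^σ`. -/
def centeredCurrent (α : GCParam) (σ : Species) (ω : Angle → ℝ) (i : Fin 2) : Config → ℝ :=
  current σ ω i - α.angMean σ ω • current1 σ i

/-- The centered local gradient `δ_i η^{σ,ω} - E[ω(θ_0) | η^σ_0 = 1] δ_i η^σ`. -/
def centeredLocGrad (α : GCParam) (σ : Species) (ω : Angle → ℝ) (i : Fin 2) : Config → ℝ :=
  locGradAng σ ω i - α.angMean σ ω • locGrad σ i

/-! ### Self-diffusion -/

/-- A grand canonical parameter of total density `ρ ∈ [0,1]` (`ρ` is clamped to this interval). -/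
def GCParam.ofDensity (ρ : ℝ) : GCParam where
  meas σ := if σ = .active then ENNReal.ofReal (min ρ 1) • Measure.dirac 0 else 0
  mass_le := by
    have h : (Finset.univ : Finset Species) = {.active, .passive} := rfl
    simp [h]

/-- The quadratic form `x ↦ xᵀ D_s(ρ) x` of the self-diffusion matrix of the symmetric simple
exclusion process on `ℤ²` at density `ρ`. The integrand only sees occupation numbers, so that any
parameter of density `ρ` gives the same value. -/
def selfDiffusionForm (ρ : ℝ) (x : Fin 2 → ℝ) : ℝ :=
  ⨅ f : blind, ∑ i, (GCParam.ofDensity ρ).E fun η =>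
    (1 - occTot (e i) η) * (x i + shift (e i) f.1 (exch 0 (e i) η) - f.1 η) ^ 2
      + ∑ᶠ (y : Lattice) (_ : y ≠ 0 ∧ y ≠ e i), dgrad 0 (e i) (shift y f.1) η ^ 2

/-- The self-diffusion coefficient `d_s(ρ)`, the common value on unit vectors of the isotropic form
`x ↦ xᵀ D_s(ρ) x`. -/
def ds (ρ : ℝ) : ℝ := selfDiffusionForm ρ (Pi.single 0 1)

/-- `𝓓(ρ) = (1 - d_s(ρ)) / ρ`, extended to `ρ = 0` by its limit. -/
def crossD (ρ : ℝ) : ℝ :=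
  if ρ = 0 then limUnder (𝓝[>] (0 : ℝ)) (fun r => (1 - ds r) / r) else (1 - ds ρ) / ρ

/-- `𝔡(α̂) = E[η^{a,ω}_0] 𝓓(α)`. -/
def frakD (α : GCParam) (ω : Angle → ℝ) : ℝ := α.E (occAng .active ω 0) * crossD α.total

/-- The two forms of the assertion that `f` vanishes modulo the closure of `𝓛 T_0^ω`: the infimum
over `g ∈ T_0^ω` of `⟪f + 𝓛 g⟫_α̂` is zero, and `f` lies in the closure. -/
def VanishesModGen (α : GCParam) (ω : Angle → ℝ) (f : Config → ℝ) : Prop :=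
  (⨅ g : classT0 ω, seminormSq α ω (f + gen g)) = 0 ∧ InClosureGen α ω f

end APLG

end

noncomputable section

open MeasureTheory Filter Topology

namespace APLG

/-!
By exclusion the total current is `-δ_i η`. Subtracting from `v = ∑_σ η_0^{σ,Φ^σ}` its conditional
mean given a particle, times `η_0`, therefore reduces all three assertions to one: for functions
`v` of one site with mean zero, `j_i^v + d_s δ_i v` vanishes modulo the generator.

The test functions are `v(η_0) f`, with `f` a function of the occupation numbers of the other sites.
Since `v` has mean zero, the contributions of distinct particles are orthogonal, and the energy of
the current `c v` corrected by `v(η_0) f` is `E[v(η_0)²]` times the quadratic form of the tagged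
particle at `(c, f)`, whose infimum over `f` is `d_s |c|²`. For a near-minimizer `f` the corrected
current is nearly orthogonal to all gradients, so that only its component along the currents is
left; by integration by parts this is the component of `-d_s δ_i v`. Bessel's inequality makes the
error uniform over the test functions of the variational formula. Subtracting from `f` its averages
over far translations moves `v(η_0) f` into `𝒞_0` at a small cost in energy.
-/

lemma sum_species {M : Type*} [AddCommMonoid M] (f : Species → M) :
    ∑ σ, f σ = f .active + f .passive := by
  have h : (Finset.univ : Finset Species) = {.active, .passive} := rfl
  rw [h, Finset.sum_pair (by decide)]

/-! ### Local observables -/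

/-- The occupation number of a site state. -/
def Site.tot (s : Site) : ℝ := ∑ σ, s.num σ

/-- A reference particle: functions of the occupation numbers do not distinguish it from any other
particle. -/
def refParticle : Site := Site.particle .active 0

@[simp] lemma Site.tot_empty : Site.empty.tot = 0 := by simp [Site.tot, Site.num]

@[simp] lemma Site.tot_particle (σ : Species) (θ : Angle) : (Site.particle σ θ).tot = 1 := by
  simp [Site.tot, Site.num]

@[simp] lemma Site.tot_refParticle : refParticle.tot = 1 := Site.tot_particle _ _

lemma Site.tot_of_ne_empty {s : Site} (h : s ≠ Site.empty) : s.tot = 1 := by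
  cases s <;> simp_all

lemma Site.tot_mem_Icc (s : Site) : s.tot ∈ Set.Icc (0 : ℝ) 1 := by cases s <;> simp

lemma Site.tot_mul_self (s : Site) : s.tot * s.tot = s.tot := by cases s <;> simp

lemma occTot_eq (x : Lattice) (η : Config) : occTot x η = (η x).tot := rfl

lemma occTot_nonneg (x : Lattice) (η : Config) : 0 ≤ occTot x η := (η x).tot_mem_Icc.1

lemma occTot_le_one (x : Lattice) (η : Config) : occTot x η ≤ 1 := (η x).tot_mem_Icc.2

lemma Site.measurable_iff {v : Site → ℝ} :
    Measurable v ↔ ∀ σ, Measurable fun θ => v (Site.particle σ θ) :=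
  ⟨fun h σ => h.comp (measurable_particle σ),
    fun h _ hs => MeasurableSpace.measurableSet_iInf.2 fun σ => h σ hs⟩

/-- Observables of one site: bounded measurable functions of its state that vanish when it is
empty. -/
structure SiteObservable (v : Site → ℝ) : Prop where
  measurable : Measurable v
  bounded : ∃ C, ∀ s, |v s| ≤ C
  empty : v Site.empty = 0

lemma siteObservable_zero : SiteObservable 0 :=
  ⟨measurable_const, ⟨0, fun _ => abs_zero.le⟩, rfl⟩

section
variable {v w : Site → ℝ}

lemma SiteObservable.add (hv : SiteObservable v) (hw : SiteObservable w) :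
    SiteObservable fun s => v s + w s := by
  obtain ⟨C, hC⟩ := hv.bounded
  obtain ⟨D, hD⟩ := hw.bounded
  exact ⟨hv.measurable.add hw.measurable,
    ⟨C + D, fun s => (abs_add_le _ _).trans (add_le_add (hC s) (hD s))⟩,
    by simp [hv.empty, hw.empty]⟩

lemma SiteObservable.mul (hv : SiteObservable v) (hw : SiteObservable w) :
    SiteObservable fun s => v s * w s := by
  obtain ⟨C, hC⟩ := hv.bounded
  obtain ⟨D, hD⟩ := hw.bounded
  refine ⟨hv.measurable.mul hw.measurable, ⟨C * D, fun s => ?_⟩, by simp [hv.empty]⟩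
  rw [abs_mul]
  exact mul_le_mul (hC s) (hD s) (abs_nonneg _) ((abs_nonneg _).trans (hC s))

lemma SiteObservable.const_mul (hv : SiteObservable v) (c : ℝ) :
    SiteObservable fun s => c * v s := by
  obtain ⟨C, hC⟩ := hv.bounded
  refine ⟨hv.measurable.const_mul c, ⟨|c| * C, fun s => ?_⟩, by simp [hv.empty]⟩
  rw [abs_mul]
  exact mul_le_mul_of_nonneg_left (hC s) (abs_nonneg _)

lemma siteObservable_tot : SiteObservable Site.tot := by
  refine ⟨Site.measurable_iff.2 fun σ => by simp, ⟨1, fun s => ?_⟩, by simp⟩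
  cases s <;> simp

lemma siteObservable_num (σ : Species) : SiteObservable (Site.num σ) := by
  refine ⟨Site.measurable_iff.2 fun τ => by simp [Site.num], ⟨1, fun s => ?_⟩, rfl⟩
  cases s with
  | empty => simp [Site.num]
  | particle τ θ => by_cases h : τ = σ <;> simp [Site.num, h]

lemma SiteObservable.mul_tot (hv : SiteObservable v) (s : Site) : v s * s.tot = v s := by
  cases s <;> simp [hv.empty]

lemma SiteObservable.mul_one_sub_tot (hv : SiteObservable v) (s : Site) :
    v s * (1 - s.tot) = 0 := by
  cases s <;> simp [hv.empty]

end

/-- Functions of the states of finitely many sites. -/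
def IsLocal (f : Config → ℝ) : Prop := ∃ A : Finset Lattice, DependsOn f (A : Set Lattice)

section
variable {f g : Config → ℝ}

lemma isLocal_const (c : ℝ) : IsLocal fun _ => c := ⟨∅, fun _ _ _ => rfl⟩

lemma isLocal_site (v : Site → ℝ) (x : Lattice) : IsLocal fun η => v (η x) :=
  ⟨{x}, fun _ _ h => congrArg v (h x (by simp))⟩

lemma IsLocal.map₂ (hf : IsLocal f) (hg : IsLocal g) (F : ℝ → ℝ → ℝ) :
    IsLocal fun η => F (f η) (g η) := by
  classical
  obtain ⟨A, hA⟩ := hf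
  obtain ⟨B, hB⟩ := hg
  refine ⟨A ∪ B, fun η ξ h => congrArg₂ F (hA fun x hx => h x ?_) (hB fun x hx => h x ?_)⟩
  · exact Finset.mem_union_left B hx
  · exact Finset.mem_union_right A hx

lemma IsLocal.comp_perm (hf : IsLocal f) (π : Equiv.Perm Lattice) :
    IsLocal fun η => f (η ∘ π) := by
  obtain ⟨A, hA⟩ := hf
  exact ⟨A.map π.toEmbedding, fun η ξ h => hA fun x hx => h _ (Finset.mem_map_of_mem _ hx)⟩

lemma dependsOn_comp_update {A : Set Lattice} {x : Lattice} (hf : DependsOn f (insert x A))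
    (s : Site) : DependsOn (fun η => f (Function.update η x s)) A := by
  refine fun η ξ h => hf fun y hy => ?_
  rcases eq_or_ne y x with rfl | hyx
  · simp
  · simpa [hyx] using h y (hy.resolve_left hyx)

lemma IsLocal.comp_update (hf : IsLocal f) (x : Lattice) (s : Site) :
    IsLocal fun η => f (Function.update η x s) :=
  hf.imp fun _ hA => dependsOn_comp_update (hA.mono (Set.subset_insert _ _)) s

/-- Observables: bounded measurable functions of the states of finitely many sites. -/
structure Observable (f : Config → ℝ) : Prop where
  measurable : Measurable f
  bounded : ∃ C, ∀ η, |f η| ≤ C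
  isLocal : IsLocal f

lemma observable_const (c : ℝ) : Observable fun _ => c :=
  ⟨measurable_const, ⟨|c|, fun _ => le_rfl⟩, isLocal_const c⟩

lemma SiteObservable.observable {v : Site → ℝ} (hv : SiteObservable v) (x : Lattice) :
    Observable fun η => v (η x) := by
  obtain ⟨C, hC⟩ := hv.bounded
  exact ⟨hv.measurable.comp (measurable_pi_apply x), ⟨C, fun η => hC _⟩, isLocal_site v x⟩

lemma Observable.add (hf : Observable f) (hg : Observable g) :
    Observable fun η => f η + g η := by
  obtain ⟨C, hC⟩ := hf.bounded
  obtain ⟨D, hD⟩ := hg.bounded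
  exact ⟨hf.measurable.add hg.measurable,
    ⟨C + D, fun s => (abs_add_le _ _).trans (add_le_add (hC s) (hD s))⟩,
    hf.isLocal.map₂ hg.isLocal (· + ·)⟩

lemma Observable.mul (hf : Observable f) (hg : Observable g) :
    Observable fun η => f η * g η := by
  obtain ⟨C, hC⟩ := hf.bounded
  obtain ⟨D, hD⟩ := hg.bounded
  refine ⟨hf.measurable.mul hg.measurable, ⟨C * D, fun s => ?_⟩,
    hf.isLocal.map₂ hg.isLocal (· * ·)⟩
  rw [abs_mul]
  exact mul_le_mul (hC s) (hD s) (abs_nonneg _) ((abs_nonneg _).trans (hC s))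

lemma Observable.const_mul (hf : Observable f) (c : ℝ) : Observable fun η => c * f η :=
  (observable_const c).mul hf

lemma Observable.neg (hf : Observable f) : Observable fun η => -f η := by
  simpa using hf.const_mul (-1)

lemma Observable.sub (hf : Observable f) (hg : Observable g) :
    Observable fun η => f η - g η := by
  simpa [sub_eq_add_neg] using hf.add hg.neg

lemma Observable.pow_two (hf : Observable f) : Observable fun η => f η ^ 2 := by
  simpa only [sq] using hf.mul hf

lemma Observable.sum {ι : Type*} {f : ι → Config → ℝ} (s : Finset ι)
    (hf : ∀ i ∈ s, Observable (f i)) : Observable fun η => ∑ i ∈ s, f i η := by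
  classical
  induction s using Finset.induction_on with
  | empty => simpa using observable_const 0
  | insert a s ha ih =>
    simp only [Finset.sum_insert ha]
    exact (hf a (by simp)).add (ih fun i hi => hf i (by simp [hi]))

lemma Observable.comp_perm (hf : Observable f) (π : Equiv.Perm Lattice) :
    Observable fun η => f (η ∘ π) := by
  obtain ⟨C, hC⟩ := hf.bounded
  exact ⟨hf.measurable.comp (measurable_pi_iff.2 fun x => measurable_pi_apply _),
    ⟨C, fun η => hC _⟩, hf.isLocal.comp_perm π⟩

lemma Observable.comp_exch (hf : Observable f) (x y : Lattice) :
    Observable fun η => f (exch x y η) := hf.comp_perm (Equiv.swap x y)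

lemma Observable.shift (hf : Observable f) (x : Lattice) : Observable (shift x f) :=
  hf.comp_perm (Equiv.addRight x)

lemma Observable.ugrad (hf : Observable f) (x y : Lattice) : Observable (ugrad x y f) :=
  (hf.comp_exch x y).sub hf

lemma Observable.comp_update (hf : Observable f) (x : Lattice) (s : Site) :
    Observable fun η => f (Function.update η x s) := by
  obtain ⟨C, hC⟩ := hf.bounded
  exact ⟨hf.measurable.comp measurable_update_left, ⟨C, fun η => hC _⟩,
    hf.isLocal.comp_update x s⟩

lemma observable_occTot (x : Lattice) : Observable (occTot x) := siteObservable_tot.observable x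

lemma observable_vacancy (x : Lattice) : Observable fun η => 1 - occTot x η :=
  (observable_const 1).sub (observable_occTot x)

lemma Observable.dgrad (hf : Observable f) (x y : Lattice) : Observable (dgrad x y f) :=
  ((observable_occTot x).mul (observable_vacancy y)).mul (hf.ugrad x y)

end

/-! ### Expectations -/

instance (α : GCParam) : IsProbabilityMeasure α.measure := by
  unfold GCParam.measure; infer_instance

lemma Observable.integrable {f : Config → ℝ} (hf : Observable f) (α : GCParam) :
    Integrable f α.measure := by
  obtain ⟨C, hC⟩ := hf.bounded
  exact Integrable.of_bound hf.measurable.aestronglyMeasurable C (ae_of_all _ fun η => hC η)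

namespace GCParam
variable (α : GCParam) {f g K : Config → ℝ} {v w : Site → ℝ}

lemma E_add (hf : Observable f) (hg : Observable g) :
    α.E (fun η => f η + g η) = α.E f + α.E g :=
  integral_add (hf.integrable α) (hg.integrable α)

lemma E_sub (hf : Observable f) (hg : Observable g) :
    α.E (fun η => f η - g η) = α.E f - α.E g :=
  integral_sub (hf.integrable α) (hg.integrable α)

lemma E_const_mul (c : ℝ) (f : Config → ℝ) : α.E (fun η => c * f η) = c * α.E f :=
  integral_const_mul c f

lemma E_neg (f : Config → ℝ) : α.E (fun η => -f η) = -α.E f := integral_neg f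

lemma E_const (c : ℝ) : α.E (fun _ => c) = c := by simp [GCParam.E]

lemma E_sum {ι : Type*} {f : ι → Config → ℝ} (s : Finset ι) (hf : ∀ i ∈ s, Observable (f i)) :
    α.E (fun η => ∑ i ∈ s, f i η) = ∑ i ∈ s, α.E (f i) :=
  integral_finsetSum s fun i hi => (hf i hi).integrable α

lemma E_nonneg (hf : ∀ η, 0 ≤ f η) : 0 ≤ α.E f := integral_nonneg hf

lemma E_mono (hf : Observable f) (hg : Observable g) (h : ∀ η, f η ≤ g η) :
    α.E f ≤ α.E g :=
  integral_mono (hf.integrable α) (hg.integrable α) h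

lemma measurePreserving_perm (π : Equiv.Perm Lattice) :
    MeasurePreserving (fun η : Config => η ∘ π) α.measure α.measure :=
  ⟨measurable_pi_iff.2 fun _ => measurable_pi_apply _,
    Measure.map_infinitePi_infinitePi_of_inj (P := fun _ : Lattice => α.siteLaw) π.injective⟩

lemma E_comp_perm (hf : Observable f) (π : Equiv.Perm Lattice) :
    α.E (fun η => f (η ∘ π)) = α.E f := by
  have h := α.measurePreserving_perm π
  unfold GCParam.E
  conv_rhs => rw [← h.map_eq]
  rw [integral_map h.measurable.aemeasurable hf.measurable.aestronglyMeasurable]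

lemma E_comp_exch (hf : Observable f) (x y : Lattice) :
    α.E (fun η => f (exch x y η)) = α.E f := α.E_comp_perm hf (Equiv.swap x y)

lemma E_shift (hf : Observable f) (x : Lattice) :
    α.E (shift x f) = α.E f := α.E_comp_perm hf (Equiv.addRight x)

/-- The mean of a function of the state of one site. -/
def mean (v : Site → ℝ) : ℝ := ∫ s, v s ∂α.siteLaw

lemma E_site (hv : SiteObservable v) (x : Lattice) : α.E (fun η => v (η x)) = α.mean v := by
  have h := measurePreserving_eval_infinitePi (fun _ : Lattice => α.siteLaw) x
  rw [mean]
  conv_rhs => rw [← h.map_eq]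
  rw [integral_map h.measurable.aemeasurable hv.measurable.aestronglyMeasurable]
  rfl

lemma mean_add (hv : SiteObservable v) (hw : SiteObservable w) :
    α.mean (fun s => v s + w s) = α.mean v + α.mean w := by
  simpa only [α.E_site (hv.add hw) 0, α.E_site hv 0, α.E_site hw 0] using
    α.E_add (hv.observable 0) (hw.observable 0)

lemma mean_const_mul (v : Site → ℝ) (c : ℝ) : α.mean (fun s => c * v s) = c * α.mean v :=
  integral_const_mul c v

instance (σ : Species) : IsFiniteMeasure (α.meas σ) :=
  ⟨((Finset.single_le_sum (f := fun σ => α.meas σ Set.univ) (fun _ _ => zero_le)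
    (Finset.mem_univ σ)).trans α.mass_le).trans_lt ENNReal.one_lt_top⟩

lemma mean_eq_sum_integral (hv : SiteObservable v) :
    α.mean v = ∑ σ, ∫ θ, v (Site.particle σ θ) ∂α.meas σ := by
  obtain ⟨C, hC⟩ := hv.bounded
  have hint : ∀ (μ : Measure Site) [IsFiniteMeasure μ], Integrable v μ := fun μ _ =>
    Integrable.of_bound hv.measurable.aestronglyMeasurable C (ae_of_all _ hC)
  have hempty : ∫ s, v s ∂((1 - ∑ σ, α.meas σ Set.univ) • Measure.dirac Site.empty) = 0 := by
    rw [integral_smul_measure, integral_dirac' _ _ hv.measurable.stronglyMeasurable, hv.empty,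
      smul_zero]
  have hvac : Integrable v ((1 - ∑ σ, α.meas σ Set.univ) • Measure.dirac Site.empty) :=
    (hint _).smul_measure (ENNReal.sub_ne_top ENNReal.one_ne_top)
  rw [mean, siteLaw, integral_add_measure (integrable_finsetSum_measure.2 fun σ _ => hint _) hvac,
    hempty, add_zero, integral_finsetSum_measure fun σ _ => hint _]
  exact Finset.sum_congr rfl fun σ _ =>
    integral_map (measurable_particle σ).aemeasurable hv.measurable.aestronglyMeasurable

lemma mean_num (σ : Species) : α.mean (Site.num σ) = α.density σ := by
  rw [α.mean_eq_sum_integral (siteObservable_num σ), Finset.sum_eq_single σ]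
  · simp [Site.num, density, Measure.real]
  · intro τ _ hτ
    simp [Site.num, hτ]
  · simp

lemma mean_tot : α.mean Site.tot = α.total := by
  have h : Site.tot = fun s => s.num .active + s.num .passive :=
    funext fun s => sum_species fun σ => s.num σ
  rw [h, α.mean_add (siteObservable_num _) (siteObservable_num _), mean_num, mean_num, total,
    sum_species]

lemma total_nonneg : 0 ≤ α.total := by
  rw [← mean_tot]
  exact integral_nonneg fun s => s.tot_mem_Icc.1

lemma total_le_one : α.total ≤ 1 := by
  rw [← mean_tot, ← α.E_site siteObservable_tot 0, ← α.E_const 1]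
  exact α.E_mono (observable_occTot 0) (observable_const 1) (occTot_le_one 0)

lemma total_ofDensity {ρ : ℝ} (h0 : 0 ≤ ρ) (h1 : ρ ≤ 1) : (GCParam.ofDensity ρ).total = ρ := by
  simp [GCParam.total, sum_species, GCParam.density, GCParam.ofDensity, h1, h0]

lemma meas_eq_zero_of_density {σ : Species} (h : α.density σ = 0) : α.meas σ = 0 :=
  Measure.measure_univ_eq_zero.1
    (((ENNReal.toReal_eq_zero_iff _).1 h).resolve_right (measure_ne_top _ _))

lemma mean_eq_zero_of_total (hv : SiteObservable v) (h : α.total = 0) : α.mean v = 0 := by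
  have hmeas : ∀ σ, α.meas σ = 0 := fun σ => α.meas_eq_zero_of_density <|
    (Finset.sum_eq_zero_iff_of_nonneg fun τ _ => ENNReal.toReal_nonneg).1 h σ (Finset.mem_univ σ)
  simp [α.mean_eq_sum_integral hv, hmeas]

lemma E_site_mul_of_update_eq (hv : SiteObservable v) {x : Lattice} (hK : Observable K)
    (hx : ∀ η s, K (Function.update η x s) = K η) :
    α.E (fun η => v (η x) * K η) = α.mean v * α.E K := by
  classical
  obtain ⟨A, hA⟩ := hK.isLocal
  let T : Finset Lattice := A.erase x
  have hindep := (ProbabilityTheory.iIndepFun_infinitePi (P := fun _ : Lattice => α.siteLaw)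
    (X := fun _ s => s) (fun _ => measurable_id)).indepFun_finset {x} T
    (by simp [T]) (fun i => measurable_pi_apply i)
  let extend : (T → Site) → Config := fun b y => if h : y ∈ T then b ⟨y, h⟩ else Site.empty
  have hextend : Measurable extend := measurable_pi_iff.2 fun y => by
    by_cases h : y ∈ T
    · simpa [extend, h] using measurable_pi_apply _
    · simp [extend, h]
  have hK_extend : ∀ η : Config, K (extend fun i => η i) = K η := fun η => by
    rw [← hx η Site.empty]
    refine hA fun y hy => ?_
    rcases eq_or_ne y x with rfl | h
    · simp [extend, T]
    · have : y ∈ T := Finset.mem_erase.2 ⟨h, hy⟩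
      simp [extend, this, h]
  have hprod := hindep.integral_fun_comp_mul_comp
    (f := fun b : ({x} : Finset Lattice) → Site => v (b ⟨x, by simp⟩))
    (g := fun b => K (extend b))
    (measurable_pi_iff.2 fun i => measurable_pi_apply _).aemeasurable
    (measurable_pi_iff.2 fun i => measurable_pi_apply _).aemeasurable
    (hv.measurable.comp (measurable_pi_apply _)).aestronglyMeasurable
    (hK.measurable.comp hextend).aestronglyMeasurable
  simp only [hK_extend] at hprod
  rw [← α.E_site hv x]
  exact hprod

end GCParam

/-- `K` sees the particle at `x`, if there is one, only through its presence. -/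
def OccInvariant (x : Lattice) (K : Config → ℝ) : Prop :=
  ∀ η : Config, η x ≠ Site.empty → K (Function.update η x refParticle) = K η

lemma GCParam.E_site_mul_of_occInvariant (α : GCParam) {v : Site → ℝ} (hv : SiteObservable v)
    {x : Lattice} {K : Config → ℝ} (hK : Observable K) (hx : OccInvariant x K) :
    α.E (fun η => v (η x) * K η)
      = α.mean v * α.E (fun η => K (Function.update η x refParticle)) := by
  rw [← α.E_site_mul_of_update_eq hv (x := x) (hK.comp_update x refParticle) (fun η s => by simp)]
  congr 1
  funext η
  by_cases h : η x = Site.empty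
  · simp [h, hv.empty]
  · rw [hx η h]

lemma OccInvariant.mul {x : Lattice} {f g : Config → ℝ} (hf : OccInvariant x f)
    (hg : OccInvariant x g) : OccInvariant x fun η => f η * g η := fun η h =>
  congrArg₂ (· * ·) (hf η h) (hg η h)

lemma occInvariant_site {x y : Lattice} (h : y ≠ x) (v : Site → ℝ) :
    OccInvariant x fun η => v (η y) := fun η _ =>
  congrArg v (Function.update_of_ne h _ η)

/-! ### Functions of the occupation numbers -/

/-- Replace a particle by the reference particle. -/
def Site.forget : Site → Site
  | .empty => .empty
  | .particle _ _ => refParticle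

/-- Replace all particles by reference particles. -/
def forgetAll (η : Config) : Config := fun x => (η x).forget

@[simp] lemma Site.forget_empty : Site.empty.forget = Site.empty := rfl

@[simp] lemma Site.forget_refParticle : refParticle.forget = refParticle := rfl

lemma Site.forget_of_ne_empty {s : Site} (h : s ≠ Site.empty) : s.forget = refParticle := by
  cases s
  · exact absurd rfl h
  · rfl

@[simp] lemma Site.tot_forget (s : Site) : s.forget.tot = s.tot := by
  cases s <;> simp [Site.forget]

lemma Site.forget_eq_of_tot {s t : Site} (h : s.tot = t.tot) : s.forget = t.forget := by
  cases s <;> cases t <;> simp_all [Site.forget]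

/-- Membership in `blind`, split into locality and invariance under `forgetAll`. -/
structure IsBlind (F : Config → ℝ) : Prop where
  isLocal : IsLocal F
  forget : ∀ η, F (forgetAll η) = F η

lemma mem_blind_iff {F : Config → ℝ} : F ∈ blind ↔ IsBlind F := by
  constructor
  · rintro ⟨A, hA⟩
    refine ⟨⟨A, fun η ξ h => hA η ξ fun x hx => ?_⟩, fun η => hA _ _ fun x _ => ?_⟩
    · rw [occTot_eq, occTot_eq, h x hx]
    · rw [occTot_eq, occTot_eq, forgetAll, Site.tot_forget]
  · rintro ⟨⟨A, hA⟩, hforget⟩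
    refine ⟨A, fun η ξ h => ?_⟩
    rw [← hforget η, ← hforget ξ]
    exact hA fun x hx => Site.forget_eq_of_tot (h x hx)

lemma forgetAll_update (η : Config) (x : Lattice) (s : Site) :
    forgetAll (Function.update η x s) = Function.update (forgetAll η) x s.forget :=
  funext fun y => Function.apply_update (fun _ => Site.forget) η x s y

lemma isBlind_const (c : ℝ) : IsBlind fun _ => c := ⟨isLocal_const c, fun _ => rfl⟩

lemma isBlind_occTot (x : Lattice) : IsBlind (occTot x) :=
  ⟨isLocal_site Site.tot x, fun η => (η x).tot_forget⟩

namespace IsBlind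
variable {f g : Config → ℝ}

lemma add (hf : IsBlind f) (hg : IsBlind g) : IsBlind fun η => f η + g η :=
  ⟨hf.isLocal.map₂ hg.isLocal (· + ·), fun η => by rw [hf.forget, hg.forget]⟩

lemma mul (hf : IsBlind f) (hg : IsBlind g) : IsBlind fun η => f η * g η :=
  ⟨hf.isLocal.map₂ hg.isLocal (· * ·), fun η => by rw [hf.forget, hg.forget]⟩

lemma const_mul (hf : IsBlind f) (c : ℝ) : IsBlind fun η => c * f η := (isBlind_const c).mul hf

lemma sub (hf : IsBlind f) (hg : IsBlind g) : IsBlind fun η => f η - g η := by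
  simpa [sub_eq_add_neg] using hf.add (hg.const_mul (-1))

lemma sum {ι : Type*} {f : ι → Config → ℝ} (s : Finset ι) (hf : ∀ i ∈ s, IsBlind (f i)) :
    IsBlind fun η => ∑ i ∈ s, f i η := by
  classical
  induction s using Finset.induction_on with
  | empty => simpa using isBlind_const 0
  | insert a s ha ih =>
    simp only [Finset.sum_insert ha]
    exact (hf a (by simp)).add (ih fun i hi => hf i (by simp [hi]))

lemma comp_perm (hf : IsBlind f) (π : Equiv.Perm Lattice) : IsBlind fun η => f (η ∘ π) :=
  ⟨hf.isLocal.comp_perm π, fun η => hf.forget (η ∘ π)⟩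

lemma comp_exch (hf : IsBlind f) (x y : Lattice) : IsBlind fun η => f (exch x y η) :=
  hf.comp_perm (Equiv.swap x y)

lemma shift (hf : IsBlind f) (x : Lattice) : IsBlind (shift x f) :=
  hf.comp_perm (Equiv.addRight x)

lemma ugrad (hf : IsBlind f) (x y : Lattice) : IsBlind (ugrad x y f) := (hf.comp_exch x y).sub hf

lemma comp_update (hf : IsBlind f) (x : Lattice) {s : Site} (hs : s.forget = s) :
    IsBlind fun η => f (Function.update η x s) :=
  ⟨hf.isLocal.comp_update x s, fun η => by
    rw [← hf.forget (Function.update η x s), forgetAll_update, hs]⟩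

lemma occInvariant (hf : IsBlind f) (x : Lattice) : OccInvariant x f := by
  intro η hη
  rw [← hf.forget, forgetAll_update, ← hf.forget η, Site.forget_refParticle,
    ← Site.forget_of_ne_empty hη]
  congr 1
  exact Function.update_eq_self x (forgetAll η)

lemma eq_tot_mul_add (hf : IsBlind f) (x : Lattice) (η : Config) :
    f η = (η x).tot * f (Function.update η x refParticle)
      + (1 - (η x).tot) * f (Function.update η x Site.empty) := by
  by_cases h : η x = Site.empty
  · have : Function.update η x Site.empty = η := by rw [← h, Function.update_eq_self]
    simp [h, this]
  · rw [Site.tot_of_ne_empty h, hf.occInvariant x η h]; ring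

/-- Induction on the support, revealing the occupation numbers one site at a time. -/
lemma induction_on {p : (Config → ℝ) → Prop} (hf : IsBlind f) (const : ∀ c, p fun _ => c)
    (reveal : ∀ (x : Lattice) (f : Config → ℝ), IsBlind f →
      p (fun η => f (Function.update η x refParticle)) →
      p (fun η => f (Function.update η x Site.empty)) → p f) : p f := by
  classical
  obtain ⟨A, hA⟩ := hf.isLocal
  induction A using Finset.induction_on generalizing f with
  | empty =>
    have : f = fun _ => f fun _ => Site.empty := funext fun η => hA fun x hx => by simp at hx
    exact this ▸ const _
  | insert a A _ ih =>
    rw [Finset.coe_insert] at hA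
    exact reveal a f hf (ih (hf.comp_update a Site.forget_refParticle) (dependsOn_comp_update hA _))
      (ih (hf.comp_update a Site.forget_empty) (dependsOn_comp_update hA _))

lemma observable (hf : IsBlind f) : Observable f := by
  refine hf.induction_on observable_const fun x f hf hpart hvac => ?_
  rw [funext (hf.eq_tot_mul_add x)]
  exact ((observable_occTot x).mul hpart).add ((observable_vacancy x).mul hvac)

end IsBlind

lemma isBlind_vacancy (x : Lattice) : IsBlind fun η => 1 - occTot x η :=
  (isBlind_const 1).sub (isBlind_occTot x)

lemma IsBlind.dgrad {f : Config → ℝ} (hf : IsBlind f) (x y : Lattice) : IsBlind (dgrad x y f) :=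
  ((isBlind_occTot x).mul (isBlind_vacancy y)).mul (hf.ugrad x y)

lemma IsBlind.E_eq_total_mul_add {f : Config → ℝ} (hf : IsBlind f) (α : GCParam) (x : Lattice) :
    α.E f = α.total * α.E (fun η => f (Function.update η x refParticle))
      + (1 - α.total) * α.E (fun η => f (Function.update η x Site.empty)) := by
  have hpart : Observable fun η => f (Function.update η x refParticle) :=
    hf.observable.comp_update _ _
  have hvac : Observable fun η => f (Function.update η x Site.empty) :=
    hf.observable.comp_update _ _
  have htot := siteObservable_tot.observable x
  have hEpart := α.E_site_mul_of_update_eq siteObservable_tot (x := x) hpart fun η s => by simp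
  have hEvac := α.E_site_mul_of_update_eq siteObservable_tot (x := x) hvac fun η s => by simp
  have hsplit : f = fun η => ((η x).tot * f (Function.update η x refParticle)
      + f (Function.update η x Site.empty)) - (η x).tot * f (Function.update η x Site.empty) := by
    funext η; rw [hf.eq_tot_mul_add x η]; ring
  conv_lhs => rw [hsplit]
  rw [α.E_sub ((htot.mul hpart).add hvac) (htot.mul hvac), α.E_add (htot.mul hpart) hvac,
    hEpart, hEvac, α.mean_tot]
  ring

lemma IsBlind.E_congr {α β : GCParam} (h : α.total = β.total) {f : Config → ℝ} (hf : IsBlind f) :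
    α.E f = β.E f := by
  refine hf.induction_on (p := fun f => α.E f = β.E f) (fun c => by rw [α.E_const, β.E_const])
    fun x f hf hpart hvac => ?_
  rw [hf.E_eq_total_mul_add α x, hf.E_eq_total_mul_add β x, h, hpart, hvac]

/-! ### Gradients of formal sums of translates -/

lemma e_ne_zero (i : Fin 2) : e i ≠ 0 := by simp [e]

lemma add_e_ne (y : Lattice) (i : Fin 2) : y + e i ≠ y := by simpa using e_ne_zero i

lemma shift_shift (x y : Lattice) (f : Config → ℝ) : shift y (shift x f) = shift (x + y) f := by
  funext η
  simp only [shift, add_assoc]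

lemma shift_zero (f : Config → ℝ) : shift 0 f = f := by
  funext η
  simp only [shift, add_zero]

lemma shift_ugrad (x a b : Lattice) (f : Config → ℝ) :
    shift x (ugrad a b f) = ugrad (a + x) (b + x) (shift x f) := by
  funext η
  have hswap : ∀ y, Equiv.swap a b y + x = Equiv.swap (a + x) (b + x) (y + x) := fun y =>
    (add_left_injective x).map_swap a b y
  simp only [shift, ugrad, exch, Function.comp_def, hswap]

lemma ugrad_eq_shift (y : Lattice) (i : Fin 2) (f : Config → ℝ) :
    ugrad y (y + e i) f = shift y (ugrad 0 (e i) (shift (-y) f)) := by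
  rw [shift_ugrad, shift_shift, neg_add_cancel, shift_zero, zero_add, add_comm]

lemma exch_comm (a b : Lattice) (η : Config) : exch a b η = exch b a η := by
  rw [exch, exch, Equiv.swap_comm]

lemma exch_exch (a b : Lattice) (η : Config) : exch a b (exch a b η) = η := by
  funext x
  simp [exch]

lemma exch_left (a b : Lattice) (η : Config) : exch a b η a = η b := by simp [exch]

lemma exch_right (a b : Lattice) (η : Config) : exch a b η b = η a := by simp [exch]

lemma exch_of_ne {a b x : Lattice} (ha : x ≠ a) (hb : x ≠ b) (η : Config) :
    exch a b η x = η x := by simp [exch, Equiv.swap_apply_of_ne_of_ne ha hb]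

lemma ugrad_eq_zero {f : Config → ℝ} {A : Finset Lattice} (hA : DependsOn f (A : Set Lattice))
    {a b : Lattice} (ha : a ∉ A) (hb : b ∉ A) (η : Config) : ugrad a b f η = 0 :=
  sub_eq_zero.2 <| hA fun _ hy =>
    exch_of_ne (ne_of_mem_of_not_mem hy ha) (ne_of_mem_of_not_mem hy hb) η

lemma dependsOn_shift {f : Config → ℝ} {A : Finset Lattice} (hA : DependsOn f (A : Set Lattice))
    (x : Lattice) :
    DependsOn (shift x f) ((A.map (addRightEmbedding x) : Finset Lattice) : Set Lattice) :=
  fun _ _ h => hA fun _ hy => h _ (Finset.mem_map_of_mem _ hy)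

lemma IsLocal.exists_ugrad_shift_eq_zero {f : Config → ℝ} (hf : IsLocal f) (a b : Lattice) :
    ∃ X : Finset Lattice, ∀ x ∉ X, ∀ η, ugrad a b (shift x f) η = 0 := by
  classical
  obtain ⟨A, hA⟩ := hf
  refine ⟨A.image (a - ·) ∪ A.image (b - ·), fun x hx η => ?_⟩
  simp only [Finset.mem_union, Finset.mem_image, not_or, not_exists, not_and] at hx
  have hnot : ∀ c, (∀ z ∈ A, c - z ≠ x) → c ∉ A.map (addRightEmbedding x) := by
    intro c hc hmem
    obtain ⟨z, hz, rfl⟩ := Finset.mem_map.1 hmem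
    exact hc z hz (add_sub_cancel_left z x)
  exact ugrad_eq_zero (dependsOn_shift hA x) (hnot a hx.1) (hnot b hx.2) η

lemma finsum_eq_sum_of_zero {ι M : Type*} [AddCommMonoid M] {f : ι → M} {X : Finset ι}
    (h : ∀ x ∉ X, f x = 0) : ∑ᶠ x, f x = ∑ x ∈ X, f x :=
  finsum_eq_sum_of_support_subset f fun x hx => by_contra fun hx' => hx (h x hx')

/-- The gradient `∇̃_{0,e_i} Σ_f` of the formal sum `Σ_f = ∑_x τ_x f`. -/
def sumGrad (i : Fin 2) (f : Config → ℝ) : Config → ℝ :=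
  fun η => ∑ᶠ x : Lattice, ugrad 0 (e i) (shift x f) η

lemma sumGrad_eq_sum {f : Config → ℝ} {i : Fin 2} {X : Finset Lattice}
    (hX : ∀ x ∉ X, ∀ η, ugrad 0 (e i) (shift x f) η = 0) :
    sumGrad i f = fun η => ∑ x ∈ X, ugrad 0 (e i) (shift x f) η :=
  funext fun η => finsum_eq_sum_of_zero fun x hx => hX x hx η

lemma Observable.sumGrad {f : Config → ℝ} (hf : Observable f) (i : Fin 2) :
    Observable (sumGrad i f) := by
  obtain ⟨X, hX⟩ := hf.isLocal.exists_ugrad_shift_eq_zero 0 (e i)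
  rw [sumGrad_eq_sum hX]
  exact Observable.sum X fun x _ => (hf.shift x).ugrad _ _

lemma sumGrad_add {f g : Config → ℝ} (hf : IsLocal f) (hg : IsLocal g) (i : Fin 2) :
    sumGrad i (fun η => f η + g η) = fun η => sumGrad i f η + sumGrad i g η := by
  obtain ⟨X, hX⟩ := hf.exists_ugrad_shift_eq_zero 0 (e i)
  obtain ⟨Y, hY⟩ := hg.exists_ugrad_shift_eq_zero 0 (e i)
  funext η
  have hsplit : ∀ x, ugrad 0 (e i) (shift x fun η => f η + g η) η
      = ugrad 0 (e i) (shift x f) η + ugrad 0 (e i) (shift x g) η := fun x => by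
    simp only [ugrad, shift]; ring
  have hfin : ∀ {F : Config → ℝ} {Z : Finset Lattice},
      (∀ x ∉ Z, ∀ η, ugrad 0 (e i) (shift x F) η = 0) →
      (Function.support fun x => ugrad 0 (e i) (shift x F) η).Finite := fun {_ Z} hZ =>
    Z.finite_toSet.subset fun x hx => by_contra fun hx' => hx (hZ x hx' η)
  simp only [sumGrad, hsplit]
  exact finsum_add_distrib (hfin hX) (hfin hY)

lemma sumGrad_const_mul (c : ℝ) (f : Config → ℝ) (i : Fin 2) :
    sumGrad i (fun η => c * f η) = fun η => c * sumGrad i f η := by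
  funext η
  simp only [sumGrad, mul_finsum]
  refine finsum_congr fun x => ?_
  simp only [ugrad, shift]; ring

lemma sumGrad_zero (i : Fin 2) : sumGrad i (fun _ => 0) = fun _ => 0 := by
  simpa using sumGrad_const_mul 0 (fun _ => 0) i

lemma sumGrad_shift (x : Lattice) (f : Config → ℝ) (i : Fin 2) :
    sumGrad i (shift x f) = sumGrad i f := by
  funext η
  simp only [sumGrad, shift_shift]
  exact finsum_comp_equiv (Equiv.addLeft x) (f := fun y => ugrad 0 (e i) (shift y f) η)

lemma IsLocal.exists_gen_eq_sum {g : Config → ℝ} (hg : IsLocal g) :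
    ∃ Z : Finset Lattice, (∀ y ∉ Z, ∀ i η, ugrad y (y + e i) g η = 0) ∧
      gen g = fun η => ∑ y ∈ Z, ∑ i, (dgrad y (y + e i) g η + dgrad (y + e i) y g η) := by
  classical
  obtain ⟨A, hA⟩ := hg
  let Z : Finset Lattice := A ∪ Finset.univ.biUnion (fun i => A.image (· - e i))
    ∪ Finset.univ.biUnion (fun i => A.image (· + e i))
  have hZ : ∀ y ∉ Z, y ∉ A ∧ ∀ i, y + e i ∉ A ∧ y - e i ∉ A := by
    intro y hy
    simp only [Z, Finset.mem_union, Finset.mem_biUnion, Finset.mem_image, Finset.mem_univ,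
      true_and, not_or, not_exists, not_and] at hy
    exact ⟨hy.1.1, fun i => ⟨fun h => hy.1.2 i _ h (by abel), fun h => hy.2 i _ h (by abel)⟩⟩
  have hright : ∀ y ∉ Z, ∀ i η, ugrad y (y + e i) g η = 0 := fun y hy i η =>
    ugrad_eq_zero hA (hZ y hy).1 ((hZ y hy).2 i).1 η
  have hback : ∀ y ∉ Z, ∀ i η, ugrad (y + e i) y g η = 0 := fun y hy i η =>
    ugrad_eq_zero hA ((hZ y hy).2 i).1 (hZ y hy).1 η
  have hleft : ∀ y ∉ Z, ∀ i η, ugrad y (y - e i) g η = 0 := fun y hy i η =>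
    ugrad_eq_zero hA (hZ y hy).1 ((hZ y hy).2 i).2 η
  refine ⟨Z, hright, funext fun η => ?_⟩
  have hreindex : ∀ i, ∑ y ∈ Z, dgrad y (y - e i) g η = ∑ y ∈ Z, dgrad (y + e i) y g η := by
    intro i
    rw [← finsum_eq_sum_of_zero fun y hy => by simp [dgrad, hleft y hy],
      ← finsum_eq_sum_of_zero fun y hy => by simp [dgrad, hback y hy],
      ← finsum_comp_equiv (Equiv.addRight (e i))]
    simp
  rw [gen, finsum_eq_sum_of_zero (X := Z) fun y hy => by
    simp [dgrad, hright y hy, hleft y hy], Finset.sum_comm]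
  conv_rhs => rw [Finset.sum_comm]
  simp only [Finset.sum_add_distrib, hreindex]

lemma Observable.gen {g : Config → ℝ} (hg : Observable g) : Observable (gen g) := by
  obtain ⟨Z, -, h⟩ := hg.isLocal.exists_gen_eq_sum
  rw [h]
  exact Observable.sum Z fun y _ => Observable.sum _ fun i _ => (hg.dgrad _ _).add (hg.dgrad _ _)

/-! ### Integration by parts -/

/-- The current `j_i^v` of a function `v` of the state of one site. -/
def siteCurrent (v : Site → ℝ) (i : Fin 2) : Config → ℝ := fun η =>
  v (η 0) * (1 - occTot (e i) η) - v (η (e i)) * (1 - occTot 0 η)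

/-- The local gradient `δ_i v` of a function `v` of the state of one site. -/
def siteGrad (v : Site → ℝ) (i : Fin 2) : Config → ℝ := fun η => v (η (e i)) - v (η 0)

lemma SiteObservable.siteCurrent {v : Site → ℝ} (hv : SiteObservable v) (i : Fin 2) :
    Observable (siteCurrent v i) :=
  ((hv.observable _).mul (observable_vacancy _)).sub ((hv.observable _).mul (observable_vacancy _))

lemma SiteObservable.siteGrad {v : Site → ℝ} (hv : SiteObservable v) (i : Fin 2) :
    Observable (siteGrad v i) :=
  (hv.observable _).sub (hv.observable _)

lemma GCParam.E_siteCurrent_mul (α : GCParam) {v : Site → ℝ} (hv : SiteObservable v) (i : Fin 2)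
    {K : Config → ℝ} (hK : Observable K) :
    α.E (fun η => siteCurrent v i η * K η) = -α.E (fun η => v (η 0) * dgrad 0 (e i) K η) := by
  have hout : Observable fun η => v (η 0) * (1 - occTot (e i) η) * K η :=
    ((hv.observable _).mul (observable_vacancy _)).mul hK
  have hin : Observable fun η => v (η (e i)) * (1 - occTot 0 η) * K η :=
    ((hv.observable _).mul (observable_vacancy _)).mul hK
  calc α.E (fun η => siteCurrent v i η * K η)
      = α.E (fun η => v (η 0) * (1 - occTot (e i) η) * K η
          - v (η (e i)) * (1 - occTot 0 η) * K η) := by simp only [siteCurrent, sub_mul]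
    _ = α.E (fun η => v (η 0) * (1 - occTot (e i) η) * K η
          - v (exch 0 (e i) η (e i)) * (1 - occTot 0 (exch 0 (e i) η)) * K (exch 0 (e i) η)) := by
        rw [α.E_sub hout hin, α.E_sub hout (hin.comp_exch 0 (e i)), α.E_comp_exch hin]
    _ = -α.E (fun η => v (η 0) * dgrad 0 (e i) K η) := by
        rw [← α.E_neg]
        congr 1; funext η
        simp only [occTot_eq, exch_left, exch_right, dgrad, ugrad]
        linear_combination (1 - (η (e i)).tot) * (K (exch 0 (e i) η) - K η) * hv.mul_tot (η 0)

lemma GCParam.E_dgrad_mul (α : GCParam) {a b : Lattice} {g K : Config → ℝ} (hg : Observable g)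
    (hK : Observable K) :
    α.E (fun η => (dgrad a b g η + dgrad b a g η) * K η)
      = -α.E (fun η => ugrad a b g η * dgrad a b K η) := by
  have hab : Observable fun η => dgrad a b g η * K η := (hg.dgrad a b).mul hK
  have hba : Observable fun η => dgrad b a g η * K η := (hg.dgrad b a).mul hK
  calc α.E (fun η => (dgrad a b g η + dgrad b a g η) * K η)
      = α.E (fun η => dgrad a b g η * K η + dgrad b a g η * K η) := by simp only [add_mul]
    _ = α.E (fun η => dgrad a b g η * K η + dgrad b a g (exch a b η) * K (exch a b η)) := by
        rw [α.E_add hab hba, α.E_add hab (hba.comp_exch a b), α.E_comp_exch hba]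
    _ = -α.E (fun η => ugrad a b g η * dgrad a b K η) := by
        rw [← α.E_neg]
        congr 1; funext η
        simp only [occTot_eq, exch_left, exch_right, dgrad, ugrad, exch_comm b a, exch_exch]
        ring

lemma GCParam.E_gen_mul (α : GCParam) {g K : Config → ℝ} (hg : Observable g) (hK : Observable K)
    {Z : Finset Lattice} (hgen : gen g = fun η =>
      ∑ y ∈ Z, ∑ i, (dgrad y (y + e i) g η + dgrad (y + e i) y g η)) :
    α.E (fun η => gen g η * K η)
      = -∑ y ∈ Z, ∑ i, α.E (fun η => ugrad y (y + e i) g η * dgrad y (y + e i) K η) := by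
  have hterm : ∀ y i,
      Observable fun η => (dgrad y (y + e i) g η + dgrad (y + e i) y g η) * K η :=
    fun y i => ((hg.dgrad _ _).add (hg.dgrad _ _)).mul hK
  simp only [hgen, Finset.sum_mul]
  rw [α.E_sum Z fun y _ => Observable.sum _ fun i _ => hterm y i]
  simp only [fun y => α.E_sum Finset.univ fun i _ => hterm y i, α.E_dgrad_mul hg hK,
    Finset.sum_neg_distrib]

/-- `K` is a family of observables whose formal sum has the directed gradient `τ_y (U i)` along the
edge from `y` to `y + e_i`. -/
structure HasDirectedGrad (K : Lattice → Config → ℝ) (U : Fin 2 → Config → ℝ) : Prop where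
  observable : ∀ x, Observable (K x)
  observable_grad : ∀ i, Observable (U i)
  finite : ∀ y i, ∃ X : Finset Lattice, ∀ x ∉ X, ∀ η, ugrad y (y + e i) (K x) η = 0
  finsum_eq : ∀ y i η, ∑ᶠ x, dgrad y (y + e i) (K x) η = shift y (U i) η

/-- `∑_x E[φ K_x] = r`, with finitely many non-zero terms. -/
def HasPairSum (α : GCParam) (φ : Config → ℝ) (K : Lattice → Config → ℝ) (r : ℝ) : Prop :=
  (Function.support fun x => α.E fun η => φ η * K x η).Finite ∧
    ∑ᶠ x, α.E (fun η => φ η * K x η) = r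

section
variable {α : GCParam} {φ ψ : Config → ℝ} {K : Lattice → Config → ℝ} {U : Fin 2 → Config → ℝ}
  {r s : ℝ} {v w : Site → ℝ}

lemma HasPairSum.of_sum {X : Finset Lattice}
    (h0 : ∀ x ∉ X, α.E (fun η => φ η * K x η) = 0)
    (hr : ∑ x ∈ X, α.E (fun η => φ η * K x η) = r) : HasPairSum α φ K r :=
  ⟨X.finite_toSet.subset fun x hx => by_contra fun hx' => hx (h0 x hx'),
    (finsum_eq_sum_of_zero h0).trans hr⟩

lemma HasPairSum.add (hφ : Observable φ) (hψ : Observable ψ) (hK : ∀ x, Observable (K x))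
    (hr : HasPairSum α φ K r) (hs : HasPairSum α ψ K s) :
    HasPairSum α (fun η => φ η + ψ η) K (r + s) := by
  have h : (fun x => α.E fun η => (φ η + ψ η) * K x η)
      = fun x => α.E (fun η => φ η * K x η) + α.E (fun η => ψ η * K x η) := by
    funext x
    simp only [add_mul, α.E_add (hφ.mul (hK x)) (hψ.mul (hK x))]
  rw [HasPairSum, h, finsum_add_distrib hr.1 hs.1, hr.2, hs.2]
  exact ⟨(hr.1.union hs.1).subset (Function.support_add _ _), rfl⟩

lemma HasPairSum.const_mul (c : ℝ) (hr : HasPairSum α φ K r) :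
    HasPairSum α (fun η => c * φ η) K (c * r) := by
  have h : (fun x => α.E fun η => c * φ η * K x η)
      = fun x => c * α.E (fun η => φ η * K x η) := by
    funext x
    simp only [mul_assoc, α.E_const_mul]
  rw [HasPairSum, h, ← mul_finsum, hr.2]
  exact ⟨hr.1.subset fun x hx => right_ne_zero_of_mul hx, rfl⟩

lemma HasDirectedGrad.sum_eq (hK : HasDirectedGrad K U) {y : Lattice} {i : Fin 2}
    {X : Finset Lattice} (hX : ∀ x ∉ X, ∀ η, ugrad y (y + e i) (K x) η = 0) (η : Config) :
    ∑ x ∈ X, dgrad y (y + e i) (K x) η = shift y (U i) η := by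
  rw [← hK.finsum_eq, finsum_eq_sum_of_zero fun x hx => by simp [dgrad, hX x hx]]

lemma HasDirectedGrad.hasPairSum_siteCurrent (hK : HasDirectedGrad K U) (hv : SiteObservable v)
    (i : Fin 2) : HasPairSum α (siteCurrent v i) K (-α.E (fun η => v (η 0) * U i η)) := by
  obtain ⟨X, hX⟩ := hK.finite 0 i
  have hsum := hK.sum_eq hX
  simp only [zero_add, shift_zero] at hX hsum
  refine HasPairSum.of_sum (X := X) (fun x hx => ?_) ?_
  · rw [α.E_siteCurrent_mul hv i (hK.observable x)]
    simp [dgrad, hX x hx, α.E_const]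
  · simp only [fun x => α.E_siteCurrent_mul hv i (hK.observable x), Finset.sum_neg_distrib]
    rw [← α.E_sum X fun x _ => (hv.observable 0).mul ((hK.observable x).dgrad _ _)]
    simp only [← Finset.mul_sum, hsum]

lemma HasDirectedGrad.sum_E_ugrad_mul (hK : HasDirectedGrad K U) {g : Config → ℝ}
    (hg : Observable g) {y : Lattice} {i : Fin 2} {X : Finset Lattice}
    (hX : ∀ x ∉ X, ∀ η, ugrad y (y + e i) (K x) η = 0) :
    ∑ x ∈ X, α.E (fun η => ugrad y (y + e i) g η * dgrad y (y + e i) (K x) η)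
      = α.E (fun η => ugrad 0 (e i) (shift (-y) g) η * U i η) := by
  rw [← α.E_sum X fun x _ => (hg.ugrad _ _).mul ((hK.observable x).dgrad _ _)]
  simp only [← Finset.mul_sum, hK.sum_eq hX]
  rw [ugrad_eq_shift, ← α.E_shift (((hg.shift _).ugrad _ _).mul (hK.observable_grad i)) y]
  rfl

lemma sumGrad_eq_sum_neg {g : Config → ℝ} {i : Fin 2} {Z : Finset Lattice}
    (hZ : ∀ y ∉ Z, ∀ η, ugrad y (y + e i) g η = 0) :
    sumGrad i g = fun η => ∑ y ∈ Z, ugrad 0 (e i) (shift (-y) g) η := by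
  rw [sumGrad_eq_sum (X := Z.map (Equiv.neg Lattice).toEmbedding)]
  · simp only [Finset.sum_map, Equiv.coe_toEmbedding, Equiv.neg_apply]
  · intro x hx η
    have hx' : -x ∉ Z := fun h => hx (by simpa using h)
    have h := hZ (-x) hx' (fun z => η (z + x))
    rw [ugrad_eq_shift, neg_neg] at h
    simpa [shift] using h

lemma HasDirectedGrad.hasPairSum_gen (hK : HasDirectedGrad K U) {g : Config → ℝ}
    (hg : Observable g) :
    HasPairSum α (gen g) K (-∑ i, α.E (fun η => sumGrad i g η * U i η)) := by
  classical
  obtain ⟨Z, hZ, hgen⟩ := hg.isLocal.exists_gen_eq_sum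
  choose X hX using hK.finite
  let Y : Finset Lattice := Z.biUnion fun y => Finset.univ.biUnion fun i => X y i
  have hY : ∀ y ∈ Z, ∀ i, ∀ x ∉ Y, ∀ η, ugrad y (y + e i) (K x) η = 0 := fun y hy i x hx =>
    hX y i x fun h => hx (Finset.mem_biUnion.2 ⟨y, hy, Finset.mem_biUnion.2 ⟨i, by simp, h⟩⟩)
  refine HasPairSum.of_sum (X := Y) (fun x hx => ?_) ?_
  · rw [α.E_gen_mul hg (hK.observable x) hgen, neg_eq_zero]
    refine Finset.sum_eq_zero fun y hy => Finset.sum_eq_zero fun i _ => ?_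
    simp [dgrad, hY y hy i x hx, α.E_const]
  · simp only [fun x => α.E_gen_mul hg (hK.observable x) hgen, Finset.sum_neg_distrib]
    rw [Finset.sum_comm, Finset.sum_congr rfl fun y _ => Finset.sum_comm]
    rw [Finset.sum_congr rfl fun y hy =>
      Finset.sum_congr rfl fun i _ => hK.sum_E_ugrad_mul hg (hY y hy i), Finset.sum_comm]
    congr 1
    refine Finset.sum_congr rfl fun i _ => ?_
    rw [← α.E_sum Z fun y _ => ((hg.shift _).ugrad _ _).mul (hK.observable_grad i),
      sumGrad_eq_sum_neg fun y hy => hZ y hy i]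
    simp only [Finset.sum_mul]

lemma hasDirectedGrad_shift {h : Config → ℝ} (hh : Observable h) :
    HasDirectedGrad (fun x => shift x h)
      (fun i η => occTot 0 η * (1 - occTot (e i) η) * sumGrad i h η) where
  observable x := hh.shift x
  observable_grad i := ((observable_occTot _).mul (observable_vacancy _)).mul (hh.sumGrad i)
  finite y i := hh.isLocal.exists_ugrad_shift_eq_zero _ _
  finsum_eq y i η := by
    simp only [dgrad, ← mul_finsum, shift, sumGrad, occTot_eq, zero_add, add_comm (e i) y]
    congr 1
    rw [← finsum_comp_equiv (Equiv.addRight y)]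
    refine finsum_congr fun x => ?_
    change ugrad y (y + e i) (shift (x + y) h) η = shift y (ugrad 0 (e i) (shift x h)) η
    rw [ugrad_eq_shift, shift_shift, add_neg_cancel_right]

lemma hasDirectedGrad_linear (hv : SiteObservable v) (k : Fin 2) :
    HasDirectedGrad (fun x η => (x k : ℝ) * v (η x))
      (fun i η => if i = k then v (η 0) * (1 - occTot (e i) η) else 0) where
  observable x := (hv.observable x).const_mul _
  observable_grad i := by
    split_ifs
    · exact (hv.observable 0).mul (observable_vacancy _)
    · exact observable_const 0
  finite y i := by
    classical
    refine ⟨{y, y + e i}, fun x hx η => ?_⟩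
    simp only [Finset.mem_insert, Finset.mem_singleton, not_or] at hx
    simp [ugrad, exch_of_ne hx.1 hx.2]
  finsum_eq y i η := by
    classical
    rw [finsum_eq_sum_of_zero (X := {y, y + e i}), Finset.sum_pair (add_e_ne y i).symm]
    · have hvac := hv.mul_one_sub_tot (η (y + e i))
      have hocc := hv.mul_tot (η y)
      have hk : e i k = if i = k then 1 else 0 := by simp [e, Pi.single_apply, eq_comm]
      simp only [dgrad, ugrad, exch_left, exch_right, shift, occTot_eq, zero_add, add_comm (e i) y,
        Pi.add_apply, hk]
      split_ifs
      · push_cast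
        linear_combination (-(η y).tot) * hvac + (1 - (η (y + e i)).tot) * hocc
      · push_cast
        ring
    · intro x hx
      simp only [Finset.mem_insert, Finset.mem_singleton, not_or] at hx
      simp [dgrad, ugrad, exch_of_ne hx.1 hx.2]

lemma GCParam.finite_support_E_site_mul_shift_sub (α : GCParam) (hv : SiteObservable v)
    {h : Config → ℝ} (hh : Observable h) :
    (Function.support fun x => α.E (fun η => v (η 0) * shift x h η) - α.mean v * α.E h).Finite := by
  classical
  obtain ⟨A, hA⟩ := hh.isLocal
  refine (A.image fun z => -z).finite_toSet.subset fun x hx => by_contra fun hxA => hx ?_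
  have hupdate : ∀ (η : Config) s, shift x h (Function.update η 0 s) = shift x h η := by
    refine fun η s => dependsOn_shift hA x fun y hy => Function.update_of_ne ?_ s η
    rintro rfl
    obtain ⟨z, hz, hzx⟩ := Finset.mem_map.1 (Finset.mem_coe.1 hy)
    exact hxA (Finset.mem_coe.2 (Finset.mem_image.2 ⟨z, hz, neg_eq_of_add_eq_zero_right hzx⟩))
  change α.E _ - _ = 0
  rw [α.E_site_mul_of_update_eq hv (hh.shift x) hupdate, α.E_shift hh, sub_self]

lemma GCParam.E_siteGrad_mul_shift (α : GCParam) (hv : SiteObservable v) (i : Fin 2)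
    {h : Config → ℝ} (hh : Observable h) (x : Lattice) :
    α.E (fun η => siteGrad v i η * shift x h η)
      = α.E (fun η => v (η 0) * shift (x - e i) h η) - α.E (fun η => v (η 0) * shift x h η) := by
  have htranslate : shift (e i) (fun η => v (η 0) * shift (x - e i) h η)
      = fun η => v (η (e i)) * shift x h η := by
    have hx : shift (e i) (shift (x - e i) h) = shift x h := by rw [shift_shift, sub_add_cancel]
    rw [← hx]
    funext η
    simp only [shift, zero_add]
  rw [← α.E_shift ((hv.observable 0).mul (hh.shift (x - e i))) (e i), htranslate,
    ← α.E_sub ((hv.observable _).mul (hh.shift x)) ((hv.observable _).mul (hh.shift x))]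
  simp only [siteGrad, sub_mul]

lemma hasPairSum_siteGrad_shift (hv : SiteObservable v) (i : Fin 2) {h : Config → ℝ}
    (hh : Observable h) : HasPairSum α (siteGrad v i) (fun x => shift x h) 0 := by
  set w : Lattice → ℝ := fun x => α.E (fun η => v (η 0) * shift x h η) - α.mean v * α.E h
  have hw : (Function.support w).Finite := α.finite_support_E_site_mul_shift_sub hv hh
  have hw' : (Function.support fun x => w (x - e i)).Finite :=
    hw.preimage (f := fun x => x - e i) (sub_left_injective.injOn)
  have htelescope : (fun x => α.E fun η => siteGrad v i η * shift x h η)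
      = fun x => w (x - e i) - w x := by
    funext x
    rw [α.E_siteGrad_mul_shift hv i hh]
    simp only [w, sub_sub_sub_cancel_right]
  rw [HasPairSum, htelescope]
  refine ⟨(hw'.union hw).subset (Function.support_sub _ _), ?_⟩
  rw [finsum_sub_distrib hw' hw, sub_eq_zero]
  exact finsum_comp_equiv (Equiv.subRight (e i)) (f := w)

lemma GCParam.E_site_mul_site (α : GCParam) (hv : SiteObservable v) (hw : SiteObservable w)
    {x y : Lattice} (h : x ≠ y) : α.E (fun η => v (η x) * w (η y)) = α.mean v * α.mean w := by
  rw [α.E_site_mul_of_update_eq hv (hw.observable y) fun η s => by simp [h.symm], α.E_site hw]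

lemma hasPairSum_siteGrad_linear (hv : SiteObservable v) (hw : SiteObservable w) (i k : Fin 2) :
    HasPairSum α (siteGrad v i) (fun x η => (x k : ℝ) * w (η x))
      (if i = k then α.mean (fun s => v s * w s) - α.mean v * α.mean w else 0) := by
  have hE : ∀ x : Lattice, α.E (fun η => siteGrad v i η * ((x k : ℝ) * w (η x)))
      = (x k : ℝ) *
        (α.E (fun η => v (η (e i)) * w (η x)) - α.E (fun η => v (η 0) * w (η x))) := by
    intro x
    rw [← α.E_sub ((hv.observable _).mul (hw.observable x))
      ((hv.observable _).mul (hw.observable x)), ← α.E_const_mul]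
    congr 1; funext η; simp only [siteGrad]; ring
  refine HasPairSum.of_sum (X := {e i}) (fun x hx => ?_) ?_
  · rw [hE]
    rcases eq_or_ne x 0 with rfl | h0
    · simp
    · rw [α.E_site_mul_site hv hw (Ne.symm (Finset.notMem_singleton.1 hx)),
        α.E_site_mul_site hv hw h0.symm, sub_self, mul_zero]
  · rw [Finset.sum_singleton, hE, α.E_site_mul_site hv hw (e_ne_zero i).symm,
      α.E_site (hv.mul hw) (e i)]
    by_cases h : i = k
    · subst h; simp [e]
    · simp [e, h, Ne.symm h]

end

/-! ### The quadratic form of the tagged particle -/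

open Classical in
/-- The increment of the pair `(c, f)` when a particle jumps from the origin to `z`, as seen from a
tagged particle at `y`. For `y = 0` it is the tagged particle that jumps, and that gains `c`; the
site `y = z` is excluded since it has to be vacant. -/
def tagGrad (z : Lattice) (c : ℝ) (f : Config → ℝ) (y : Lattice) : Config → ℝ := fun η =>
  if y = 0 then (1 - occTot z η) * (c + shift z f (exch 0 z η) - f η)
  else if y = z then 0 else dgrad 0 z (shift y f) η

/-- The density of the bilinear form of the tagged particle in the direction `z`. -/
def tagDensity (z : Lattice) (c : ℝ) (f : Config → ℝ) (c' : ℝ) (f' : Config → ℝ) : Config → ℝ :=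
  fun η => ∑ᶠ y : Lattice, tagGrad z c f y η * tagGrad z c' f' y η

/-- The bilinear form on pairs `(c, f)` of a vector and a blind function whose quadratic form,
minimized over `f`, is `c ↦ cᵀ D_s c`. -/
def tagForm (α : GCParam) (c : Fin 2 → ℝ) (f : Config → ℝ) (c' : Fin 2 → ℝ) (f' : Config → ℝ) :
    ℝ :=
  ∑ i, α.E (tagDensity (e i) (c i) f (c' i) f')

lemma tagGrad_zero (z : Lattice) (c : ℝ) (f : Config → ℝ) (η : Config) :
    tagGrad z c f 0 η = (1 - occTot z η) * (c + shift z f (exch 0 z η) - f η) := if_pos rfl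

lemma tagGrad_self {z : Lattice} (hz : z ≠ 0) (c : ℝ) (f : Config → ℝ) (η : Config) :
    tagGrad z c f z η = 0 := by
  rw [tagGrad, if_neg hz, if_pos rfl]

lemma tagGrad_of_ne {z y : Lattice} (hy : y ≠ 0) (hyz : y ≠ z) (c : ℝ) (f : Config → ℝ)
    (η : Config) : tagGrad z c f y η = dgrad 0 z (shift y f) η := by
  rw [tagGrad, if_neg hy, if_neg hyz]

lemma IsBlind.tagGrad {f : Config → ℝ} (hf : IsBlind f) (z : Lattice) (c : ℝ) (y : Lattice) :
    IsBlind (tagGrad z c f y) := by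
  unfold APLG.tagGrad
  split_ifs
  · exact (isBlind_vacancy z).mul (((isBlind_const c).add ((hf.shift z).comp_exch 0 z)).sub hf)
  · exact isBlind_const 0
  · exact (hf.shift y).dgrad 0 z

lemma IsLocal.exists_tagGrad_eq_zero {f : Config → ℝ} (hf : IsLocal f) (z : Lattice) :
    ∃ X : Finset Lattice, ∀ y ∉ X, ∀ c η, tagGrad z c f y η = 0 := by
  obtain ⟨X, hX⟩ := hf.exists_ugrad_shift_eq_zero 0 z
  refine ⟨insert 0 X, fun y hy c η => ?_⟩
  rw [Finset.mem_insert, not_or] at hy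
  rcases eq_or_ne y z with rfl | hyz
  · exact tagGrad_self hy.1 c f η
  · rw [tagGrad_of_ne hy.1 hyz, dgrad, hX y hy.2, mul_zero]

lemma tagDensity_eq_sum {z : Lattice} {c : ℝ} {f : Config → ℝ} {X : Finset Lattice}
    (hX : ∀ y ∉ X, ∀ η, tagGrad z c f y η = 0) (c' : ℝ) (f' : Config → ℝ) (η : Config) :
    tagDensity z c f c' f' η = ∑ y ∈ X, tagGrad z c f y η * tagGrad z c' f' y η := by
  rw [tagDensity, finsum_eq_sum_of_zero fun y hy => by rw [hX y hy, zero_mul]]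

lemma IsBlind.tagDensity {f f' : Config → ℝ} (hf : IsBlind f) (hf' : IsBlind f') (z : Lattice)
    (c c' : ℝ) : IsBlind (tagDensity z c f c' f') := by
  obtain ⟨X, hX⟩ := hf.isLocal.exists_tagGrad_eq_zero z
  rw [funext (tagDensity_eq_sum (fun y hy => hX y hy c) c' f')]
  exact IsBlind.sum X fun y _ => (hf.tagGrad z c y).mul (hf'.tagGrad z c' y)

lemma tagDensity_comm (z : Lattice) (c : ℝ) (f : Config → ℝ) (c' : ℝ) (f' : Config → ℝ) :
    tagDensity z c f c' f' = tagDensity z c' f' c f := by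
  funext η
  simp only [tagDensity, mul_comm (tagGrad z c f _ η)]

lemma tagGrad_add (z : Lattice) (c d : ℝ) (f g : Config → ℝ) (y : Lattice) (η : Config) :
    tagGrad z (c + d) (fun η => f η + g η) y η = tagGrad z c f y η + tagGrad z d g y η := by
  simp only [tagGrad, dgrad, ugrad, shift]
  split_ifs <;> ring

lemma tagGrad_const_mul (z : Lattice) (t c : ℝ) (f : Config → ℝ) (y : Lattice) (η : Config) :
    tagGrad z (t * c) (fun η => t * f η) y η = t * tagGrad z c f y η := by
  simp only [tagGrad, dgrad, ugrad, shift]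
  split_ifs <;> ring

lemma tagDensity_add {f g : Config → ℝ} (hf : IsLocal f) (hg : IsLocal g) (z : Lattice)
    (c d c' : ℝ) (f' : Config → ℝ) (η : Config) :
    tagDensity z (c + d) (fun η => f η + g η) c' f' η
      = tagDensity z c f c' f' η + tagDensity z d g c' f' η := by
  have hfin : ∀ {h : Config → ℝ} (a : ℝ), IsLocal h →
      (Function.support fun y => tagGrad z a h y η * tagGrad z c' f' y η).Finite := fun a hh => by
    obtain ⟨X, hX⟩ := hh.exists_tagGrad_eq_zero z
    exact X.finite_toSet.subset fun y hy => by_contra fun hy' => hy (by simp [hX y hy'])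
  simp only [tagDensity, tagGrad_add, add_mul, finsum_add_distrib (hfin c hf) (hfin d hg)]

lemma tagDensity_const_mul (z : Lattice) (t c : ℝ) (f : Config → ℝ) (c' : ℝ) (f' : Config → ℝ)
    (η : Config) :
    tagDensity z (t * c) (fun η => t * f η) c' f' η = t * tagDensity z c f c' f' η := by
  simp only [tagDensity, tagGrad_const_mul, mul_assoc, ← mul_finsum]

lemma tagDensity_self_nonneg (z : Lattice) (c : ℝ) (f : Config → ℝ) (η : Config) :
    0 ≤ tagDensity z c f c f η :=
  finsum_nonneg fun _ => mul_self_nonneg _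

lemma tagDensity_self_eq {f : Config → ℝ} (hf : IsLocal f) (z : Lattice) (c : ℝ) (η : Config) :
    tagDensity z c f c f η
      = (1 - occTot z η) * (c + shift z f (exch 0 z η) - f η) ^ 2
        + ∑ᶠ (y : Lattice) (_ : y ≠ 0 ∧ y ≠ z), dgrad 0 z (shift y f) η ^ 2 := by
  classical
  obtain ⟨X, hX⟩ := hf.exists_tagGrad_eq_zero z
  have hterm : ∀ y, (if y = 0 then 0 else tagGrad z c f y η ^ 2)
      = if y ≠ 0 ∧ y ≠ z then dgrad 0 z (shift y f) η ^ 2 else 0 := fun y => by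
    rw [tagGrad]
    split_ifs <;> simp_all
  have hvac : (1 - occTot z η) * (1 - occTot z η) = 1 - occTot z η := by
    rw [occTot_eq]
    linear_combination (η z).tot_mul_self
  simp only [finsum_eq_if, ← hterm]
  rw [tagDensity, finsum_eq_sum_of_zero (X := insert 0 X) fun y hy => by
      rw [hX y fun h => hy (Finset.mem_insert_of_mem h), zero_mul],
    finsum_eq_sum_of_zero (X := insert 0 X) fun y hy => by
      rw [hX y fun h => hy (Finset.mem_insert_of_mem h), zero_pow two_ne_zero, ite_self],
    ← Finset.add_sum_erase _ _ (Finset.mem_insert_self 0 X),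
    ← Finset.sum_erase (a := 0) (f := fun y => if y = 0 then 0 else tagGrad z c f y η ^ 2) _
      (if_pos rfl), tagGrad_zero]
  refine congrArg₂ (· + ·) ?_ (Finset.sum_congr rfl fun y hy => ?_)
  · linear_combination (c + shift z f (exch 0 z η) - f η) ^ 2 * hvac
  · rw [if_neg (Finset.ne_of_mem_erase hy), sq]

section
variable (α : GCParam) {f g f' : Config → ℝ}

lemma tagForm_comm (c : Fin 2 → ℝ) (f : Config → ℝ) (c' : Fin 2 → ℝ) (f' : Config → ℝ) :
    tagForm α c f c' f' = tagForm α c' f' c f := by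
  simp only [tagForm, tagDensity_comm _ _ f]

lemma tagForm_add (hf : IsBlind f) (hg : IsBlind g) (hf' : IsBlind f') (c d c' : Fin 2 → ℝ) :
    tagForm α (c + d) (fun η => f η + g η) c' f' = tagForm α c f c' f' + tagForm α d g c' f' := by
  simp only [tagForm, ← Finset.sum_add_distrib]
  refine Finset.sum_congr rfl fun i _ => ?_
  rw [← α.E_add (hf.tagDensity hf' _ _ _).observable (hg.tagDensity hf' _ _ _).observable]
  exact congrArg α.E (funext fun η => tagDensity_add hf.isLocal hg.isLocal _ _ _ _ _ η)

lemma tagForm_smul (t : ℝ) (c : Fin 2 → ℝ) (f : Config → ℝ) (c' : Fin 2 → ℝ) (f' : Config → ℝ) :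
    tagForm α (t • c) (fun η => t * f η) c' f' = t * tagForm α c f c' f' := by
  simp only [tagForm, Finset.mul_sum, ← α.E_const_mul]
  exact Finset.sum_congr rfl fun i _ =>
    congrArg α.E (funext fun η => tagDensity_const_mul _ t (c i) f (c' i) f' η)

lemma tagForm_add_right (hf : IsBlind f) (hg : IsBlind g) (hf' : IsBlind f')
    (c d c' : Fin 2 → ℝ) :
    tagForm α c' f' (c + d) (fun η => f η + g η) = tagForm α c' f' c f + tagForm α c' f' d g := by
  rw [tagForm_comm, tagForm_add α hf hg hf', tagForm_comm α c, tagForm_comm α d]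

lemma tagForm_smul_right (t : ℝ) (c : Fin 2 → ℝ) (f : Config → ℝ) (c' : Fin 2 → ℝ)
    (f' : Config → ℝ) :
    tagForm α c' f' (t • c) (fun η => t * f η) = t * tagForm α c' f' c f := by
  rw [tagForm_comm, tagForm_smul, tagForm_comm]

lemma tagForm_smul_self (t : ℝ) (c : Fin 2 → ℝ) (f : Config → ℝ) :
    tagForm α (t • c) (fun η => t * f η) (t • c) (fun η => t * f η)
      = t ^ 2 * tagForm α c f c f := by
  rw [tagForm_smul, tagForm_smul_right]; ring

lemma tagForm_add_self (hf : IsBlind f) (hg : IsBlind g) (c d : Fin 2 → ℝ) :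
    tagForm α (c + d) (fun η => f η + g η) (c + d) (fun η => f η + g η)
      = tagForm α c f c f + 2 * tagForm α c f d g + tagForm α d g d g := by
  rw [tagForm_add α hf hg (hf.add hg), tagForm_add_right α hf hg hf,
    tagForm_add_right α hf hg hg, tagForm_comm α d g c f]
  ring

lemma tagForm_smul_add_smul (hf : IsBlind f) (hg : IsBlind g) (c d : Fin 2 → ℝ) (a b : ℝ) :
    tagForm α (a • c + b • d) (fun η => a * f η + b * g η) (a • c + b • d)
        (fun η => a * f η + b * g η)
      = a ^ 2 * tagForm α c f c f + 2 * a * b * tagForm α c f d g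
        + b ^ 2 * tagForm α d g d g := by
  rw [tagForm_add_self α (hf.const_mul a) (hg.const_mul b), tagForm_smul_self, tagForm_smul_self,
    tagForm_smul, tagForm_smul_right]
  ring

lemma tagForm_self_nonneg (c : Fin 2 → ℝ) (f : Config → ℝ) : 0 ≤ tagForm α c f c f :=
  Finset.sum_nonneg fun _ _ => α.E_nonneg fun η => tagDensity_self_nonneg _ _ _ η

lemma sq_le_mul_of_forall_nonneg {a b c : ℝ} (h : ∀ t : ℝ, 0 ≤ a + 2 * t * b + t ^ 2 * c) :
    b ^ 2 ≤ a * c := by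
  have hdiscrim := discrim_le_zero (a := c) (b := 2 * b) (c := a) fun t => by
    linarith [h t]
  rw [discrim] at hdiscrim
  linarith

lemma tagForm_sq_le (hf : IsBlind f) (hg : IsBlind g) (c d : Fin 2 → ℝ) :
    tagForm α c f d g ^ 2 ≤ tagForm α c f c f * tagForm α d g d g :=
  sq_le_mul_of_forall_nonneg fun t => by
    have h := tagForm_smul_add_smul α hf hg c d 1 t
    rw [one_pow, one_mul, mul_one] at h
    rw [← h]
    exact tagForm_self_nonneg α _ _

end

/-! ### Isotropy -/

lemma exch_comp_addEquiv (S : Lattice ≃+ Lattice) (z : Lattice) (η : Config) :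
    exch 0 (S z) η ∘ S = exch 0 z (η ∘ S) := by
  funext y
  have h : Equiv.swap 0 (S z) (S y) = S (Equiv.swap 0 z y) := by
    simpa using (S.injective.map_swap 0 z y).symm
  simp [exch, h]

lemma shift_comp_addEquiv (S : Lattice ≃+ Lattice) (y : Lattice) (f : Config → ℝ) (η : Config) :
    shift (S y) (fun ξ => f (ξ ∘ S)) η = shift y f (η ∘ S) := by
  simp only [shift, Function.comp_def, map_add]

lemma tagGrad_comp_addEquiv (S : Lattice ≃+ Lattice) (z : Lattice) (c : ℝ) (f : Config → ℝ)
    (y : Lattice) (η : Config) :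
    tagGrad (S z) c (fun ξ => f (ξ ∘ S)) (S y) η = tagGrad z c f y (η ∘ S) := by
  simp only [tagGrad, dgrad, ugrad, shift_comp_addEquiv, exch_comp_addEquiv, occTot_eq,
    Function.comp_apply, map_zero, EmbeddingLike.apply_eq_iff_eq, EmbeddingLike.map_eq_zero_iff]

lemma tagDensity_comp_addEquiv (S : Lattice ≃+ Lattice) (z : Lattice) (c : ℝ) (f : Config → ℝ)
    (η : Config) :
    tagDensity (S z) c (fun ξ => f (ξ ∘ S)) c (fun ξ => f (ξ ∘ S)) η
      = tagDensity z c f c f (η ∘ S) := by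
  rw [tagDensity, tagDensity, ← finsum_comp_equiv S.toEquiv]
  exact finsum_congr fun y => congrArg₂ (· * ·) (tagGrad_comp_addEquiv S z c f y η)
    (tagGrad_comp_addEquiv S z c f y η)

/-- The relabelling of the sites that maps a configuration to the environment seen from the tagged
particle after its jump from the origin to `z`. -/
def jumpPerm (z : Lattice) : Equiv.Perm Lattice := (Equiv.addRight z).trans (Equiv.swap 0 z)

lemma comp_jumpPerm (z : Lattice) (η : Config) :
    η ∘ jumpPerm z = fun y => exch 0 z η (y + z) := rfl

lemma exch_neg_comp_jumpPerm (z : Lattice) (η : Config) :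
    exch 0 (-z) (η ∘ jumpPerm z) = fun y => η (y + z) := by
  funext y
  have hswap : Equiv.swap 0 (-z) y + z = Equiv.swap z 0 (y + z) := by
    simpa using (add_left_injective z).map_swap 0 (-z) y
  simp only [exch, Function.comp_apply, jumpPerm, Equiv.trans_apply, Equiv.coe_addRight, hswap,
    Equiv.swap_comm z 0, Equiv.swap_apply_self]

lemma shift_comp_jumpPerm (z y : Lattice) (f : Config → ℝ) (η : Config) :
    shift y f (η ∘ jumpPerm z) = shift (y + z) f (exch 0 z η) := by
  simp only [shift, comp_jumpPerm, add_assoc]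

lemma shift_exch_neg_comp_jumpPerm (z y : Lattice) (f : Config → ℝ) (η : Config) :
    shift y f (exch 0 (-z) (η ∘ jumpPerm z)) = shift (y + z) f η := by
  simp only [shift, exch_neg_comp_jumpPerm, add_assoc]

lemma tagGrad_neg_comp_jumpPerm (z : Lattice) (c : ℝ) (f : Config → ℝ) (y : Lattice)
    (η : Config) :
    tagGrad (-z) c f y (η ∘ jumpPerm z) = -tagGrad z (-c) f (jumpPerm z y) η := by
  have hz : occTot (-z) (η ∘ jumpPerm z) = occTot z η := by simp [occTot_eq, jumpPerm]
  have h0 : occTot 0 (η ∘ jumpPerm z) = occTot 0 η := by simp [occTot_eq, jumpPerm]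
  have hshift := shift_comp_jumpPerm z 0 f η
  rw [shift_zero, zero_add] at hshift
  rcases eq_or_ne y 0 with rfl | hy
  · have hjump : jumpPerm z 0 = 0 := by simp [jumpPerm]
    rw [hjump, tagGrad_zero, tagGrad_zero, shift_exch_neg_comp_jumpPerm, neg_add_cancel,
      shift_zero, hshift, hz]
    ring
  rcases eq_or_ne y (-z) with rfl | hyz
  · have hjump : jumpPerm z (-z) = z := by simp [jumpPerm]
    rw [hjump, tagGrad_self hy, tagGrad_self (neg_ne_zero.1 hy), neg_zero]
  · have hyz' : y + z ≠ 0 := fun h => hyz (eq_neg_of_add_eq_zero_left h)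
    have hy' : y + z ≠ z := fun h => hy (add_eq_right.1 h)
    have hjump : jumpPerm z y = y + z := Equiv.swap_apply_of_ne_of_ne hyz' hy'
    rw [hjump, tagGrad_of_ne hy hyz, tagGrad_of_ne hyz' hy', dgrad, dgrad, ugrad, ugrad,
      shift_comp_jumpPerm, shift_exch_neg_comp_jumpPerm, hz, h0]
    ring

lemma tagDensity_neg_comp_jumpPerm (z : Lattice) (c : ℝ) (f : Config → ℝ) (η : Config) :
    tagDensity (-z) c f c f (η ∘ jumpPerm z) = tagDensity z (-c) f (-c) f η := by
  simp only [tagDensity, tagGrad_neg_comp_jumpPerm, neg_mul_neg]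
  exact finsum_comp_equiv (jumpPerm z)
    (f := fun y => tagGrad z (-c) f y η * tagGrad z (-c) f y η)

/-- The rotation by a right angle. -/
def rotation : Lattice ≃+ Lattice where
  toFun x := ![-x 1, x 0]
  invFun x := ![x 1, -x 0]
  left_inv x := by ext i; fin_cases i <;> simp
  right_inv x := by ext i; fin_cases i <;> simp
  map_add' x y := by ext i; fin_cases i <;> simp [add_comm]

lemma rotation_e_zero : rotation (e 0) = e 1 := by
  ext i; fin_cases i <;> simp [rotation, e]

lemma rotation_neg_e_one : rotation (-e 1) = e 0 := by
  ext i; fin_cases i <;> simp [rotation, e]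

section
variable (α : GCParam) {f : Config → ℝ}

lemma E_tagDensity_comp_addEquiv (S : Lattice ≃+ Lattice) (z : Lattice) (c : ℝ) (hf : IsBlind f) :
    α.E (tagDensity (S z) c (fun ξ => f (ξ ∘ S)) c (fun ξ => f (ξ ∘ S)))
      = α.E (tagDensity z c f c f) := by
  rw [← α.E_comp_perm (hf.tagDensity hf z c c).observable S.toEquiv]
  exact congrArg α.E (funext fun η => tagDensity_comp_addEquiv S z c f η)

/-- The law of the environment is invariant under the jump of the tagged particle. -/
lemma E_tagDensity_neg (z : Lattice) (c : ℝ) (hf : IsBlind f) :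
    α.E (tagDensity (-z) c f c f) = α.E (tagDensity z (-c) f (-c) f) := by
  rw [← α.E_comp_perm (hf.tagDensity hf (-z) c c).observable (jumpPerm z)]
  exact congrArg α.E (funext fun η => tagDensity_neg_comp_jumpPerm z c f η)

lemma tagForm_comp_rotation (c : Fin 2 → ℝ) (hf : IsBlind f) :
    tagForm α ![-c 1, c 0] (fun ξ => f (ξ ∘ rotation)) ![-c 1, c 0] (fun ξ => f (ξ ∘ rotation))
      = tagForm α c f c f := by
  have h0 := E_tagDensity_comp_addEquiv α rotation (e 0) (c 0) hf
  have h1 := E_tagDensity_comp_addEquiv α rotation (-e 1) (-c 1) hf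
  rw [rotation_e_zero] at h0
  rw [rotation_neg_e_one, E_tagDensity_neg α _ _ hf, neg_neg] at h1
  rw [tagForm, tagForm, Fin.sum_univ_two, Fin.sum_univ_two, ← h0, ← h1, add_comm]
  rfl

/-! ### The self-diffusion coefficient -/

lemma selfDiffusionForm_eq_iInf_tagForm (x : Fin 2 → ℝ) :
    selfDiffusionForm α.total x = ⨅ f : blind, tagForm α x f.1 x f.1 := by
  refine iInf_congr fun f => Finset.sum_congr rfl fun i _ => ?_
  have hf := mem_blind_iff.1 f.2
  rw [← (hf.tagDensity hf (e i) (x i) (x i)).E_congr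
    (GCParam.total_ofDensity α.total_nonneg α.total_le_one)]
  exact congrArg _ (funext fun η => (tagDensity_self_eq hf.isLocal (e i) (x i) η).symm)

lemma ds_nonneg : 0 ≤ ds α.total := by
  rw [ds, selfDiffusionForm_eq_iInf_tagForm]
  exact Real.iInf_nonneg fun f => tagForm_self_nonneg α _ _

lemma ds_le_tagForm (hf : IsBlind f) :
    ds α.total ≤ tagForm α (Pi.single 0 1) f (Pi.single 0 1) f := by
  rw [ds, selfDiffusionForm_eq_iInf_tagForm]
  exact ciInf_le (f := fun f : blind => tagForm α (Pi.single 0 1) f.1 (Pi.single 0 1) f.1)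
    ⟨0, Set.forall_mem_range.2 fun f => tagForm_self_nonneg α _ _⟩ ⟨f, mem_blind_iff.2 hf⟩

lemma exists_tagForm_lt (i : Fin 2) {δ : ℝ} (hδ : 0 < δ) :
    ∃ f, IsBlind f ∧ tagForm α (Pi.single i 1) f (Pi.single i 1) f < ds α.total + δ := by
  have hzero : ∃ f, IsBlind f ∧
      tagForm α (Pi.single 0 1) f (Pi.single 0 1) f < ds α.total + δ := by
    rw [ds, selfDiffusionForm_eq_iInf_tagForm]
    have : Nonempty blind := ⟨⟨fun _ => 0, mem_blind_iff.2 (isBlind_const 0)⟩⟩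
    obtain ⟨f, hf⟩ := exists_lt_of_ciInf_lt (lt_add_of_pos_right
      (⨅ f : blind, tagForm α (Pi.single 0 1) f.1 (Pi.single 0 1) f.1) hδ)
    exact ⟨f.1, mem_blind_iff.1 f.2, hf⟩
  obtain ⟨f, hf, hlt⟩ := hzero
  fin_cases i
  · exact ⟨f, hf, hlt⟩
  · refine ⟨_, hf.comp_perm rotation.toEquiv, ?_⟩
    have hrot : ![-(Pi.single 0 1 : Fin 2 → ℝ) 1, (Pi.single 0 1 : Fin 2 → ℝ) 0]
        = Pi.single 1 1 := by
      ext i; fin_cases i <;> simp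
    rwa [← tagForm_comp_rotation α _ hf, hrot] at hlt

lemma ds_mul_sq_le_tagForm_single (i : Fin 2) (t : ℝ) (hf : IsBlind f) :
    ds α.total * t ^ 2 ≤ tagForm α (Pi.single i t) f (Pi.single i t) f := by
  have hzero : ∀ (t : ℝ) {f}, IsBlind f →
      ds α.total * t ^ 2 ≤ tagForm α (Pi.single 0 t) f (Pi.single 0 t) f := by
    intro t f hf
    rcases eq_or_ne t 0 with rfl | ht
    · simpa using tagForm_self_nonneg α (Pi.single 0 0) f
    · have hscale := tagForm_smul_self α t (Pi.single 0 1) (fun η => t⁻¹ * f η)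
      simp only [mul_inv_cancel_left₀ ht, ← Pi.single_smul, smul_eq_mul, mul_one] at hscale
      rw [hscale, mul_comm]
      exact mul_le_mul_of_nonneg_left (ds_le_tagForm α (hf.const_mul t⁻¹)) (sq_nonneg t)
  fin_cases i
  · exact hzero t hf
  · have hrot : ![-(Pi.single 1 t : Fin 2 → ℝ) 1, (Pi.single 1 t : Fin 2 → ℝ) 0]
        = Pi.single 0 (-t) := by
      ext i; fin_cases i <;> simp
    have h := hzero (-t) (hf.comp_perm rotation.toEquiv)
    rw [← hrot, neg_sq] at h
    exact h.trans_eq (tagForm_comp_rotation α _ hf)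

lemma ds_mul_le_tagForm (c : Fin 2 → ℝ) (hf : IsBlind f) :
    ds α.total * (c 0 ^ 2 + c 1 ^ 2) ≤ tagForm α c f c f := by
  set g : Config → ℝ := fun ξ => f (ξ ∘ rotation)
  set d : Fin 2 → ℝ := ![-c 1, c 0]
  set r : ℝ := c 0 ^ 2 + c 1 ^ 2 with hr
  have hg : IsBlind g := hf.comp_perm rotation.toEquiv
  have hrot : tagForm α d g d g = tagForm α c f c f := tagForm_comp_rotation α c hf
  -- Combining `c` with its image under the rotation gives multiples of the basis vectors.
  have hzero : c 0 • c + (-c 1) • d = Pi.single 0 r := by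
    ext i; fin_cases i <;> simp [d, hr] <;> ring
  have hone : c 1 • c + c 0 • d = Pi.single 1 r := by
    ext i; fin_cases i <;> simp [d, hr] <;> ring
  have h0 := ds_mul_sq_le_tagForm_single α 0 r ((hf.const_mul (c 0)).add (hg.const_mul (-c 1)))
  have h1 := ds_mul_sq_le_tagForm_single α 1 r ((hf.const_mul (c 1)).add (hg.const_mul (c 0)))
  rw [← hzero, tagForm_smul_add_smul α hf hg, hrot] at h0
  rw [← hone, tagForm_smul_add_smul α hf hg, hrot] at h1
  have hmul : ds α.total * r * r ≤ tagForm α c f c f * r := by linarith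
  rcases (show 0 ≤ r by positivity).eq_or_lt with hr0 | hr0
  · simpa [← hr0] using tagForm_self_nonneg α c f
  · exact le_of_mul_le_mul_right hmul hr0

end

/-! ### Freezing the state of the origin -/

/-- The function `f` with the state of the origin frozen to `s`. -/
def freeze (s : Site) (f : Config → ℝ) : Config → ℝ := fun η => f (Function.update η 0 s)

lemma freeze_update (s t : Site) (f : Config → ℝ) (η : Config) :
    freeze s f (Function.update η 0 t) = freeze s f η := by simp [freeze]

/-- A function of the environment of a tagged particle at the origin: it is blind, and it does not
depend on the state of the origin. -/
structure IsEnvironmental (f : Config → ℝ) : Prop extends IsBlind f where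
  update_zero : ∀ η s, f (Function.update η 0 s) = f η

lemma IsEnvironmental.freeze_eq {f : Config → ℝ} (hf : IsEnvironmental f) (s : Site) :
    freeze s f = f :=
  funext fun η => hf.update_zero η s

lemma isEnvironmental_const (c : ℝ) : IsEnvironmental fun _ => c :=
  ⟨isBlind_const c, fun _ _ => rfl⟩

lemma IsEnvironmental.add {f g : Config → ℝ} (hf : IsEnvironmental f) (hg : IsEnvironmental g) :
    IsEnvironmental fun η => f η + g η :=
  ⟨hf.toIsBlind.add hg.toIsBlind, fun η s => by rw [hf.update_zero, hg.update_zero]⟩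

lemma IsEnvironmental.const_mul {f : Config → ℝ} (hf : IsEnvironmental f) (t : ℝ) :
    IsEnvironmental fun η => t * f η :=
  ⟨hf.toIsBlind.const_mul t, fun η s => by rw [hf.update_zero]⟩

lemma IsBlind.isEnvironmental_freeze {f : Config → ℝ} (hf : IsBlind f) {s : Site}
    (hs : s.forget = s) : IsEnvironmental (freeze s f) :=
  ⟨hf.comp_update 0 hs, fun η t => freeze_update s t f η⟩

lemma shift_update (y : Lattice) (s : Site) (f : Config → ℝ) (η : Config) :
    shift y f (Function.update η y s) = shift y (freeze s f) η := by
  have h := Function.update_comp_eq_of_injective η (add_left_injective y) 0 s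
  rw [zero_add] at h
  exact congrArg f h

lemma exch_update (a b y : Lattice) (s : Site) (η : Config) :
    exch a b (Function.update η (Equiv.swap a b y) s) = Function.update (exch a b η) y s :=
  Function.update_comp_eq_of_injective η (Equiv.swap a b).injective y s

lemma tagGrad_update {z : Lattice} (hz : z ≠ 0) (c : ℝ) (s : Site) (f : Config → ℝ) (y : Lattice)
    (η : Config) :
    tagGrad z c f y (Function.update η y s) = tagGrad z c (freeze s f) y η := by
  rcases eq_or_ne y 0 with rfl | hy
  · have hexch := exch_update 0 z z s η
    rw [Equiv.swap_apply_right] at hexch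
    simp only [tagGrad_zero, hexch, shift_update, occTot_eq, Function.update_of_ne hz]
    rfl
  rcases eq_or_ne y z with rfl | hyz
  · rw [tagGrad_self hy, tagGrad_self hy]
  · have hexch := exch_update 0 z y s η
    rw [Equiv.swap_apply_of_ne_of_ne hy hyz] at hexch
    simp only [tagGrad_of_ne hy hyz, dgrad, ugrad, hexch, shift_update, occTot_eq,
      Function.update_of_ne hy.symm, Function.update_of_ne hyz.symm]

section
variable (α : GCParam) {f : Config → ℝ}

lemma E_tagDensity_eq_freeze (hf : IsBlind f) {z : Lattice} (hz : z ≠ 0) (c : ℝ) :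
    α.E (tagDensity z c f c f)
      = α.total * α.E (tagDensity z c (freeze refParticle f) c (freeze refParticle f))
        + (1 - α.total) * α.E (tagDensity z c (freeze .empty f) c (freeze .empty f)) := by
  obtain ⟨X, hX⟩ := hf.isLocal.exists_tagGrad_eq_zero z
  have hfreeze : ∀ s, ∀ y ∉ X, ∀ η, tagGrad z c (freeze s f) y η = 0 := fun s y hy η => by
    rw [← tagGrad_update hz, hX y hy]
  have hsum : ∀ {g}, IsBlind g → (∀ y ∉ X, ∀ η, tagGrad z c g y η = 0) →
      α.E (tagDensity z c g c g) = ∑ y ∈ X, α.E fun η => tagGrad z c g y η * tagGrad z c g y η :=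
    fun hg hgX => by
      rw [funext (tagDensity_eq_sum hgX c _), α.E_sum X fun y _ =>
        ((hg.tagGrad z c y).mul (hg.tagGrad z c y)).observable]
  rw [hsum hf fun y hy => hX y hy c,
    hsum (hf.isEnvironmental_freeze Site.forget_refParticle).toIsBlind (hfreeze _),
    hsum (hf.isEnvironmental_freeze Site.forget_empty).toIsBlind (hfreeze _), Finset.mul_sum,
    Finset.mul_sum, ← Finset.sum_add_distrib]
  refine Finset.sum_congr rfl fun y _ => ?_
  rw [((hf.tagGrad z c y).mul (hf.tagGrad z c y)).E_eq_total_mul_add α y]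
  simp only [tagGrad_update hz]

lemma tagForm_eq_freeze (hf : IsBlind f) (c : Fin 2 → ℝ) :
    tagForm α c f c f
      = α.total * tagForm α c (freeze refParticle f) c (freeze refParticle f)
        + (1 - α.total) * tagForm α c (freeze .empty f) c (freeze .empty f) := by
  simp only [tagForm, fun i => E_tagDensity_eq_freeze α hf (e_ne_zero i) (c i),
    Finset.sum_add_distrib, ← Finset.mul_sum]

lemma exists_freeze_tagForm_le (hf : IsBlind f) (c : Fin 2 → ℝ) :
    ∃ f', IsEnvironmental f' ∧ tagForm α c f' c f' ≤ tagForm α c f c f := by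
  have h0 := α.total_nonneg
  have h1 := α.total_le_one
  rw [tagForm_eq_freeze α hf c]
  rcases le_total (tagForm α c (freeze refParticle f) c (freeze refParticle f))
    (tagForm α c (freeze .empty f) c (freeze .empty f)) with hle | hle
  · exact ⟨_, hf.isEnvironmental_freeze Site.forget_refParticle, by nlinarith⟩
  · exact ⟨_, hf.isEnvironmental_freeze Site.forget_empty, by nlinarith⟩

end

/-! ### Averages over far translations -/

/-- The average of the translates of `f` by the points of `P`. -/
def shiftAvg (P : Finset Lattice) (f : Config → ℝ) : Config → ℝ := fun η =>
  (P.card : ℝ)⁻¹ * ∑ p ∈ P, shift p f η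

lemma IsBlind.shiftAvg {f : Config → ℝ} (hf : IsBlind f) (P : Finset Lattice) :
    IsBlind (shiftAvg P f) :=
  (IsBlind.sum P fun p _ => hf.shift p).const_mul _

lemma shift_shiftAvg (P : Finset Lattice) (f : Config → ℝ) (y : Lattice) (η : Config) :
    shift y (shiftAvg P f) η = (P.card : ℝ)⁻¹ * ∑ p ∈ P, shift (p + y) f η := by
  simp only [← shift_shift]
  rfl

lemma sum_sq_average_le {G : Type*} [AddGroup G] {d : G → ℝ} (hd : ∀ x, 0 ≤ d x) {B : ℝ}
    (hB : ∀ W : Finset G, ∑ x ∈ W, d x ≤ B) (P Z : Finset G) :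
    ∑ y ∈ Z, ((P.card : ℝ)⁻¹ * ∑ p ∈ P, d (p + y)) ^ 2 ≤ B ^ 2 / P.card := by
  set a : G → ℝ := fun y => (P.card : ℝ)⁻¹ * ∑ p ∈ P, d (p + y) with ha
  have hB0 : 0 ≤ B := by simpa using hB ∅
  have ha0 : ∀ y, 0 ≤ a y := fun y =>
    mul_nonneg (by positivity) (Finset.sum_nonneg fun p _ => hd _)
  have hsup : ∀ y, a y ≤ (P.card : ℝ)⁻¹ * B := fun y => by
    refine mul_le_mul_of_nonneg_left ?_ (by positivity)
    simpa using hB (P.map (addRightEmbedding y))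
  have hsum : ∑ y ∈ Z, a y ≤ B := by
    have hshift : ∀ p ∈ P, ∑ y ∈ Z, d (p + y) ≤ B := fun p _ => by
      simpa using hB (Z.map (addLeftEmbedding p))
    rw [ha, ← Finset.mul_sum, Finset.sum_comm]
    calc (P.card : ℝ)⁻¹ * ∑ p ∈ P, ∑ y ∈ Z, d (p + y)
        ≤ (P.card : ℝ)⁻¹ * (P.card * B) := by
          gcongr
          simpa using Finset.sum_le_card_nsmul P _ B hshift
      _ ≤ B := by
          rw [← mul_assoc]
          exact mul_le_of_le_one_left hB0 inv_mul_le_one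
  calc ∑ y ∈ Z, a y ^ 2
      ≤ ∑ y ∈ Z, (P.card : ℝ)⁻¹ * B * a y :=
        Finset.sum_le_sum fun y _ => by
          rw [sq]
          exact mul_le_mul_of_nonneg_right (hsup y) (ha0 y)
    _ = (P.card : ℝ)⁻¹ * B * ∑ y ∈ Z, a y := by rw [Finset.mul_sum]
    _ ≤ (P.card : ℝ)⁻¹ * B * B := by gcongr
    _ = B ^ 2 / P.card := by ring

lemma exists_sum_abs_ugrad_le {f : Config → ℝ} (hf : Observable f) (a b : Lattice) :
    ∃ B : ℝ, ∀ (η : Config) (W : Finset Lattice), ∑ x ∈ W, |ugrad a b (shift x f) η| ≤ B := by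
  classical
  obtain ⟨C, hC⟩ := hf.bounded
  obtain ⟨X, hX⟩ := hf.isLocal.exists_ugrad_shift_eq_zero a b
  have hterm : ∀ η x, |ugrad a b (shift x f) η| ≤ 2 * C := fun η x => by
    rw [two_mul]
    exact (abs_sub _ _).trans (add_le_add (hC _) (hC _))
  refine ⟨X.card * (2 * C), fun η W => ?_⟩
  calc ∑ x ∈ W, |ugrad a b (shift x f) η|
      = ∑ x ∈ W ∩ X, |ugrad a b (shift x f) η| :=
        (Finset.sum_subset Finset.inter_subset_left fun x hxW hx => by
          rw [hX x fun hxX => hx (Finset.mem_inter.2 ⟨hxW, hxX⟩), abs_zero]).symm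
    _ ≤ ∑ x ∈ X, |ugrad a b (shift x f) η| :=
        Finset.sum_le_sum_of_subset_of_nonneg Finset.inter_subset_right fun _ _ _ => abs_nonneg _
    _ ≤ X.card * (2 * C) := by
        simpa using Finset.sum_le_card_nsmul X _ (2 * C) fun x _ => hterm η x

lemma abs_tagGrad_shiftAvg_le (z : Lattice) (c : ℝ) (P : Finset Lattice) (f : Config → ℝ)
    {y : Lattice} (hy : y ≠ 0) (η : Config) :
    |tagGrad z c (shiftAvg P f) y η|
      ≤ (P.card : ℝ)⁻¹ * ∑ p ∈ P, |ugrad 0 z (shift (p + y) f) η| := by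
  rcases eq_or_ne y z with rfl | hyz
  · rw [tagGrad_self hy, abs_zero]
    positivity
  have hgrad : ugrad 0 z (shift y (shiftAvg P f)) η
      = (P.card : ℝ)⁻¹ * ∑ p ∈ P, ugrad 0 z (shift (p + y) f) η := by
    simp only [ugrad, shift_shiftAvg, Finset.sum_sub_distrib, mul_sub]
  have hweight : |occTot 0 η * (1 - occTot z η)| ≤ 1 := by
    have h0 := occTot_nonneg 0 η
    have hz := sub_nonneg.2 (occTot_le_one z η)
    rw [abs_of_nonneg (mul_nonneg h0 hz)]
    exact mul_le_one₀ (occTot_le_one 0 η) hz (sub_le_self 1 (occTot_nonneg z η))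
  rw [tagGrad_of_ne hy hyz, dgrad, abs_mul, hgrad, abs_mul (P.card : ℝ)⁻¹,
    abs_of_nonneg (a := (P.card : ℝ)⁻¹) (by positivity)]
  exact (mul_le_of_le_one_left (by positivity) hweight).trans
    (mul_le_mul_of_nonneg_left (Finset.abs_sum_le_sum_abs _ _) (by positivity))

/-- A square of side `n`, which is far from the origin when `M` is large. -/
def farSquare (M n : ℕ) : Finset Lattice :=
  (Finset.range n ×ˢ Finset.range n).image fun p => ![(M : ℤ) + p.1, p.2]

lemma farSquare_injective (M : ℕ) :
    Function.Injective fun p : ℕ × ℕ => (![(M : ℤ) + p.1, p.2] : Lattice) := fun p q h =>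
  Prod.ext (by simpa using congrFun h 0) (by simpa using congrFun h 1)

lemma card_farSquare (M n : ℕ) : (farSquare M n).card = n ^ 2 := by
  rw [farSquare, Finset.card_image_of_injective _ (farSquare_injective M), Finset.card_product,
    Finset.card_range, sq]

lemma sum_farSquare (M n : ℕ) (F : Lattice → ℝ) :
    ∑ p ∈ farSquare M n, F p
      = ∑ a ∈ Finset.range n, ∑ b ∈ Finset.range n, F ![(M : ℤ) + a, b] := by
  rw [farSquare, Finset.sum_image (farSquare_injective M).injOn, Finset.sum_product]

lemma le_of_mem_farSquare {M n : ℕ} {p : Lattice} (hp : p ∈ farSquare M n) : (M : ℤ) ≤ p 0 := by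
  obtain ⟨q, -, rfl⟩ := Finset.mem_image.1 hp
  simp

lemma abs_sum_farSquare_sub_le {F : Lattice → ℝ} {C : ℝ} (hF : ∀ x, |F x| ≤ C) (i : Fin 2)
    (M n : ℕ) : |∑ p ∈ farSquare M n, (F (p + e i) - F p)| ≤ n * (2 * C) := by
  have hline : ∀ G : ℕ → Lattice, |∑ a ∈ Finset.range n, (F (G (a + 1)) - F (G a))| ≤ 2 * C :=
    fun G => by
      rw [Finset.sum_range_sub (fun a => F (G a)) n, two_mul]
      exact (abs_sub _ _).trans (add_le_add (hF _) (hF _))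
  have hlines : ∀ G : ℕ → ℕ → Lattice,
      |∑ b ∈ Finset.range n, ∑ a ∈ Finset.range n, (F (G b (a + 1)) - F (G b a))|
        ≤ n * (2 * C) := fun G => by
    refine (Finset.abs_sum_le_sum_abs _ _).trans ?_
    simpa using Finset.sum_le_card_nsmul (Finset.range n) _ (2 * C) fun b _ => hline (G b)
  rw [sum_farSquare]
  fin_cases i
  · rw [Finset.sum_comm]
    convert hlines fun b a => ![(M : ℤ) + a, b] using 7
    ext i; fin_cases i <;> simp [e, add_assoc]
  · convert hlines fun a b => ![(M : ℤ) + a, b] using 7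
    ext i; fin_cases i <;> simp [e]

lemma mem_box {l : ℕ} {x : Lattice} : x ∈ box l ↔ ∀ i, |x i| ≤ (l : ℤ) := by
  rw [box, Finset.mem_Icc, Pi.le_def, Pi.le_def, ← forall_and]
  simp only [abs_le]

lemma exists_box_superset (A : Finset Lattice) : ∃ s : ℕ, A ⊆ box s := by
  refine ⟨A.sup fun x => (x 0).natAbs + (x 1).natAbs, fun x hx => mem_box.2 fun i => ?_⟩
  have hle := Finset.le_sup (f := fun x : Lattice => (x 0).natAbs + (x 1).natAbs) hx
  have hi : (x i).natAbs ≤ (x 0).natAbs + (x 1).natAbs := by fin_cases i <;> simp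
  rw [Int.abs_eq_natAbs]
  exact_mod_cast hi.trans hle

lemma shift_eq_of_far {f : Config → ℝ} {s : ℕ} (hs : DependsOn f (box s : Set Lattice)) {r : ℤ}
    {y : Lattice} (hy : s + r ≤ y 0) {η ξ : Config} (h : ∀ x : Lattice, r ≤ x 0 → η x = ξ x) :
    shift y f η = shift y f ξ := by
  refine hs fun x hx => h _ ?_
  have hx0 := (abs_le.1 (mem_box.1 hx 0)).1
  simp only [Pi.add_apply]
  omega

lemma abs_tagGrad_farAvg_le {f : Config → ℝ} {s M : ℕ} (hs : DependsOn f (box s : Set Lattice))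
    (hM : s + 2 ≤ M) {C : ℝ} (hC : ∀ η, |f η| ≤ C) (i : Fin 2) (n : ℕ) (η : Config) :
    |tagGrad (e i) 0 (shiftAvg (farSquare M n) f) 0 η| ≤ 2 * C / n := by
  have hfar : ∀ p ∈ farSquare M n,
      shift (p + e i) f (exch 0 (e i) η) = shift (p + e i) f η := fun p hp => by
    have he : 0 ≤ e i 0 ∧ e i 0 ≤ 1 := by fin_cases i <;> simp [e]
    have hp0 := le_of_mem_farSquare hp
    refine shift_eq_of_far hs (r := 2) (by rw [Pi.add_apply]; omega) fun x hx => exch_of_ne ?_ ?_ η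
    · rintro rfl
      simp at hx
    · rintro rfl
      omega
  have hgrad : shift (e i) (shiftAvg (farSquare M n) f) (exch 0 (e i) η)
        - shiftAvg (farSquare M n) f η
      = ((n : ℝ) ^ 2)⁻¹ * ∑ p ∈ farSquare M n, (shift (p + e i) f η - shift p f η) := by
    rw [shift_shiftAvg, Finset.sum_congr rfl hfar, shiftAvg, card_farSquare,
      Finset.sum_sub_distrib, mul_sub, Nat.cast_pow]
  have hvac : |1 - occTot (e i) η| ≤ 1 := by
    rw [abs_of_nonneg (sub_nonneg.2 (occTot_le_one _ _))]
    exact sub_le_self 1 (occTot_nonneg _ _)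
  rw [tagGrad_zero, zero_add, hgrad, abs_mul, abs_mul,
    abs_of_nonneg (a := ((n : ℝ) ^ 2)⁻¹) (by positivity)]
  calc |1 - occTot (e i) η| * (((n : ℝ) ^ 2)⁻¹ * |_|)
      ≤ ((n : ℝ) ^ 2)⁻¹ * |_| := mul_le_of_le_one_left (by positivity) hvac
    _ ≤ ((n : ℝ) ^ 2)⁻¹ * (n * (2 * C)) :=
        mul_le_mul_of_nonneg_left (abs_sum_farSquare_sub_le (F := fun x => shift x f η)
          (fun x => hC _) i M n) (by positivity)
    _ = 2 * C / n := by
        rcases eq_or_ne (n : ℝ) 0 with hn | hn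
        · simp [hn]
        · field_simp

lemma exists_tagForm_farAvg_le (α : GCParam) {f : Config → ℝ} (hf : IsBlind f) {s M : ℕ}
    (hs : DependsOn f (box s : Set Lattice)) (hM : s + 2 ≤ M) :
    ∃ D : ℝ, ∀ n : ℕ, tagForm α 0 (shiftAvg (farSquare M n) f) 0 (shiftAvg (farSquare M n) f)
      ≤ D / (n : ℝ) ^ 2 := by
  obtain ⟨C, hC⟩ := hf.observable.bounded
  choose B hB using fun i => exists_sum_abs_ugrad_le hf.observable 0 (e i)
  refine ⟨∑ i, ((2 * C) ^ 2 + B i ^ 2), fun n => ?_⟩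
  set P := farSquare M n with hP
  have hblind := hf.shiftAvg P
  rw [tagForm, Finset.sum_div]
  refine Finset.sum_le_sum fun i _ => ?_
  rw [← α.E_const (((2 * C) ^ 2 + B i ^ 2) / (n : ℝ) ^ 2)]
  refine α.E_mono (hblind.tagDensity hblind _ _ _).observable (observable_const _) fun η => ?_
  obtain ⟨X, hX⟩ := hblind.isLocal.exists_tagGrad_eq_zero (e i)
  have hjump : tagGrad (e i) 0 (shiftAvg P f) 0 η ^ 2 ≤ (2 * C) ^ 2 / (n : ℝ) ^ 2 := by
    rw [← sq_abs, ← div_pow]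
    exact pow_le_pow_left₀ (abs_nonneg _) (abs_tagGrad_farAvg_le hs hM hC i n η) 2
  have henv : ∑ y ∈ X.erase 0, tagGrad (e i) 0 (shiftAvg P f) y η ^ 2 ≤ B i ^ 2 / (n : ℝ) ^ 2 := by
    refine (Finset.sum_le_sum fun y hy => ?_).trans ((sum_sq_average_le
      (fun x => abs_nonneg (ugrad 0 (e i) (shift x f) η)) (hB i η) P (X.erase 0)).trans_eq ?_)
    · rw [← sq_abs]
      exact pow_le_pow_left₀ (abs_nonneg _)
        (abs_tagGrad_shiftAvg_le _ _ _ _ (Finset.ne_of_mem_erase hy) η) 2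
    · rw [hP, card_farSquare, Nat.cast_pow]
  have hsum : tagDensity (e i) 0 (shiftAvg P f) 0 (shiftAvg P f) η
      ≤ tagGrad (e i) 0 (shiftAvg P f) 0 η ^ 2
        + ∑ y ∈ X.erase 0, tagGrad (e i) 0 (shiftAvg P f) y η ^ 2 := by
    rw [tagDensity_eq_sum fun y hy => hX y hy 0]
    simp only [← sq]
    by_cases h0 : (0 : Lattice) ∈ X
    · exact (Finset.add_sum_erase X _ h0).ge
    · rw [Finset.erase_eq_of_notMem h0]
      exact le_add_of_nonneg_left (sq_nonneg _)
  calc tagDensity (e i) 0 (shiftAvg P f) 0 (shiftAvg P f) η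
      ≤ (2 * C) ^ 2 / (n : ℝ) ^ 2 + B i ^ 2 / (n : ℝ) ^ 2 := hsum.trans (add_le_add hjump henv)
    _ = ((2 * C) ^ 2 + B i ^ 2) / (n : ℝ) ^ 2 := (add_div _ _ _).symm

/-! ### Canonical expectations -/

lemma canonicalExp_sub (l : ℕ) (ξ : Config) (ψ φ : Config → ℝ) :
    canonicalExp l ξ (fun η => ψ η - φ η) = canonicalExp l ξ ψ - canonicalExp l ξ φ := by
  simp only [canonicalExp, Finset.sum_sub_distrib, sub_div]

lemma canonicalExp_const_mul (l : ℕ) (ξ : Config) (c : ℝ) (ψ : Config → ℝ) :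
    canonicalExp l ξ (fun η => c * ψ η) = c * canonicalExp l ξ ψ := by
  simp only [canonicalExp, ← Finset.mul_sum, mul_div_assoc]

lemma canonicalExp_sum {ι : Type*} (l : ℕ) (ξ : Config) (s : Finset ι) (ψ : ι → Config → ℝ) :
    canonicalExp l ξ (fun η => ∑ k ∈ s, ψ k η) = ∑ k ∈ s, canonicalExp l ξ (ψ k) := by
  simp only [canonicalExp, ← Finset.sum_div]
  rw [Finset.sum_comm]

lemma canonicalExp_comp {l : ℕ} (ξ : Config) (ψ : Config → ℝ) {ρ : Equiv.Perm Lattice}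
    (hρ : ∀ x, ρ x ≠ x → x ∈ box l) :
    canonicalExp l ξ (fun η => ψ (η ∘ ρ)) = canonicalExp l ξ ψ := by
  have hmem : ∀ x, ρ x ∈ box l ↔ x ∈ box l := fun x => by
    by_cases h : ρ x = x
    · rw [h]
    · exact iff_of_true (hρ _ fun h' => h (ρ.injective h')) (hρ x h)
  have hsubtype : Equiv.Perm.ofSubtype (ρ.subtypePerm hmem) = ρ :=
    Equiv.Perm.ofSubtype_subtypePerm hmem hρ
  have hsum : ∑ π : Equiv.Perm (box l), ψ ((ξ ∘ Equiv.Perm.ofSubtype π) ∘ ρ)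
      = ∑ π : Equiv.Perm (box l), ψ (ξ ∘ Equiv.Perm.ofSubtype π) := by
    refine Fintype.sum_equiv (Equiv.mulRight (ρ.subtypePerm hmem)) _ _ fun π => ?_
    rw [Equiv.coe_mulRight, map_mul, hsubtype, Equiv.Perm.coe_mul, Function.comp_assoc]
  rw [canonicalExp, canonicalExp, hsum]

lemma canonicalExp_eq_zero_of_exch {l : ℕ} (ξ : Config) {ψ : Config → ℝ} {a b : Lattice}
    (ha : a ∈ box l) (hb : b ∈ box l) (h : ∀ η, ψ (exch a b η) = -ψ η) :
    canonicalExp l ξ ψ = 0 := by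
  have hswap : canonicalExp l ξ (fun η => ψ (exch a b η)) = canonicalExp l ξ ψ :=
    canonicalExp_comp ξ ψ fun x hx => by
      by_contra hxl
      exact hx (Equiv.swap_apply_of_ne_of_ne (fun h => hxl (h ▸ ha)) fun h => hxl (h ▸ hb))
  have hneg : (fun η => ψ (exch a b η)) = fun η => -1 * ψ η :=
    funext fun η => (h η).trans (neg_one_mul _).symm
  rw [hneg, canonicalExp_const_mul] at hswap
  linarith

open Classical in
/-- The involution that exchanges `A` with its translate `A + y`. -/
def translSwap (A : Finset Lattice) (y : Lattice) (h : ∀ x ∈ A, x + y ∉ A) :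
    Equiv.Perm Lattice :=
  Function.Involutive.toPerm (fun x => if x ∈ A then x + y else if x - y ∈ A then x - y else x) (by
    intro x
    by_cases hx : x ∈ A
    · simp [hx, h x hx]
    · by_cases hxy : x - y ∈ A
      · simp [hx, hxy]
      · simp [hx, hxy])

lemma translSwap_of_mem {A : Finset Lattice} {y : Lattice} (h : ∀ x ∈ A, x + y ∉ A) {x : Lattice}
    (hx : x ∈ A) : translSwap A y h x = x + y := by
  simp [translSwap, Function.Involutive.toPerm, hx]

lemma translSwap_of_notMem {A : Finset Lattice} {y : Lattice} (h : ∀ x ∈ A, x + y ∉ A)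
    {x : Lattice} (hx : x ∉ A) (hxy : x - y ∉ A) : translSwap A y h x = x := by
  simp [translSwap, Function.Involutive.toPerm, hx, hxy]

lemma canonicalExp_site_mul_shift {A : Finset Lattice} {y : Lattice} (h : ∀ x ∈ A, x + y ∉ A)
    (h0 : (0 : Lattice) ∉ A) (hy : -y ∉ A) {l : ℕ} (hl : ∀ x ∈ A, x ∈ box l)
    (hly : ∀ x ∈ A, x + y ∈ box l) (ξ : Config) (v : Site → ℝ) {f : Config → ℝ}
    (hf : DependsOn f (A : Set Lattice)) :
    canonicalExp l ξ (fun η => v (η 0) * shift y f η)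
      = canonicalExp l ξ (fun η => v (η 0) * f η) := by
  rw [← canonicalExp_comp (ρ := translSwap A y h) ξ (fun η => v (η 0) * f η)]
  · congr 1
    funext η
    have hfix : translSwap A y h 0 = 0 := translSwap_of_notMem h h0 (by simpa using hy)
    have hshift : f (η ∘ translSwap A y h) = shift y f η := hf fun x hx => by
      rw [Function.comp_apply, translSwap_of_mem h hx]
    rw [hshift, Function.comp_apply, hfix]
  · intro x hx
    by_cases hxA : x ∈ A
    · exact hl x hxA
    · by_cases hxy : x - y ∈ A
      · simpa using hly _ hxy
      · exact absurd (translSwap_of_notMem h hxA hxy) hx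

lemma canonicalExp_site_mul_shift_of_far {f : Config → ℝ} {s r l : ℕ} {p : Lattice}
    (hf0 : ∀ η t, f (Function.update η 0 t) = f η) (hs : DependsOn f (box s : Set Lattice))
    (hp : 2 * s + 1 ≤ p 0) (hr : p ∈ box r) (hl : s + r ≤ l) (ξ : Config) (v : Site → ℝ) :
    canonicalExp l ξ (fun η => v (η 0) * shift p f η)
      = canonicalExp l ξ (fun η => v (η 0) * f η) := by
  have hpunctured : DependsOn f (((box s).erase 0 : Finset Lattice) : Set Lattice) := by
    intro η ξ h
    rw [← hf0 η Site.empty, ← hf0 ξ Site.empty]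
    refine dependsOn_comp_update (hs.mono fun x hx => ?_) Site.empty h
    rw [Finset.coe_erase, Set.insert_sdiff_singleton]
    exact Set.mem_insert_of_mem 0 hx
  have habs : ∀ x ∈ (box s).erase 0, ∀ i, |x i| ≤ (s : ℤ) := fun x hx =>
    mem_box.1 (Finset.mem_of_mem_erase hx)
  refine canonicalExp_site_mul_shift (fun x hx hxp => ?_) (Finset.notMem_erase _ _) (fun hx => ?_)
    (fun x hx => mem_box.2 fun i => ?_) (fun x hx => mem_box.2 fun i => ?_) ξ v hpunctured
  · have hx0 := abs_le.1 (habs x hx 0)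
    have hxp0 := abs_le.1 (habs _ hxp 0)
    rw [Pi.add_apply] at hxp0
    omega
  · have hx0 := abs_le.1 (habs _ hx 0)
    rw [Pi.neg_apply] at hx0
    omega
  · have hxi := habs x hx i
    omega
  · have hxi := habs x hx i
    have hpi := mem_box.1 hr i
    have hsum := abs_add_le (x i) (p i)
    rw [Pi.add_apply]
    omega

/-! ### The class `T_0^ω` -/

/-- The site functions `∑_σ (c^σ + d^σ ω(θ)) η^σ`, which span the one-site part of `T^ω`. -/
def affineSite (ω : Angle → ℝ) (c d : Species → ℝ) (s : Site) : ℝ :=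
  ∑ σ, (c σ + d σ * ω s.angle) * s.num σ

section
variable {ω : Angle → ℝ}

lemma IsC2.continuous (hω : IsC2 ω) : Continuous ω :=
  (QuotientAddGroup.isQuotientMap_mk (N := AddSubgroup.zmultiples (2 * Real.pi))).continuous_iff.2
    (ContDiff.continuous hω)

lemma IsC2.exists_abs_le (hω : IsC2 ω) : ∃ C, ∀ θ, |ω θ| ≤ C := by
  have : Fact (0 < 2 * Real.pi) := ⟨Real.two_pi_pos⟩
  obtain ⟨C, hC⟩ := (isCompact_range hω.continuous).isBounded.exists_norm_le
  exact ⟨C, fun θ => hC _ (Set.mem_range_self θ)⟩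

lemma IsC2.siteObservable (hω : IsC2 ω) (σ : Species) :
    SiteObservable fun s => ω s.angle * s.num σ := by
  obtain ⟨C, hC⟩ := hω.exists_abs_le
  obtain ⟨D, hD⟩ := (siteObservable_num σ).bounded
  refine ⟨Site.measurable_iff.2 fun τ => ?_, ⟨C * D, fun s => ?_⟩, by simp [Site.num]⟩
  · exact hω.continuous.measurable.mul measurable_const
  · rw [abs_mul]
    exact mul_le_mul (hC _) (hD s) (abs_nonneg _) ((abs_nonneg _).trans (hC s.angle))

lemma IsC2.siteObservable_affine (hω : IsC2 ω) (a b : ℝ) (σ : Species) :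
    SiteObservable fun s => (a + b * ω s.angle) * s.num σ := by
  simpa only [add_mul, mul_assoc] using
    ((siteObservable_num σ).const_mul a).add ((hω.siteObservable σ).const_mul b)

lemma siteObservable_affineSite (hω : IsC2 ω) (c d : Species → ℝ) :
    SiteObservable (affineSite ω c d) := by
  have h : affineSite ω c d = fun s => (c .active + d .active * ω s.angle) * s.num .active
      + (c .passive + d .passive * ω s.angle) * s.num .passive := funext fun s => sum_species _
  rw [h]
  exact (hω.siteObservable_affine _ _ _).add (hω.siteObservable_affine _ _ _)

lemma forgetAll_setAngles (A : Finset Lattice) (η : Config) (t : A → ℝ) :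
    forgetAll (setAngles A η t) = forgetAll η := by
  funext x
  by_cases hx : x ∈ A
  · cases h : η x <;> simp [forgetAll, setAngles, hx, h, Site.setAngle, Site.forget]
  · simp [forgetAll, setAngles, hx]

lemma contDiff_affineSite_setAngles (hω : IsC2 ω) (c d : Species → ℝ) (A : Finset Lattice)
    (η : Config) (x : Lattice) :
    ContDiff ℝ 2 fun t : A → ℝ => affineSite ω c d (setAngles A η t x) := by
  by_cases hx : x ∈ A
  · cases h : η x with
    | empty =>
      simp only [setAngles, hx, dif_pos, h, Site.setAngle]
      exact contDiff_const
    | particle τ θ =>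
      simp only [setAngles, hx, dif_pos, h, Site.setAngle, affineSite, Site.num, Site.angle]
      have hangle : ContDiff ℝ 2 fun t : A → ℝ => ω ((t ⟨x, hx⟩ : ℝ) : Angle) :=
        ContDiff.comp (g := fun t : ℝ => ω (t : Angle)) hω (contDiff_apply ℝ ℝ _)
      exact ContDiff.sum fun σ _ =>
        (contDiff_const.add (contDiff_const.mul hangle)).mul contDiff_const
  · simp only [setAngles, hx, dif_neg, not_false_iff]
    exact contDiff_const

lemma affineSite_mul_mem_cylinder (hω : IsC2 ω) (c d : Species → ℝ) (x : Lattice)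
    {F : Config → ℝ} (hF : IsBlind F) : (fun η => affineSite ω c d (η x) * F η) ∈ cylinder := by
  refine ⟨(isLocal_site _ x).map₂ hF.isLocal (· * ·), fun A η => ?_⟩
  have hconst : ∀ t, F (setAngles A η t) = F η := fun t => by
    rw [← hF.forget, forgetAll_setAngles, hF.forget]
  simp only [hconst]
  exact (contDiff_affineSite_setAngles hω c d A η x).mul contDiff_const

lemma affineSite_mul_mem_classT (hω : IsC2 ω) (c d : Species → ℝ) (x : Lattice)
    {F : Config → ℝ} (hF : IsBlind F) : (fun η => affineSite ω c d (η x) * F η) ∈ classT ω := by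
  refine Submodule.subset_span ⟨affineSite_mul_mem_cylinder hω c d x hF, c .active, c .passive,
    d .active, d .passive, {x}, fun _ => F, fun _ => mem_blind_iff.2 hF, ?_⟩
  funext η
  simp only [affineSite, sum_species, Finset.sum_singleton, occ, occAng]
  ring

lemma classT_le_cylinder : classT ω ≤ cylinder := Submodule.span_le.2 fun _ hf => hf.1

lemma mem_classT0_of_canonicalExp_eq_zero {ψ : Config → ℝ} (hψ : ψ ∈ classT ω) {s : ℕ}
    (h : ∀ l, s ≤ l → ∀ ξ : Config, canonicalExp l ξ ψ = 0) : ψ ∈ classT0 ω := by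
  have hcyl := classT_le_cylinder hψ
  obtain ⟨A, hA⟩ := hcyl.1
  obtain ⟨r, hr⟩ := exists_box_superset A
  refine ⟨⟨hcyl, max s r, hA.mono fun x hx => mem_box.2 fun i => ?_,
    fun l hl ξ _ => h l (le_of_max_le_left hl) ξ⟩, hψ⟩
  exact (mem_box.1 (hr hx) i).trans (by exact_mod_cast le_max_right s r)

lemma mem_classT0_of_exch_eq_neg {ψ : Config → ℝ} (hψ : ψ ∈ classT ω) (a b : Lattice)
    (h : ∀ η, ψ (exch a b η) = -ψ η) : ψ ∈ classT0 ω := by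
  obtain ⟨s, hs⟩ := exists_box_superset {a, b}
  have hmono : ∀ {l x}, s ≤ l → x ∈ ({a, b} : Finset Lattice) → x ∈ box l := fun hl hx =>
    mem_box.2 fun i => (mem_box.1 (hs hx) i).trans (by exact_mod_cast hl)
  exact mem_classT0_of_canonicalExp_eq_zero hψ fun l hl ξ =>
    canonicalExp_eq_zero_of_exch ξ (hmono hl (by simp)) (hmono hl (by simp)) h

lemma siteCurrent_mem_classT0 (hω : IsC2 ω) (c d : Species → ℝ) (i : Fin 2) :
    siteCurrent (affineSite ω c d) i ∈ classT0 ω := by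
  refine mem_classT0_of_exch_eq_neg (Submodule.sub_mem _
    (affineSite_mul_mem_classT hω c d 0 (isBlind_vacancy (e i)))
    (affineSite_mul_mem_classT hω c d (e i) (isBlind_vacancy 0))) 0 (e i) fun η => ?_
  simp only [siteCurrent, occTot_eq, exch_left, exch_right]
  ring

lemma siteGrad_mem_classT0 (hω : IsC2 ω) (c d : Species → ℝ) (i : Fin 2) :
    siteGrad (affineSite ω c d) i ∈ classT0 ω := by
  have hsite : ∀ x, (fun η : Config => affineSite ω c d (η x)) ∈ classT ω := fun x => by
    simpa only [mul_one] using affineSite_mul_mem_classT hω c d x (isBlind_const 1)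
  refine mem_classT0_of_exch_eq_neg (Submodule.sub_mem _ (hsite (e i)) (hsite 0)) 0 (e i)
    fun η => ?_
  simp only [siteGrad, exch_left, exch_right]
  ring

lemma affineSite_mul_sub_shiftAvg_mem_classT0 (hω : IsC2 ω) (c d : Species → ℝ)
    {f : Config → ℝ} (hf : IsEnvironmental f) {s : ℕ}
    (hs : DependsOn f (box s : Set Lattice)) {P : Finset Lattice} (hP : P.Nonempty)
    (hfar : ∀ p ∈ P, 2 * (s : ℤ) + 1 ≤ p 0) :
    (fun η => affineSite ω c d (η 0) * (f η - shiftAvg P f η)) ∈ classT0 ω := by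
  obtain ⟨r, hr⟩ := exists_box_superset P
  refine mem_classT0_of_canonicalExp_eq_zero (s := s + r)
    (affineSite_mul_mem_classT hω c d 0 (hf.toIsBlind.sub (hf.toIsBlind.shiftAvg P)))
    fun l hl ξ => ?_
  have hexpand : (fun η => affineSite ω c d (η 0) * (f η - shiftAvg P f η))
      = fun η => affineSite ω c d (η 0) * f η
        - (P.card : ℝ)⁻¹ * ∑ p ∈ P, affineSite ω c d (η 0) * shift p f η := by
    funext η
    rw [← Finset.mul_sum, shiftAvg]
    ring
  have hcard : (P.card : ℝ) ≠ 0 := by exact_mod_cast hP.card_ne_zero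
  rw [hexpand, canonicalExp_sub, canonicalExp_const_mul, canonicalExp_sum,
    Finset.sum_congr rfl fun p hp => canonicalExp_site_mul_shift_of_far hf.update_zero hs
      (hfar p hp) (hr hp) hl ξ (affineSite ω c d),
    Finset.sum_const, nsmul_eq_mul, inv_mul_cancel_left₀ hcard, sub_self]

lemma shiftAvg_update_zero {f : Config → ℝ} {s : ℕ} (hs : DependsOn f (box s : Set Lattice))
    {P : Finset Lattice} (hfar : ∀ p ∈ P, (s : ℤ) + 1 ≤ p 0) (η : Config) (t : Site) :
    shiftAvg P f (Function.update η 0 t) = shiftAvg P f η :=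
  congrArg (_ * ·) <| Finset.sum_congr rfl fun p hp =>
    shift_eq_of_far hs (hfar p hp) fun x hx => Function.update_of_ne (by rintro rfl; simp at hx) _ _

lemma exists_tagForm_sub_farAvg_le (α : GCParam) {f : Config → ℝ} (hf : IsBlind f) {s M : ℕ}
    (hs : DependsOn f (box s : Set Lattice)) (hM : s + 2 ≤ M) (c : Fin 2 → ℝ) {δ : ℝ}
    (hδ : 0 < δ) :
    ∃ n : ℕ, 0 < n ∧ tagForm α c (fun η => f η - shiftAvg (farSquare M n) f η) c
      (fun η => f η - shiftAvg (farSquare M n) f η) ≤ tagForm α c f c f + δ := by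
  obtain ⟨D, hD⟩ := exists_tagForm_farAvg_le α hf hs hM
  set T := tagForm α c f c f
  have hlim : Tendsto (fun n : ℕ => 2 * √(T * (D / (n : ℝ) ^ 2)) + D / (n : ℝ) ^ 2) atTop
      (𝓝 0) := by
    have hsmall : Tendsto (fun n : ℕ => D / (n : ℝ) ^ 2) atTop (𝓝 0) :=
      tendsto_const_nhds.div_atTop
        ((tendsto_pow_atTop two_ne_zero).comp tendsto_natCast_atTop_atTop)
    simpa using ((hsmall.const_mul T).sqrt.const_mul 2).add hsmall
  obtain ⟨n, hn, hpos⟩ :=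
    ((hlim.eventually_lt_const hδ).and (eventually_gt_atTop 0)).exists
  refine ⟨n, hpos, ?_⟩
  have hA := hf.shiftAvg (farSquare M n)
  have hcross : |tagForm α c f 0 (shiftAvg (farSquare M n) f)| ≤ √(T * (D / (n : ℝ) ^ 2)) :=
    Real.abs_le_sqrt ((tagForm_sq_le α hf hA c 0).trans
      (mul_le_mul_of_nonneg_left (hD n) (tagForm_self_nonneg α c f)))
  have hexpand := tagForm_smul_add_smul α hf hA c 0 1 (-1)
  simp only [one_smul, smul_zero, add_zero, one_mul, neg_one_mul, ← sub_eq_add_neg] at hexpand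
  rw [hexpand]
  linarith [(abs_le.1 hcross).1, hD n]

/-- Subtracting a far average costs little energy and gives `v(η_0) f` mean zero under the canonical
measures, so that near-minimizers of the tagged particle form yield elements of `T_0^ω`. -/
lemma exists_nearMinimizer (α : GCParam) (hω : IsC2 ω) (c d : Species → ℝ) (i : Fin 2) {δ : ℝ}
    (hδ : 0 < δ) :
    ∃ f, IsEnvironmental f ∧
      (fun η => affineSite ω c d (η 0) * f η) ∈ classT0 ω ∧
      tagForm α (Pi.single i 1) f (Pi.single i 1) f ≤ ds α.total + δ := by
  obtain ⟨f₀, hf₀, hlt⟩ := exists_tagForm_lt α i (half_pos hδ)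
  obtain ⟨f, hf, hle⟩ := exists_freeze_tagForm_le α hf₀ (Pi.single i 1)
  obtain ⟨A, hA⟩ := hf.isLocal
  obtain ⟨s, hs⟩ := exists_box_superset A
  have hbox : DependsOn f (box s : Set Lattice) := hA.mono hs
  obtain ⟨n, hn, hnle⟩ := exists_tagForm_sub_farAvg_le α hf.toIsBlind (M := 2 * s + 2) hbox
    (by omega) (Pi.single i 1) (half_pos hδ)
  have hfar : ∀ p ∈ farSquare (2 * s + 2) n, 2 * (s : ℤ) + 1 ≤ p 0 := fun p hp => by
    have := le_of_mem_farSquare hp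
    omega
  have hne : (farSquare (2 * s + 2) n).Nonempty :=
    Finset.card_pos.1 (by rw [card_farSquare]; positivity)
  refine ⟨_, ⟨hf.toIsBlind.sub (hf.toIsBlind.shiftAvg _), fun η t => ?_⟩,
    affineSite_mul_sub_shiftAvg_mem_classT0 hω c d hf hbox hne hfar, by linarith⟩
  rw [hf.update_zero, shiftAvg_update_zero hbox fun p hp => ?_]
  have := hfar p hp
  omega

end

/-! ### The energy form -/

/-- The gradient of the formal sum `∑_x (x_i v(η_x) + τ_x h)` along the edge from `0` to `e i`, on
the event that a particle can jump along this edge. -/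
def edgeGrad (i : Fin 2) (v : Site → ℝ) (h : Config → ℝ) : Config → ℝ := fun η =>
  occTot 0 η * (1 - occTot (e i) η) * (v (η 0) + sumGrad i h η)

lemma Observable.edgeGrad {v : Site → ℝ} (hv : SiteObservable v) {h : Config → ℝ}
    (hh : Observable h) (i : Fin 2) : Observable (edgeGrad i v h) :=
  ((observable_occTot 0).mul (observable_vacancy (e i))).mul ((hv.observable 0).add (hh.sumGrad i))

lemma edgeGrad_add (i : Fin 2) (v w : Site → ℝ) {h k : Config → ℝ} (hh : IsLocal h)
    (hk : IsLocal k) (η : Config) :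
    edgeGrad i (v + w) (fun η => h η + k η) η = edgeGrad i v h η + edgeGrad i w k η := by
  simp only [edgeGrad, sumGrad_add hh hk, Pi.add_apply]
  ring

lemma edgeGrad_smul (i : Fin 2) (t : ℝ) (v : Site → ℝ) (h : Config → ℝ) (η : Config) :
    edgeGrad i (t • v) (fun η => t * h η) η = t * edgeGrad i v h η := by
  simp only [edgeGrad, sumGrad_const_mul, Pi.smul_apply, smul_eq_mul]
  ring

lemma edgeGrad_shift (i : Fin 2) (v : Site → ℝ) (x : Lattice) (h : Config → ℝ) :
    edgeGrad i v (shift x h) = edgeGrad i v h := by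
  unfold edgeGrad
  rw [sumGrad_shift]

/-- The bilinear form whose quadratic form is the energy `⟪j + 𝓛 g⟫`, where the functions `Ψ i` of
one site are the sums over the types of the angular functions of `j`. -/
def energyForm (α : GCParam) (Ψ : Fin 2 → Site → ℝ) (g : Config → ℝ) (Ψ' : Fin 2 → Site → ℝ)
    (h : Config → ℝ) : ℝ :=
  ∑ i, α.E fun η => edgeGrad i (Ψ i) g η * edgeGrad i (Ψ' i) h η

section
variable (α : GCParam) {Ψ Ψ' : Fin 2 → Site → ℝ} {g h k : Config → ℝ}

lemma energyForm_comm (Ψ : Fin 2 → Site → ℝ) (g : Config → ℝ) (Ψ' : Fin 2 → Site → ℝ)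
    (h : Config → ℝ) : energyForm α Ψ g Ψ' h = energyForm α Ψ' h Ψ g := by
  simp only [energyForm, mul_comm (edgeGrad _ (Ψ _) g _)]

lemma energyForm_add_right {Ψ'' : Fin 2 → Site → ℝ} (hΨ : ∀ i, SiteObservable (Ψ i))
    (hΨ' : ∀ i, SiteObservable (Ψ' i)) (hΨ'' : ∀ i, SiteObservable (Ψ'' i)) (hg : Observable g)
    (hh : Observable h) (hk : Observable k) :
    energyForm α Ψ g (Ψ' + Ψ'') (fun η => h η + k η)
      = energyForm α Ψ g Ψ' h + energyForm α Ψ g Ψ'' k := by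
  simp only [energyForm, ← Finset.sum_add_distrib]
  refine Finset.sum_congr rfl fun i _ => ?_
  have hgi := hg.edgeGrad (hΨ i) i
  rw [← α.E_add (hgi.mul (hh.edgeGrad (hΨ' i) i)) (hgi.mul (hk.edgeGrad (hΨ'' i) i))]
  congr 1
  funext η
  rw [Pi.add_apply, edgeGrad_add i _ _ hh.isLocal hk.isLocal, mul_add]

lemma energyForm_smul_right (t : ℝ) (Ψ : Fin 2 → Site → ℝ) (g : Config → ℝ)
    (Ψ' : Fin 2 → Site → ℝ) (h : Config → ℝ) :
    energyForm α Ψ g (t • Ψ') (fun η => t * h η) = t * energyForm α Ψ g Ψ' h := by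
  simp only [energyForm, Pi.smul_apply, edgeGrad_smul, mul_left_comm _ t, α.E_const_mul,
    Finset.mul_sum]

lemma energyForm_self_nonneg (Ψ : Fin 2 → Site → ℝ) (h : Config → ℝ) :
    0 ≤ energyForm α Ψ h Ψ h :=
  Finset.sum_nonneg fun _ _ => α.E_nonneg fun _ => mul_self_nonneg _

lemma energyForm_sq_le (hΨ : ∀ i, SiteObservable (Ψ i)) (hΨ' : ∀ i, SiteObservable (Ψ' i))
    (hg : Observable g) (hh : Observable h) :
    energyForm α Ψ g Ψ' h ^ 2 ≤ energyForm α Ψ g Ψ g * energyForm α Ψ' h Ψ' h := by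
  refine sq_le_mul_of_forall_nonneg fun t => ?_
  have htΨ' : ∀ i, SiteObservable ((t • Ψ') i) := fun i => (hΨ' i).const_mul t
  have hsum : ∀ i, SiteObservable ((Ψ + t • Ψ') i) := fun i => (hΨ i).add (htΨ' i)
  have hth := hh.const_mul t
  have hexpand : energyForm α (Ψ + t • Ψ') (fun η => g η + t * h η) (Ψ + t • Ψ')
      (fun η => g η + t * h η) = energyForm α Ψ g Ψ g + 2 * t * energyForm α Ψ g Ψ' h
        + t ^ 2 * energyForm α Ψ' h Ψ' h := by
    rw [energyForm_add_right α hsum hΨ htΨ' (hg.add hth) hg hth, energyForm_smul_right,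
      energyForm_comm, energyForm_add_right α hΨ hΨ htΨ' hg hg hth, energyForm_smul_right,
      energyForm_comm α (Ψ + t • Ψ'), energyForm_add_right α hΨ' hΨ htΨ' hh hg hth,
      energyForm_smul_right, energyForm_comm α Ψ' h Ψ g]
    ring
  rw [← hexpand]
  exact energyForm_self_nonneg α _ _

end

/-! ### Site functions times environmental functions -/

lemma weight_mul_ugrad_shift {v : Site → ℝ} (hv : SiteObservable v) (i : Fin 2) (f : Config → ℝ)
    (y : Lattice) (η : Config) :
    occTot 0 η * (1 - occTot (e i) η) * ugrad 0 (e i) (shift y fun η => v (η 0) * f η) η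
      = v (η y) * tagGrad (e i) 0 f y η
        + ((if y = e i then 1 else 0) - if y = 0 then 1 else 0)
          * (v (η 0) * (1 - occTot (e i) η) * shift (e i) f (exch 0 (e i) η)) := by
  have hvac := hv.mul_one_sub_tot (η (e i))
  have hocc := hv.mul_tot (η 0)
  rcases eq_or_ne y 0 with rfl | hy
  · rw [if_neg (e_ne_zero i).symm, if_pos rfl, tagGrad_zero]
    simp only [ugrad, shift, add_zero, zero_add, exch_left, occTot_eq]
    linear_combination ((η 0).tot * f (exch 0 (e i) η)) * hvac - (1 - (η (e i)).tot) * f η * hocc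
  rcases eq_or_ne y (e i) with rfl | hye
  · rw [if_pos rfl, if_neg hy, tagGrad_self hy]
    simp only [ugrad, shift, zero_add, exch_right, occTot_eq]
    linear_combination (-(η 0).tot * f (fun z => η (z + e i))) * hvac
      + (1 - (η (e i)).tot) * f (fun z => exch 0 (e i) η (z + e i)) * hocc
  · rw [if_neg hye, if_neg hy, tagGrad_of_ne hy hye]
    simp only [dgrad, ugrad, shift, zero_add, exch_of_ne hy hye]
    ring

lemma edgeGrad_site_mul {v : Site → ℝ} (hv : SiteObservable v) {f : Config → ℝ} (hf : IsLocal f)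
    {i : Fin 2} {X : Finset Lattice} (hX : ∀ y ∉ X, ∀ c η, tagGrad (e i) c f y η = 0) (c : ℝ)
    (η : Config) :
    edgeGrad i (c • v) (fun η => v (η 0) * f η) η
      = ∑ y ∈ X, v (η y) * tagGrad (e i) c f y η := by
  classical
  obtain ⟨Y, hY⟩ := IsLocal.exists_ugrad_shift_eq_zero ((hv.observable 0).isLocal.map₂ hf (· * ·))
    0 (e i)
  set Z := insert 0 (insert (e i) (X ∪ Y)) with hZ
  have hXZ : ∑ y ∈ X, v (η y) * tagGrad (e i) c f y η = ∑ y ∈ Z, v (η y) * tagGrad (e i) c f y η :=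
    Finset.sum_subset (fun y hy => by simp [hZ, hy]) fun y _ hy => by rw [hX y hy, mul_zero]
  have htag : ∀ y, tagGrad (e i) c f y η
      = tagGrad (e i) 0 f y η + if y = 0 then c * (1 - occTot (e i) η) else 0 := fun y => by
    simp only [tagGrad]
    split_ifs <;> ring
  rw [hXZ, edgeGrad, sumGrad_eq_sum (X := Z) fun y hy => hY y fun h => hy (by simp [hZ, h]),
    mul_add, Finset.mul_sum]
  simp only [weight_mul_ugrad_shift hv, htag, mul_add, Finset.sum_add_distrib, ← Finset.sum_mul,
    Finset.sum_sub_distrib, mul_ite, mul_zero, Finset.sum_ite_eq']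
  have hocc := hv.mul_tot (η 0)
  simp only [hZ, Finset.mem_insert, true_or, or_true, if_true, Pi.smul_apply, smul_eq_mul,
    occTot_eq]
  linear_combination c * (1 - (η (e i)).tot) * hocc

section
variable (α : GCParam) {Φ v : Site → ℝ}

/-- Distinct sites are orthogonal since `Φ` is centered. -/
lemma E_sum_site_mul_mul_sum_site_mul (hΦ : SiteObservable Φ) (hv : SiteObservable v)
    (hmean : α.mean Φ = 0) (X : Finset Lattice) {A B : Lattice → Config → ℝ}
    (hA : ∀ y, IsBlind (A y)) (hB : ∀ y, IsBlind (B y))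
    (hAfree : ∀ y η s, A y (Function.update η y s) = A y η)
    (hBfree : ∀ y η s, B y (Function.update η y s) = B y η) :
    α.E (fun η => (∑ y ∈ X, Φ (η y) * A y η) * ∑ z ∈ X, v (η z) * B z η)
      = α.mean (fun s => Φ s * v s) * ∑ y ∈ X, α.E (fun η => A y η * B y η) := by
  have hdiag : ∀ y, α.E (fun η => (Φ (η y) * A y η) * (v (η y) * B y η))
      = α.mean (fun s => Φ s * v s) * α.E (fun η => A y η * B y η) := fun y => by
    rw [← α.E_site_mul_of_update_eq (hΦ.mul hv) (x := y) ((hA y).mul (hB y)).observable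
      fun η s => by rw [hAfree, hBfree]]
    congr 1
    funext η
    ring
  have hoff : ∀ y z, z ≠ y → α.E (fun η => (Φ (η y) * A y η) * (v (η z) * B z η)) = 0 :=
    fun y z hzy => by
    have hK : Observable fun η => A y η * (v (η z) * B z η) :=
      (hA y).observable.mul ((hv.observable z).mul (hB z).observable)
    simp only [mul_assoc]
    rw [α.E_site_mul_of_occInvariant hΦ hK (((hA y).occInvariant y).mul
      ((occInvariant_site hzy v).mul ((hB z).occInvariant y))), hmean, zero_mul]
  have hobs : ∀ y z, Observable fun η => (Φ (η y) * A y η) * (v (η z) * B z η) := fun y z =>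
    ((hΦ.observable y).mul (hA y).observable).mul ((hv.observable z).mul (hB z).observable)
  simp only [Finset.sum_mul_sum]
  rw [α.E_sum X fun y _ => Observable.sum X fun z _ => hobs y z, Finset.mul_sum]
  refine Finset.sum_congr rfl fun y hy => ?_
  rw [α.E_sum X fun z _ => hobs y z, Finset.sum_eq_single_of_mem y hy fun z _ => hoff y z, hdiag]

lemma E_edgeGrad_mul_edgeGrad (hΦ : SiteObservable Φ) (hv : SiteObservable v)
    (hmean : α.mean Φ = 0) {f F : Config → ℝ} (hf : IsEnvironmental f) (hF : IsEnvironmental F)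
    (i : Fin 2) (c c' : ℝ) :
    α.E (fun η => edgeGrad i (c • Φ) (fun η => Φ (η 0) * f η) η
        * edgeGrad i (c' • v) (fun η => v (η 0) * F η) η)
      = α.mean (fun s => Φ s * v s) * α.E (tagDensity (e i) c f c' F) := by
  classical
  obtain ⟨X, hX⟩ := hf.isLocal.exists_tagGrad_eq_zero (e i)
  obtain ⟨Y, hY⟩ := hF.isLocal.exists_tagGrad_eq_zero (e i)
  have hX' : ∀ y ∉ X ∪ Y, ∀ c η, tagGrad (e i) c f y η = 0 := fun y hy =>
    hX y fun h => hy (Finset.mem_union_left Y h)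
  have hY' : ∀ y ∉ X ∪ Y, ∀ c η, tagGrad (e i) c F y η = 0 := fun y hy =>
    hY y fun h => hy (Finset.mem_union_right X h)
  have hfree : ∀ {h : Config → ℝ}, IsEnvironmental h → ∀ (c : ℝ) y η s,
      tagGrad (e i) c h y (Function.update η y s) = tagGrad (e i) c h y η := fun hh c y η s => by
    rw [tagGrad_update (e_ne_zero i), hh.freeze_eq]
  simp only [edgeGrad_site_mul hΦ hf.isLocal hX', edgeGrad_site_mul hv hF.isLocal hY']
  rw [E_sum_site_mul_mul_sum_site_mul α hΦ hv hmean (X ∪ Y) (fun y => hf.tagGrad (e i) c y)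
    (fun y => hF.tagGrad (e i) c' y) (hfree hf c) (hfree hF c'),
    funext (tagDensity_eq_sum (fun y hy => hX' y hy c) c' F),
    α.E_sum _ fun y _ => ((hf.tagGrad (e i) c y).mul (hF.tagGrad (e i) c' y)).observable]

lemma energyForm_site_mul (hΦ : SiteObservable Φ) (hv : SiteObservable v) (hmean : α.mean Φ = 0)
    {f F : Config → ℝ} (hf : IsEnvironmental f) (hF : IsEnvironmental F) (c b : Fin 2 → ℝ) :
    energyForm α (fun i => c i • Φ) (fun η => Φ (η 0) * f η) (fun i => b i • v)
      (fun η => v (η 0) * F η) = α.mean (fun s => Φ s * v s) * tagForm α c f b F := by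
  simp only [energyForm, E_edgeGrad_mul_edgeGrad α hΦ hv hmean hf hF, tagForm, Finset.mul_sum]

lemma energyForm_site_mul_zero (hΦ : SiteObservable Φ) (hmean : α.mean Φ = 0)
    {Ψ : Fin 2 → Site → ℝ} (hΨ : ∀ i, SiteObservable (Ψ i)) {f : Config → ℝ}
    (hf : IsEnvironmental f) (c : Fin 2 → ℝ) :
    energyForm α (fun i => c i • Φ) (fun η => Φ (η 0) * f η) Ψ (fun _ => 0)
      = tagForm α c f (fun i => α.mean fun s => Φ s * Ψ i s) (fun _ => 0) := by
  refine Finset.sum_congr rfl fun i _ => ?_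
  have h := E_edgeGrad_mul_edgeGrad α hΦ (hΨ i) hmean hf (isEnvironmental_const 0) i (c i) 1
  rw [← α.E_const_mul] at h
  simpa only [one_smul, mul_one, mul_zero, tagDensity_comm _ (c i) f, ← tagDensity_const_mul]
    using h

end

/-! ### The components along the environment of a particle -/

/-- The component of `(Ψ, h)` along the elements `(c • Φ, Φ(η_0) f)`, with `f` a function of the
environment, is represented by the pair `(x, G)` in the form of the tagged particle. -/
structure HasTagComponent (α : GCParam) (Φ : Site → ℝ) (Ψ : Fin 2 → Site → ℝ) (h : Config → ℝ)
    (x : Fin 2 → ℝ) (G : Config → ℝ) : Prop where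
  siteObservable : ∀ i, SiteObservable (Ψ i)
  observable : Observable h
  isEnvironmental : IsEnvironmental G
  energyForm_eq : ∀ c {f}, IsEnvironmental f →
    energyForm α (fun i => c i • Φ) (fun η => Φ (η 0) * f η) Ψ h = tagForm α c f x G

section
variable {α : GCParam} {Φ : Site → ℝ} {Ψ Ψ' : Fin 2 → Site → ℝ} {g h : Config → ℝ}
  {x y : Fin 2 → ℝ} {F G : Config → ℝ}

lemma HasTagComponent.add (hΦ : SiteObservable Φ) (hg : HasTagComponent α Φ Ψ g x F)
    (hh : HasTagComponent α Φ Ψ' h y G) :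
    HasTagComponent α Φ (Ψ + Ψ') (fun η => g η + h η) (x + y) fun η => F η + G η where
  siteObservable i := (hg.siteObservable i).add (hh.siteObservable i)
  observable := hg.observable.add hh.observable
  isEnvironmental := hg.isEnvironmental.add hh.isEnvironmental
  energyForm_eq c f hf := by
    have hcΦ : ∀ i, SiteObservable (c i • Φ) := fun i => hΦ.const_mul (c i)
    rw [energyForm_add_right α hcΦ hg.siteObservable hh.siteObservable
      ((hΦ.observable 0).mul hf.observable) hg.observable hh.observable, hg.energyForm_eq c hf,
      hh.energyForm_eq c hf, tagForm_add_right α hg.isEnvironmental.toIsBlind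
      hh.isEnvironmental.toIsBlind hf.toIsBlind]

lemma HasTagComponent.smul (hh : HasTagComponent α Φ Ψ h x G) (t : ℝ) :
    HasTagComponent α Φ (t • Ψ) (fun η => t * h η) (t • x) fun η => t * G η where
  siteObservable i := (hh.siteObservable i).const_mul t
  observable := hh.observable.const_mul t
  isEnvironmental := hh.isEnvironmental.const_mul t
  energyForm_eq c f hf := by
    rw [energyForm_smul_right, hh.energyForm_eq c hf, tagForm_smul_right]

lemma hasTagComponent_site (hΦ : SiteObservable Φ) (hmean : α.mean Φ = 0)
    (hΨ : ∀ i, SiteObservable (Ψ i)) :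
    HasTagComponent α Φ Ψ (fun _ => 0) (fun i => α.mean fun s => Φ s * Ψ i s) fun _ => 0 where
  siteObservable := hΨ
  observable := observable_const 0
  isEnvironmental := isEnvironmental_const 0
  energyForm_eq c _ hf := energyForm_site_mul_zero α hΦ hmean hΨ hf c

lemma exists_hasTagComponent_site_mul (hΦ : SiteObservable Φ) (hmean : α.mean Φ = 0)
    {v : Site → ℝ} (hv : SiteObservable v) (z : Lattice) (hF : IsBlind F) :
    ∃ G, HasTagComponent α Φ 0 (fun η => v (η z) * F η) 0 G := by
  set F₀ := freeze refParticle (shift (-z) F)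
  have hF₀ : IsEnvironmental F₀ := (hF.shift (-z)).isEnvironmental_freeze Site.forget_refParticle
  have hshift : shift z (fun η => v (η 0) * F₀ η) = fun η => v (η z) * F η := by
    have hfreeze : ∀ η : Config, v (η 0) * F₀ η = v (η 0) * shift (-z) F η := fun η => by
      by_cases hη : η 0 = Site.empty
      · rw [hη, hv.empty, zero_mul, zero_mul]
      · exact congrArg _ ((hF.shift (-z)).occInvariant 0 η hη)
    rw [funext hfreeze]
    funext η
    simp only [shift, zero_add, add_assoc, neg_add_cancel, add_zero]
  refine ⟨fun η => α.mean (fun s => Φ s * v s) * F₀ η, fun _ => siteObservable_zero,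
    (hv.observable z).mul hF.observable, hF₀.const_mul _, fun c f hf => ?_⟩
  have h := energyForm_site_mul α hΦ hv hmean hf hF₀ c 0
  rw [← tagForm_smul_right, smul_zero] at h
  rw [← h, ← hshift]
  simp only [energyForm, edgeGrad_shift, Pi.zero_apply, zero_smul]

lemma exists_hasTagComponent_of_mem_classT (hΦ : SiteObservable Φ) (hmean : α.mean Φ = 0)
    {ω : Angle → ℝ} (hω : IsC2 ω) (hh : h ∈ classT ω) :
    ∃ G, HasTagComponent α Φ 0 h 0 G := by
  have hzero : ∃ G, HasTagComponent α Φ 0 (fun _ => 0) 0 G := by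
    have h := (hasTagComponent_site hΦ hmean fun _ => siteObservable_zero).smul 0
    simp only [zero_smul, zero_mul] at h
    exact ⟨_, h⟩
  have hadd : ∀ g h : Config → ℝ, (∃ F, HasTagComponent α Φ 0 g 0 F) →
      (∃ G, HasTagComponent α Φ 0 h 0 G) → ∃ G, HasTagComponent α Φ 0 (g + h) 0 G := by
    rintro g h ⟨F, hF⟩ ⟨G, hG⟩
    exact ⟨_, add_zero (0 : Fin 2 → Site → ℝ) ▸ add_zero (0 : Fin 2 → ℝ) ▸ hF.add hΦ hG⟩
  induction hh using Submodule.span_induction with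
  | mem h hh =>
    obtain ⟨-, a, b, c, d, A, F, hF, rfl⟩ := hh
    have hsum : (fun η => ∑ x ∈ A, (a * occ .active x η + b * occ .passive x η
        + c * occAng .active ω x η + d * occAng .passive ω x η) * F x η)
        = ∑ x ∈ A, fun η => affineSite ω (Species.rec a b) (Species.rec c d) (η x) * F x η := by
      funext η
      rw [Finset.sum_apply]
      refine Finset.sum_congr rfl fun x _ => ?_
      simp only [affineSite, sum_species, occ, occAng]
      ring
    rw [hsum]
    exact Finset.sum_induction _ _ hadd hzero fun x _ => exists_hasTagComponent_site_mul hΦ hmean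
      (siteObservable_affineSite hω _ _) x (mem_blind_iff.1 (hF x))
  | zero => exact hzero
  | add g h _ _ hg hh => exact hadd g h hg hh
  | smul t h _ hh =>
    obtain ⟨G, hG⟩ := hh
    exact ⟨_, smul_zero t (A := Fin 2 → Site → ℝ) ▸ smul_zero t (A := Fin 2 → ℝ) ▸ hG.smul t⟩

lemma exists_hasTagComponent (hΦ : SiteObservable Φ) (hmean : α.mean Φ = 0)
    (hΨ : ∀ i, SiteObservable (Ψ i)) {ω : Angle → ℝ} (hω : IsC2 ω) (hh : h ∈ classT ω) :
    ∃ G, HasTagComponent α Φ Ψ h (fun i => α.mean fun s => Φ s * Ψ i s) G := by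
  obtain ⟨G, hG⟩ := exists_hasTagComponent_of_mem_classT hΦ hmean hω hh
  exact ⟨_, by simpa only [add_zero, zero_add] using (hasTagComponent_site hΦ hmean hΨ).add hΦ hG⟩

/-- Bessel's inequality, by Cauchy-Schwarz against the component itself. -/
lemma HasTagComponent.tagForm_self_le (hΦ : SiteObservable Φ) (hmean : α.mean Φ = 0)
    (hh : HasTagComponent α Φ Ψ h x G) :
    tagForm α x G x G ≤ α.mean (fun s => Φ s * Φ s) * energyForm α Ψ h Ψ h := by
  have hG := hh.isEnvironmental
  have hcs := energyForm_sq_le α (fun i => hΦ.const_mul (x i)) hh.siteObservable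
    ((hΦ.observable 0).mul hG.observable) hh.observable
  have hself := energyForm_site_mul α hΦ hΦ hmean hG hG x x
  have hcomp := hh.energyForm_eq x hG
  change energyForm α (fun i => x i • Φ) _ Ψ h ^ 2
    ≤ energyForm α (fun i => x i • Φ) _ (fun i => x i • Φ) _ * _ at hcs
  rw [hcomp, hself, mul_right_comm, sq] at hcs
  rcases (tagForm_self_nonneg α x G).eq_or_lt with hzero | hpos
  · rw [← hzero]
    exact mul_nonneg (integral_nonneg fun s => mul_self_nonneg _) (energyForm_self_nonneg α Ψ h)
  · exact le_of_mul_le_mul_right hcs hpos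

end

/-! ### Correctors -/

section
variable (α : GCParam)

lemma tagForm_sub_sq_le {δ : ℝ} (hδ : 0 ≤ δ) {i : Fin 2} {f : Config → ℝ} (hf : IsBlind f)
    (hle : tagForm α (Pi.single i 1) f (Pi.single i 1) f ≤ ds α.total + δ) (x : Fin 2 → ℝ)
    {G : Config → ℝ} (hG : IsBlind G) :
    (tagForm α (Pi.single i 1) f x G - ds α.total * x i) ^ 2 ≤ δ * tagForm α x G x G := by
  have hperturb : (tagForm α (Pi.single i 1) f x G - ds α.total * x i) ^ 2
      ≤ δ * (tagForm α x G x G - ds α.total * (x 0 ^ 2 + x 1 ^ 2)) := by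
    refine sq_le_mul_of_forall_nonneg fun t => ?_
    have hmin := ds_mul_le_tagForm α (Pi.single i 1 + t • x) (hf.add (hG.const_mul t))
    have hexpand := tagForm_smul_add_smul α hf hG (Pi.single i 1) x 1 t
    simp only [one_smul, one_mul, one_pow, mul_one] at hexpand
    have hnorm : (Pi.single i 1 + t • x : Fin 2 → ℝ) 0 ^ 2
        + (Pi.single i 1 + t • x : Fin 2 → ℝ) 1 ^ 2
        = 1 + 2 * t * x i + t ^ 2 * (x 0 ^ 2 + x 1 ^ 2) := by
      fin_cases i <;> simp <;> ring
    rw [hexpand, hnorm] at hmin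
    linarith
  refine hperturb.trans (mul_le_mul_of_nonneg_left (sub_le_self _ ?_) hδ)
  exact mul_nonneg (ds_nonneg α) (by positivity)

lemma exists_corrector {ω : Angle → ℝ} (hω : IsC2 ω) {c d : Species → ℝ}
    (hmean : α.mean (affineSite ω c d) = 0) (i : Fin 2) {δ : ℝ} (hδ : 0 < δ) :
    ∃ g ∈ classT0 ω, Observable g ∧ ∀ Ψ : Fin 2 → Site → ℝ, (∀ k, SiteObservable (Ψ k)) →
      ∀ h ∈ classT ω,
        (energyForm α (fun k => (Pi.single i 1 : Fin 2 → ℝ) k • affineSite ω c d) g Ψ h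
          - ds α.total * α.mean (fun s => affineSite ω c d s * Ψ i s)) ^ 2
          ≤ δ * energyForm α Ψ h Ψ h := by
  set Φ := affineSite ω c d
  have hΦ : SiteObservable Φ := siteObservable_affineSite hω c d
  set K := α.mean fun s => Φ s * Φ s
  have hK : 0 ≤ K := integral_nonneg fun s => mul_self_nonneg _
  have hδK : 0 < δ / (K + 1) := by positivity
  obtain ⟨f, hf, hmem, hle⟩ := exists_nearMinimizer α hω c d i hδK
  refine ⟨_, hmem, (hΦ.observable 0).mul hf.observable, fun Ψ hΨ h hh => ?_⟩
  obtain ⟨G, hG⟩ := exists_hasTagComponent hΦ hmean hΨ hω hh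
  set x : Fin 2 → ℝ := fun k => α.mean fun s => Φ s * Ψ k s
  have hbessel : tagForm α x G x G ≤ (K + 1) * energyForm α Ψ h Ψ h :=
    (hG.tagForm_self_le hΦ hmean).trans
      (mul_le_mul_of_nonneg_right (by linarith) (energyForm_self_nonneg α Ψ h))
  rw [hG.energyForm_eq (Pi.single i 1) hf]
  calc (tagForm α (Pi.single i 1) f x G - ds α.total * x i) ^ 2
      ≤ δ / (K + 1) * tagForm α x G x G :=
        tagForm_sub_sq_le α hδK.le hf.toIsBlind hle x hG.isEnvironmental.toIsBlind
    _ ≤ δ / (K + 1) * ((K + 1) * energyForm α Ψ h Ψ h) :=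
        mul_le_mul_of_nonneg_left hbessel hδK.le
    _ = δ * energyForm α Ψ h Ψ h := by
        rw [← mul_assoc, div_mul_cancel₀ _ (by positivity)]

end

/-! ### Vanishing modulo the generator -/

/-- The functions `∑_σ η_0^{σ,Φ σ i}` of one site attached to the current `∑_σ ∑_i j_i^{σ,Φ σ i}`;
for `Φ = affineAng ω c d` they are affine site functions by definition. -/
def angSite (Φ : Species → Fin 2 → Angle → ℝ) (i : Fin 2) (s : Site) : ℝ :=
  ∑ σ, Φ σ i s.angle * s.num σ

lemma sum_num_mul_sq (Φ : Species → Fin 2 → Angle → ℝ) (i : Fin 2) (t : ℝ) (s : Site) :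
    ∑ σ, s.num σ * (Φ σ i s.angle + t) ^ 2 = (s.tot * (angSite Φ i s + t)) ^ 2 := by
  rcases s with _ | ⟨τ, θ⟩
  · simp [Site.num]
  · simp [Site.num, angSite]

section
variable {α : GCParam}

lemma energy_eq_energyForm {Φ : Species → Fin 2 → Angle → ℝ}
    (hΦ : ∀ σ i, SiteObservable fun s => Φ σ i s.angle * s.num σ) {h : Config → ℝ}
    (hh : Observable h) : energy α Φ h = energyForm α (angSite Φ) h (angSite Φ) h := by
  have hnum : ∀ (σ : Species) (s : Site) (a t : ℝ),
      s.num σ * (a + t) ^ 2 = (a * s.num σ + s.num σ * t) ^ 2 := by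
    rintro σ (_ | ⟨τ, θ⟩) a t
    · simp [Site.num]
    · by_cases h : τ = σ <;> simp [Site.num, h]
  have hobs : ∀ σ i, Observable fun η => occ σ 0 η * (1 - occTot (e i) η) *
      (Φ σ i (η 0).angle + sumGrad i h η) ^ 2 := fun σ i => by
    simp only [occ, mul_right_comm _ (1 - occTot (e i) _), hnum]
    exact ((((hΦ σ i).observable 0).add (((siteObservable_num σ).observable 0).mul
      (hh.sumGrad i))).pow_two).mul (observable_vacancy (e i))
  rw [energy, Finset.sum_comm, energyForm]
  refine Finset.sum_congr rfl fun i _ => ?_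
  refine (α.E_sum Finset.univ fun σ _ => hobs σ i).symm.trans (congrArg α.E (funext fun η => ?_))
  have hvac : (1 - occTot (e i) η) * (1 - occTot (e i) η) = 1 - occTot (e i) η := by
    rw [occTot_eq]
    linear_combination (η (e i)).tot_mul_self
  simp only [occ, mul_right_comm _ (1 - occTot (e i) η), ← Finset.sum_mul, sum_num_mul_sq,
    edgeGrad, occTot_eq 0]
  linear_combination (-((η 0).tot * (angSite Φ i (η 0) + sumGrad i h η)) ^ 2) * hvac

/-- The pairing of `φ` with `j + 𝓛 h` has finitely many non-zero terms, with sum `r`; here `Ψ i` is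
the function of one site attached to `j` in the direction `i`. -/
def HasPairing (α : GCParam) (φ : Config → ℝ) (Ψ : Fin 2 → Site → ℝ) (h : Config → ℝ) (r : ℝ) :
    Prop :=
  ∃ (s : ℝ) (t : Fin 2 → ℝ), HasPairSum α φ (fun x => shift x h) s ∧
    (∀ k, HasPairSum α φ (fun x η => (x k : ℝ) * Ψ k (η x)) (t k)) ∧ -(s + ∑ k, t k) = r

lemma HasPairing.pairing_eq {φ h : Config → ℝ} {Φ : Species → Fin 2 → Angle → ℝ} {r : ℝ}
    (hr : HasPairing α φ (angSite Φ) h r) : pairing α φ Φ h = r := by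
  obtain ⟨s, t, hs, ht, rfl⟩ := hr
  rw [pairing, hs.2]
  congr 2
  refine Finset.sum_congr rfl fun k _ => ?_
  rw [← (ht k).2]
  refine finsum_congr fun x => ?_
  rw [← α.E_const_mul]
  exact congrArg α.E (funext fun η => mul_left_comm _ _ _)

section
variable {φ ψ g h : Config → ℝ} {Ψ : Fin 2 → Site → ℝ} {v : Site → ℝ} {r s : ℝ}

lemma HasPairing.add (hΨ : ∀ k, SiteObservable (Ψ k)) (hh : Observable h) (hφ : Observable φ)
    (hψ : Observable ψ) (hr : HasPairing α φ Ψ h r) (hs : HasPairing α ψ Ψ h s) :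
    HasPairing α (fun η => φ η + ψ η) Ψ h (r + s) := by
  obtain ⟨a, b, ha, hb, rfl⟩ := hr
  obtain ⟨a', b', ha', hb', rfl⟩ := hs
  refine ⟨a + a', b + b', ha.add hφ hψ (fun x => hh.shift x) ha', fun k =>
    (hb k).add hφ hψ (fun x => ((hΨ k).observable x).const_mul _) (hb' k), ?_⟩
  simp only [Pi.add_apply, Finset.sum_add_distrib]
  ring

lemma HasPairing.const_mul (c : ℝ) (hr : HasPairing α φ Ψ h r) :
    HasPairing α (fun η => c * φ η) Ψ h (c * r) := by
  obtain ⟨a, b, ha, hb, rfl⟩ := hr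
  refine ⟨c * a, fun k => c * b k, ha.const_mul c, fun k => (hb k).const_mul c, ?_⟩
  rw [← Finset.mul_sum]
  ring

lemma edgeGrad_mul_edgeGrad (i : Fin 2) (v w : Site → ℝ) (g h : Config → ℝ) (η : Config) :
    edgeGrad i v g η * edgeGrad i w h η = (v (η 0) + sumGrad i g η) * edgeGrad i w h η := by
  have hocc := (η 0).tot_mul_self
  have hvac := (η (e i)).tot_mul_self
  simp only [edgeGrad, occTot_eq]
  linear_combination (v (η 0) + sumGrad i g η) * (w (η 0) + sumGrad i h η) *
    ((1 - (η (e i)).tot) ^ 2 * hocc + (η 0).tot * hvac)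

lemma E_mul_edgeGrad (hΨ : ∀ k, SiteObservable (Ψ k)) (hh : Observable h) {K : Config → ℝ}
    (hK : Observable K) (i : Fin 2) :
    α.E (fun η => K η * edgeGrad i (Ψ i) h η)
      = α.E (fun η => K η * (occTot 0 η * (1 - occTot (e i) η) * sumGrad i h η))
        + ∑ k, α.E (fun η => K η * if i = k then Ψ k (η 0) * (1 - occTot (e i) η) else 0) := by
  have hif : ∀ k, Observable fun η => K η * if i = k then Ψ k (η 0) * (1 - occTot (e i) η) else 0 :=
    fun k => hK.mul ((hasDirectedGrad_linear (hΨ k) k).observable_grad i)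
  rw [← α.E_sum _ fun k _ => hif k,
    ← α.E_add (hK.mul ((hasDirectedGrad_shift hh).observable_grad i))
      (Observable.sum _ fun k _ => hif k)]
  congr 1
  funext η
  have hocc := (hΨ i).mul_tot (η 0)
  rw [← Finset.mul_sum, Finset.sum_ite_eq, if_pos (Finset.mem_univ i), edgeGrad, occTot_eq 0]
  linear_combination K η * (1 - occTot (e i) η) * hocc

lemma hasPairing_siteCurrent (hΨ : ∀ k, SiteObservable (Ψ k)) (hh : Observable h)
    (hv : SiteObservable v) (i : Fin 2) :
    HasPairing α (siteCurrent v i) Ψ h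
      (energyForm α (fun k => (Pi.single i 1 : Fin 2 → ℝ) k • v) (fun _ => 0) Ψ h) := by
  refine ⟨_, _, (hasDirectedGrad_shift hh).hasPairSum_siteCurrent hv i,
    fun k => (hasDirectedGrad_linear (hΨ k) k).hasPairSum_siteCurrent hv i, ?_⟩
  rw [Finset.sum_neg_distrib, ← neg_add, neg_neg, ← E_mul_edgeGrad hΨ hh (hv.observable 0),
    energyForm, Finset.sum_eq_single_of_mem i (Finset.mem_univ i)]
  · simp only [edgeGrad_mul_edgeGrad, sumGrad_zero, Pi.single_eq_same, one_smul, add_zero]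
  · intro k _ hk
    simp only [edgeGrad_mul_edgeGrad, sumGrad_zero, Pi.single_eq_of_ne hk, zero_smul,
      Pi.zero_apply, add_zero, zero_mul, α.E_const]

lemma hasPairing_gen (hΨ : ∀ k, SiteObservable (Ψ k)) (hh : Observable h) (hg : Observable g) :
    HasPairing α (gen g) Ψ h (energyForm α 0 g Ψ h) := by
  refine ⟨_, _, (hasDirectedGrad_shift hh).hasPairSum_gen hg,
    fun k => (hasDirectedGrad_linear (hΨ k) k).hasPairSum_gen hg, ?_⟩
  rw [Finset.sum_neg_distrib, ← neg_add, neg_neg, Finset.sum_comm, ← Finset.sum_add_distrib]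
  refine Finset.sum_congr rfl fun i _ => ?_
  rw [← E_mul_edgeGrad hΨ hh (hg.sumGrad i)]
  simp only [edgeGrad_mul_edgeGrad, Pi.zero_apply, zero_add]

lemma hasPairing_siteGrad (hΨ : ∀ k, SiteObservable (Ψ k)) (hh : Observable h)
    (hv : SiteObservable v) (i : Fin 2) :
    HasPairing α (siteGrad v i) Ψ h
      (α.mean v * α.mean (Ψ i) - α.mean fun s => v s * Ψ i s) := by
  refine ⟨_, _, hasPairSum_siteGrad_shift hv i hh,
    fun k => hasPairSum_siteGrad_linear hv (hΨ k) i k, ?_⟩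
  rw [Finset.sum_ite_eq, if_pos (Finset.mem_univ i)]
  ring

end

section
variable {ω : Angle → ℝ}

lemma observable_of_mem_classT (hω : IsC2 ω) {h : Config → ℝ} (hh : h ∈ classT ω) :
    Observable h := by
  obtain ⟨G, hG⟩ := exists_hasTagComponent_of_mem_classT (α := GCParam.ofDensity 0)
    siteObservable_zero (integral_zero _ _) hω hh
  exact hG.observable

lemma seminormSq_nonneg (φ : Config → ℝ) : 0 ≤ seminormSq α ω φ := by
  refine le_iSup_of_le 0 (le_iSup_of_le 0 (le_iSup_of_le 0 ?_))
  have hpairing : pairing α φ (affineAng ω 0 0) ((0 : classT0 ω) : Config → ℝ) = 0 := by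
    simp [pairing, affineAng, occAng, shift, α.E_const]
  have henergy : energy α (affineAng ω 0 0) ((0 : classT0 ω) : Config → ℝ) = 0 := by
    simp [energy, affineAng, shift, ugrad, α.E_const]
  rw [hpairing, henergy]
  simp

lemma pairing_eq_energyForm_sub {Φ : Site → ℝ} (hΦ : SiteObservable Φ) (hmean : α.mean Φ = 0)
    (i : Fin 2) (t : ℝ) {A : Species → Fin 2 → Angle → ℝ} (hA : ∀ k, SiteObservable (angSite A k))
    {g h : Config → ℝ} (hg : Observable g) (hh : Observable h) :
    pairing α (siteCurrent Φ i + t • siteGrad Φ i + gen g) A h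
      = energyForm α (fun k => (Pi.single i 1 : Fin 2 → ℝ) k • Φ) g (angSite A) h
        - t * α.mean (fun s => Φ s * angSite A i s) := by
  set S : Fin 2 → Site → ℝ := fun k => (Pi.single i 1 : Fin 2 → ℝ) k • Φ
  have hS : ∀ k, SiteObservable (S k) := fun k => hΦ.const_mul _
  have hcurrent := hasPairing_siteCurrent (α := α) hA hh hΦ i
  have hgrad := (hasPairing_siteGrad (α := α) hA hh hΦ i).const_mul t
  have hobs := (hΦ.siteCurrent i).add ((hΦ.siteGrad i).const_mul t)
  have hsum := (hcurrent.add hA hh (hΦ.siteCurrent i) ((hΦ.siteGrad i).const_mul t) hgrad).add hA hh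
    hobs hg.gen (hasPairing_gen hA hh hg)
  have hsplit : energyForm α S g (angSite A) h
      = energyForm α S (fun _ => 0) (angSite A) h + energyForm α 0 g (angSite A) h := by
    have hadd := energyForm_add_right α (Ψ' := S) (Ψ'' := 0) hA hS (fun _ => siteObservable_zero) hh
      (observable_const 0) hg
    simpa only [add_zero, zero_add, energyForm_comm α (angSite A) h] using hadd
  refine hsum.pairing_eq.trans ?_
  rw [hsplit, hmean]
  ring

lemma exists_seminormSq_le (hω : IsC2 ω) {c d : Species → ℝ}
    (hmean : α.mean (affineSite ω c d) = 0) (i : Fin 2) {δ : ℝ} (hδ : 0 < δ) :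
    ∃ g : classT0 ω, seminormSq α ω (siteCurrent (affineSite ω c d) i
      + ds α.total • siteGrad (affineSite ω c d) i + gen g) ≤ (δ : EReal) := by
  obtain ⟨g, hg, hgobs, hbound⟩ := exists_corrector α hω hmean i hδ
  refine ⟨⟨g, hg⟩, iSup_le fun a => iSup_le fun b => iSup_le fun h => EReal.coe_le_coe_iff.2 ?_⟩
  have hh : Observable (h : Config → ℝ) := observable_of_mem_classT hω h.2.2
  have hA : ∀ k, SiteObservable (angSite (affineAng ω a b) k) := fun k =>
    siteObservable_affineSite hω (a · k) (b · k)
  have henergy : energy α (affineAng ω a b) h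
      = energyForm α (angSite (affineAng ω a b)) h (angSite (affineAng ω a b)) h :=
    energy_eq_energyForm (fun σ k => hω.siteObservable_affine (a σ k) (b σ k) σ) hh
  have hsq := hbound _ hA h h.2.2
  have hnonneg := energyForm_self_nonneg α (angSite (affineAng ω a b)) h
  rw [← pairing_eq_energyForm_sub (siteObservable_affineSite hω c d) hmean i _ hA hgobs hh,
    ← henergy] at hsq
  rw [← henergy] at hnonneg
  set P := pairing α _ (affineAng ω a b) h
  set En := energy α (affineAng ω a b) h
  have habs : |2 * P| ≤ δ + En :=
    abs_le_of_sq_le_sq (by linarith [sq_nonneg (δ - En)]) (by linarith)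
  linarith [le_abs_self (2 * P)]

lemma gen_neg (g : Config → ℝ) : gen (-g) = -gen g := by
  funext η
  simp only [gen, Pi.neg_apply, ← finsum_neg_distrib, ← Finset.sum_neg_distrib, dgrad, ugrad]
  exact finsum_congr fun x => Finset.sum_congr rfl fun i _ => by ring

lemma vanishesModGen_of_mean_eq_zero (hω : IsC2 ω) {c d : Species → ℝ}
    (hmean : α.mean (affineSite ω c d) = 0) (i : Fin 2) :
    VanishesModGen α ω (siteCurrent (affineSite ω c d) i
      + ds α.total • siteGrad (affineSite ω c d) i) := by
  refine ⟨le_antisymm ?_ (le_iInf fun g => seminormSq_nonneg _), (classT0 ω).add_mem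
    (siteCurrent_mem_classT0 hω c d i)
    ((classT0 ω).smul_mem _ (siteGrad_mem_classT0 hω c d i)), ?_⟩
  · refine EReal.le_of_forall_lt_iff_le.1 fun δ hδ => ?_
    obtain ⟨g, hg⟩ := exists_seminormSq_le hω hmean i (EReal.coe_pos.1 hδ)
    exact (iInf_le _ g).trans hg
  · choose g hg using fun n : ℕ => exists_seminormSq_le hω hmean i (Nat.one_div_pos_of_nat (n := n))
    have hlim : Tendsto (fun n : ℕ => ((1 / ((n : ℝ) + 1) : ℝ) : EReal)) atTop (𝓝 0) :=
      (continuous_coe_real_ereal.tendsto 0).comp tendsto_one_div_add_atTop_nhds_zero_nat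
    refine ⟨fun n => -g n, tendsto_of_tendsto_of_tendsto_of_le_of_le tendsto_const_nhds hlim
      (fun n => seminormSq_nonneg _) fun n => ?_⟩
    simpa only [Submodule.coe_neg, gen_neg, sub_neg_eq_add] using hg n

lemma vanishesModGen_affineSite (hω : IsC2 ω) (c d : Species → ℝ) (i : Fin 2) :
    VanishesModGen α ω (siteCurrent (affineSite ω c d) i
      + ds α.total • siteGrad (affineSite ω c d) i
      + (α.mean (affineSite ω c d) * crossD α.total) • siteGrad Site.tot i) := by
  set v := affineSite ω c d
  have hv : SiteObservable v := siteObservable_affineSite hω c d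
  set m := α.mean v / α.total with hm
  have hmean : α.mean v = m * α.total ∧ α.mean v * crossD α.total = m * (1 - ds α.total) := by
    by_cases h : α.total = 0
    · simp [hm, h, α.mean_eq_zero_of_total hv h]
    · rw [crossD, if_neg h, hm]
      constructor <;> field_simp
  have hcenter : affineSite ω (fun σ => c σ - m) d = fun s => v s + -m * s.tot := by
    funext s
    simp only [v, affineSite, Site.tot, sum_species]
    ring
  have hcentered : α.mean (affineSite ω (fun σ => c σ - m) d) = 0 := by
    rw [hcenter, α.mean_add hv (siteObservable_tot.const_mul (-m)), α.mean_const_mul, α.mean_tot,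
      hmean.1]
    ring
  convert vanishesModGen_of_mean_eq_zero hω hcentered i using 1
  rw [hcenter, hmean.2]
  funext η
  -- The total current is `-δ_i η`, by exclusion.
  simp only [siteCurrent, siteGrad, Pi.add_apply, Pi.smul_apply, smul_eq_mul, occTot_eq]
  ring

lemma E_occAng_eq_mean (hω : IsC2 ω) (σ : Species) :
    α.E (occAng σ ω 0) = α.mean fun s => ω s.angle * s.num σ :=
  α.E_site (hω.siteObservable σ) 0

lemma vanishesModGen_species (hω : IsC2 ω) (σ : Species) (a b : ℝ) (i : Fin 2) {κ : ℝ}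
    (hκ : (a * α.density σ + b * α.E (occAng σ ω 0)) * crossD α.total = κ) :
    VanishesModGen α ω ((a • current1 σ i + b • current σ ω i)
      + ds α.total • (a • locGrad σ i + b • locGradAng σ ω i) + κ • locGradTot i) := by
  have hv : affineSite ω (Pi.single σ a) (Pi.single σ b)
      = fun s => a * s.num σ + b * (ω s.angle * s.num σ) := by
    funext s
    rw [affineSite, Finset.sum_eq_single_of_mem σ (Finset.mem_univ σ) fun τ _ hτ => by simp [hτ],
      Pi.single_eq_same, Pi.single_eq_same]
    ring
  have hmean : α.mean (affineSite ω (Pi.single σ a) (Pi.single σ b))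
      = a * α.density σ + b * α.E (occAng σ ω 0) := by
    rw [hv, α.mean_add ((siteObservable_num σ).const_mul a) ((hω.siteObservable σ).const_mul b),
      α.mean_const_mul, α.mean_const_mul, α.mean_num, E_occAng_eq_mean hω]
  convert vanishesModGen_affineSite (α := α) hω (Pi.single σ a) (Pi.single σ b) i using 1
  rw [hmean, hκ, hv]
  funext η
  simp only [siteCurrent, siteGrad, Pi.add_apply, Pi.smul_apply, smul_eq_mul, current1, current,
    locGrad, locGradAng, locGradTot, occAng, occ, occTot_eq]
  ring

lemma E_occAng_eq_angMean_mul (hω : IsC2 ω) (σ : Species) :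
    α.E (occAng σ ω 0) = α.angMean σ ω * α.density σ := by
  have hocc : α.E (occ σ 0) = α.density σ :=
    (α.E_site (siteObservable_num σ) 0).trans (α.mean_num σ)
  rw [GCParam.angMean, hocc]
  by_cases h : α.density σ = 0
  · have hzero : ∀ τ, ∫ θ, ω θ * Site.num σ (Site.particle τ θ) ∂α.meas τ = 0 := fun τ => by
      by_cases hτ : τ = σ
      · rw [hτ, α.meas_eq_zero_of_density h, integral_zero_measure]
      · simp [Site.num, hτ]
    rw [h, mul_zero, E_occAng_eq_mean hω, α.mean_eq_sum_integral (hω.siteObservable σ)]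
    exact Finset.sum_eq_zero fun τ _ => hzero τ
  · field_simp

end

end

end APLG

end

theorem proposition4p5 (ω : APLG.Angle → ℝ) (hω : APLG.IsC2 ω) (α : APLG.GCParam) (i : Fin 2) :
    (∀ σ : APLG.Species,
      APLG.VanishesModGen α ω (APLG.current1 σ i + APLG.ds α.total • APLG.locGrad σ i
        + (α.density σ * APLG.crossD α.total) • APLG.locGradTot i)) ∧
    (∀ σ : APLG.Species,
      APLG.VanishesModGen α ω (APLG.centeredCurrent α σ ω i
        + APLG.ds α.total • APLG.centeredLocGrad α σ ω i)) ∧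
    APLG.VanishesModGen α ω (APLG.current .active ω i
      + APLG.ds α.total • APLG.locGradAng .active ω i
      + APLG.frakD α ω • APLG.locGradTot i) := by
  refine ⟨fun σ => ?_, fun σ => ?_, ?_⟩
  · have h := APLG.vanishesModGen_species (α := α) hω σ 1 0 i rfl
    simpa only [one_mul, zero_mul, add_zero, one_smul, zero_smul] using h
  · have h := APLG.vanishesModGen_species (α := α) hω σ (-α.angMean σ ω) 1 i (κ := 0)
      (by rw [APLG.E_occAng_eq_angMean_mul hω]; ring)
    convert h using 1
    simp only [APLG.centeredCurrent, APLG.centeredLocGrad]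
    module
  · have h := APLG.vanishesModGen_species (α := α) hω .active 0 1 i (κ := APLG.frakD α ω)
      (by rw [APLG.frakD]; ring)
    simpa only [one_smul, zero_smul, zero_add] using h
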